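/- **Theorem (Continuation criterion).** Let $\mathbb{T}=(-\pi,\pi]$ be the torus of length $2\pi$, let $a,p,q\in\mathbb{R}$, let $k\ge 1$ be an integer, and consider the 1-D MHD system $$\omega^+_t + a u^-\omega^+_\theta = p\,\omega^+H\omega^- + q\,\omega^-H\omega^+,\qquad \omega^-_t + a u^+\omega^-_\theta = p\,\omega^-H\omega^+ + q\,\omega^+H\omega^-,$$ where $Hf(\theta)=\frac{1}{2\pi}\,\mathrm{p.v.}\int_{-\pi}^{\pi}\cot\left(\frac{\theta-\vartheta}{2}\right)f(\vartheta)\,d\vartheta$ is the Hilbert transform on $\mathbb{T}$ and $u^\pm$ is determined by $u^\pm_\theta = H\omega^\pm$ and $u^\pm(0,t)=0$. For $T\in(0,\infty]$, an $H^k$ solution on $[0,T)$ with real-valued initial data $\omega_0^\pm\in H^k(\mathbb{T})$ is a pair $\omega^\pm\in C([0,T);H^k(\mathbb{T}))\cap \mathrm{Lip}_{\mathrm{loc}}([0,T);H^{k-1}(\mathbb{T}))$ with $\omega^\pm(0)=\omega_0^\pm$ that satisfies the system, with time derivatives taken in $L^2(\mathbb{T})$; it is maximal, with maximal existence time $T$,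 if it is not the restriction to $[0,T)$ of an $H^k$ solution on $[0,T')$ with the same initial data for any $T'>T$. Let $\omega^\pm_0\in H^k(\mathbb{T})$, and let $\omega^\pm$ be a maximal $H^k$ solution with initial data $\omega_0^\pm$ and maximal existence time $T^\ast\in(0,\infty]$. Then either $T^\ast=\infty$ or $$\int_0^{T^\ast}\left(\lVert\omega^+\rVert_{L^\infty}+\lVert\omega^-\rVert_{L^\infty}+\lVert H\omega^+\rVert_{L^\infty}+\lVert H\omega^-\rVert_{L^\infty}\right)dt=\infty .$$ -/

import Mathlib

open MeasureTheory Filter Topology Set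
open scoped Real ENNReal ContDiff

noncomputable section

namespace MHD

instance factTwoPiPos : Fact ((0 : ℝ) < 2 * π) := ⟨Real.two_pi_pos⟩

/-- The torus `ℝ / 2πℤ`, with Lebesgue measure `volume` of total mass `2π`. -/
abbrev Torus : Type := AddCircle (2 * π)

/-- Real-valued `L²` on the torus. -/
abbrev L2 : Type := Lp ℝ 2 (volume : Measure Torus)

/-- `g` is the weak derivative `f_θ`: `∫ f φ' = - ∫ g φ` for all smooth `2π`-periodic `φ`. -/
def IsWeakDeriv (f g : L2) : Prop :=
  ∀ φ : ℝ → ℝ, ContDiff ℝ ∞ φ → Function.Periodic φ (2 * π) →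
    ∫ x in (-π)..π, f (x : Torus) * deriv φ x = -∫ x in (-π)..π, g (x : Torus) * φ x

open Classical in
/-- The weak derivative of `f` (and `0` if `f` has no weak derivative in `L²`). -/
def weakDeriv (f : L2) : L2 :=
  if h : ∃ g, IsWeakDeriv f g then h.choose else 0

/-- `f ∈ H^k`: the weak derivatives of `f` up to order `k` exist in `L²`. -/
def MemH : ℕ → L2 → Prop
  | 0, _ => True
  | k + 1, f => ∃ g, IsWeakDeriv f g ∧ MemH k g

/-- The `H^k` norm `(∑_{j ≤ k} ‖∂_θ^j f‖_{L²}²)^{1/2}`, meaningful for `f ∈ H^k`. -/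
def hNorm (k : ℕ) (f : L2) : ℝ :=
  √(∑ j ∈ Finset.range (k + 1), ‖weakDeriv^[j] f‖ ^ 2)

/-- The Hilbert transform
`Hf(θ) = (1/2π) p.v. ∫ cot((θ - ϑ)/2) f(ϑ) dϑ`, written with `s = θ - ϑ`. -/
def hilbert (f : Torus → ℝ) (θ : Torus) : ℝ :=
  limUnder (𝓝[>] (0 : ℝ)) fun ε : ℝ =>
    (2 * π)⁻¹ * ∫ s in {s : ℝ | ε < |s| ∧ |s| < π}, Real.cot (s / 2) * f (θ - (s : Torus))

/-- The velocity `u` with `u_θ = Hf` and `u(0) = 0`, computed at the representative of `θ` in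
`(-π, π]`. (The choice of representative is immaterial because `Hf` has mean zero.) -/
def velocity (f : Torus → ℝ) : Torus → ℝ :=
  AddCircle.liftIoc (2 * π) (-π) fun x : ℝ => ∫ y in (0 : ℝ)..x, hilbert f (y : Torus)

/-- The right-hand side `p f Hg + q g Hf - a u(g) f_θ` of the evolution equation of `f`. -/
def rhs (a p q : ℝ) (f g : L2) (θ : Torus) : ℝ :=
  p * f θ * hilbert g θ + q * g θ * hilbert f θ - a * velocity g θ * weakDeriv f θ

/-- The time interval `[0, T)`, where `T` may be `∞`. -/
def timeInterval (T : EReal) : Set ℝ := {t : ℝ | 0 ≤ t ∧ (t : EReal) < T}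

/-- `w ∈ C([0, T); H^k)`. -/
def IsContH (k : ℕ) (T : EReal) (w : ℝ → L2) : Prop :=
  (∀ t ∈ timeInterval T, MemH k (w t)) ∧
    ∀ t ∈ timeInterval T,
      Tendsto (fun s => hNorm k (w s - w t)) (𝓝[timeInterval T] t) (𝓝 0)

/-- `w ∈ Lip([0, T); H^m)`, in the local sense: `w` is Lipschitz on every `[0, T']`, `T' < T`. -/
def IsLipH (m : ℕ) (T : EReal) (w : ℝ → L2) : Prop :=
  (∀ t ∈ timeInterval T, MemH m (w t)) ∧
    ∀ T' ∈ timeInterval T, ∃ C : ℝ, ∀ s ∈ Icc 0 T', ∀ t ∈ Icc 0 T',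
      hNorm m (w t - w s) ≤ C * |t - s|

/-- `w_t = rhs a p q w z` on `[0, T)`: at every time the derivative exists in `L²` and agrees with
the right-hand side almost everywhere on the torus (one-sided derivative at `t = 0`). -/
def SolvesEq (a p q : ℝ) (T : EReal) (w z : ℝ → L2) : Prop :=
  ∀ t ∈ timeInterval T, ∃ F : L2,
    HasDerivWithinAt w F (timeInterval T) t ∧ F =ᵐ[volume] rhs a p q (w t) (z t)

/-- `(wp, wm) = (ω⁺, ω⁻)` is an `H^k` solution on `[0, T)`, `0 < T ≤ ∞`, of the Cauchy problem for
the 1-D MHD system with initial data `(wp₀, wm₀)`. -/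
structure IsSolution (a p q : ℝ) (k : ℕ) (wp₀ wm₀ : L2) (T : EReal) (wp wm : ℝ → L2) :
    Prop where
  pos : 0 < T
  init_p : wp 0 = wp₀
  init_m : wm 0 = wm₀
  cont_p : IsContH k T wp
  cont_m : IsContH k T wm
  lip_p : IsLipH (k - 1) T wp
  lip_m : IsLipH (k - 1) T wm
  eq_p : SolvesEq a p q T wp wm
  eq_m : SolvesEq a p q T wm wp

/-- `(wp, wm)` is a maximal `H^k` solution with maximal existence time `T`: it is a solution on
`[0, T)` and is not the restriction of a solution on a longer interval `[0, T')`. -/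
def IsMaximalSolution (a p q : ℝ) (k : ℕ) (wp₀ wm₀ : L2) (T : EReal) (wp wm : ℝ → L2) : Prop :=
  IsSolution a p q k wp₀ wm₀ T wp wm ∧
    ∀ T' : EReal, T < T' → ∀ vp vm : ℝ → L2, IsSolution a p q k wp₀ wm₀ T' vp vm →
      ¬ (EqOn vp wp (timeInterval T) ∧ EqOn vm wm (timeInterval T))

/-- The `L^∞` norm on the torus. -/
def supNorm (f : Torus → ℝ) : ℝ≥0∞ := eLpNorm f ⊤ (volume : Measure Torus)

end MHD

end

/-! The proof is by contraposition: if `T` is finite and the four supremum norms are integrable in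
time, the solution extends beyond `T`, against maximality. Two facts are combined.

A priori bound. Let `E` be the sum of the squared `L²` norms of ω⁺, ω⁻ and their first derivatives,
and `M(t)` the sum of the four supremum norms. Then `E' ≤ C M E`: by the product rule every product
in the equation has one factor in the supremum norm and the other in `L²`. The term `a u f_θ` loses
no derivative, because transport by a real velocity is skew-symmetric up to `u_θ = Hg`. Grönwall's
inequality bounds `E` on `[T/2, T)`. An `H¹` solution is too rough for `f_θ` to be inserted into the
equation, so the derivative is first replaced by a difference quotient, which is a bounded
multiplier, and the step is sent to zero at the end (`ip_nl_le`, `ip_dq_nl_le`,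
`energy_le_add_integral`, `IsSolution.exists_bound`).

Local theory. For initial data of size `R` in `H¹` there is a solution on a time interval whose
length depends on `R` only. If the data lie in `H^k` the solution stays in `H^k` on that same
interval, since the `H^k` energy estimate is tame: its growth rate involves only the `H¹` size
(`energy_estimate`, `local_existence`). Solutions come from a Galerkin scheme with a cut off. Its
convergence, and uniqueness, rest on an `L²` estimate of differences in which frequencies above `K`
cost `O(1/K)` (`difference_estimate`, `stability`). Restarting at a time close to `T` and gluing by
uniqueness gives the extension (`IsSolution.exists_extension`).

All analysis is done on Fourier coefficients, where `H` is the multiplier `-i sgn n` and `H^k` is a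
weighted `ℓ²`. The return to functions needs: weak derivatives as multipliers (`memH_iff`), the
principal value integral as `-i sgn n` for `H¹` functions (`hilbert_eq`), and the equivalence of the
system with its coefficient form (`ae_eq_rhs_iff`). Supremum norms enter through one inequality:
convolution with `α` is bounded on `ℓ²` by the maximum of the function whose coefficients are `α`
(`N2_conv_le_norm_SC`). -/

noncomputable section

namespace MHD

/-! ### Square summable and summable bi-infinite sequences -/

section Sequences

variable {𝕜 𝕜' : Type*} [RCLike 𝕜] [RCLike 𝕜']

/-- The sequence `a` is square summable. -/
def Sq (a : ℤ → 𝕜) : Prop := Summable fun n => ‖a n‖ ^ 2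

/-- The `ℓ²` norm. -/
def N2 (a : ℤ → 𝕜) : ℝ := √(∑' n, ‖a n‖ ^ 2)

/-- The sequence `a` is absolutely summable. -/
def S1 (a : ℤ → 𝕜) : Prop := Summable fun n => ‖a n‖

/-- The `ℓ¹` norm. -/
def N1 (a : ℤ → 𝕜) : ℝ := ∑' n, ‖a n‖

theorem N2_nonneg (a : ℤ → 𝕜) : 0 ≤ N2 a := Real.sqrt_nonneg _

theorem N1_nonneg (a : ℤ → 𝕜) : 0 ≤ N1 a := tsum_nonneg fun _ => norm_nonneg _

theorem N2_sq (a : ℤ → 𝕜) : N2 a ^ 2 = ∑' n, ‖a n‖ ^ 2 :=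
  Real.sq_sqrt (tsum_nonneg fun _ => by positivity)

theorem Sq.sum_le {a : ℤ → 𝕜} (ha : Sq a) (s : Finset ℤ) : ∑ n ∈ s, ‖a n‖ ^ 2 ≤ N2 a ^ 2 := by
  rw [N2_sq]
  exact ha.sum_le_tsum s fun _ _ => by positivity

theorem Sq.norm_le {a : ℤ → 𝕜} (ha : Sq a) (n : ℤ) : ‖a n‖ ≤ N2 a := by
  have := ha.sum_le {n}
  simp only [Finset.sum_singleton] at this
  exact (sq_le_sq₀ (norm_nonneg _) (N2_nonneg _)).1 this

theorem sq_of_sum_le {a : ℤ → 𝕜} {C : ℝ} (hC : 0 ≤ C)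
    (h : ∀ s : Finset ℤ, ∑ n ∈ s, ‖a n‖ ^ 2 ≤ C ^ 2) : Sq a ∧ N2 a ≤ C := by
  have hs : Sq a := summable_of_sum_le (fun _ => by positivity) h
  refine ⟨hs, ?_⟩
  rw [N2, ← Real.sqrt_sq hC]
  exact Real.sqrt_le_sqrt (hs.tsum_le_of_sum_le h)

theorem Sq.mono {a : ℤ → 𝕜} {b : ℤ → 𝕜'} (hb : Sq b) (h : ∀ n, ‖a n‖ ≤ ‖b n‖) :
    Sq a ∧ N2 a ≤ N2 b := by
  refine sq_of_sum_le (N2_nonneg _) fun s => le_trans (Finset.sum_le_sum fun n _ => ?_) (hb.sum_le s)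
  exact pow_le_pow_left₀ (norm_nonneg _) (h n) 2

theorem Sq.mul_le {a : ℤ → 𝕜} {b : ℤ → 𝕜'} (ha : Sq a) (hb : Sq b) :
    (Summable fun n => ‖a n‖ * ‖b n‖) ∧ ∑' n, ‖a n‖ * ‖b n‖ ≤ N2 a * N2 b := by
  have key : ∀ s : Finset ℤ, ∑ n ∈ s, ‖a n‖ * ‖b n‖ ≤ N2 a * N2 b := fun s => by
    refine (Real.sum_mul_le_sqrt_mul_sqrt s _ _).trans ?_
    refine mul_le_mul ?_ ?_ (Real.sqrt_nonneg _) (N2_nonneg _)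
    · rw [← Real.sqrt_sq (N2_nonneg a)]; exact Real.sqrt_le_sqrt (ha.sum_le s)
    · rw [← Real.sqrt_sq (N2_nonneg b)]; exact Real.sqrt_le_sqrt (hb.sum_le s)
  have hs : Summable fun n => ‖a n‖ * ‖b n‖ := summable_of_sum_le (fun _ => by positivity) key
  exact ⟨hs, hs.tsum_le_of_sum_le key⟩

theorem Sq.const_mul {a : ℤ → 𝕜} (ha : Sq a) (c : 𝕜) :
    Sq (fun n => c * a n) ∧ N2 (fun n => c * a n) = ‖c‖ * N2 a := by
  constructor
  · simpa [Sq, mul_pow] using Summable.mul_left (‖c‖ ^ 2) ha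
  · simp only [N2, norm_mul, mul_pow, tsum_mul_left]
    rw [Real.sqrt_mul (by positivity), Real.sqrt_sq (norm_nonneg _)]

theorem Sq.add {a b : ℤ → 𝕜} (ha : Sq a) (hb : Sq b) :
    Sq (fun n => a n + b n) ∧ N2 (fun n => a n + b n) ≤ N2 a + N2 b := by
  refine sq_of_sum_le (add_nonneg (N2_nonneg _) (N2_nonneg _)) fun s => ?_
  obtain ⟨h1, h2⟩ := ha.mul_le hb
  have h3 := (h1.sum_le_tsum s fun _ _ => by positivity).trans h2
  calc ∑ n ∈ s, ‖a n + b n‖ ^ 2 ≤ ∑ n ∈ s, (‖a n‖ ^ 2 + 2 * (‖a n‖ * ‖b n‖) + ‖b n‖ ^ 2) := by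
        refine Finset.sum_le_sum fun n _ => ?_
        have := pow_le_pow_left₀ (norm_nonneg _) (norm_add_le (a n) (b n)) 2
        linarith [this, add_sq ‖a n‖ ‖b n‖]
    _ ≤ (N2 a + N2 b) ^ 2 := by
        rw [Finset.sum_add_distrib, Finset.sum_add_distrib, ← Finset.mul_sum]
        nlinarith [ha.sum_le s, hb.sum_le s]

theorem Sq.neg {a : ℤ → 𝕜} (ha : Sq a) : Sq (fun n => - a n) ∧ N2 (fun n => - a n) = N2 a := by
  simpa [Sq, N2] using ha

theorem Sq.sub {a b : ℤ → 𝕜} (ha : Sq a) (hb : Sq b) :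
    Sq (fun n => a n - b n) ∧ N2 (fun n => a n - b n) ≤ N2 a + N2 b := by
  have := ha.add hb.neg.1
  simpa [sub_eq_add_neg, hb.neg.2] using this

theorem S1.sq {a : ℤ → 𝕜} (ha : S1 a) : Sq a := by
  refine (sq_of_sum_le (N1_nonneg a) fun s => ?_).1
  refine (Finset.sum_sq_le_sq_sum_of_nonneg fun _ _ => norm_nonneg _).trans ?_
  exact pow_le_pow_left₀ (Finset.sum_nonneg fun _ _ => norm_nonneg _)
    (ha.sum_le_tsum s fun _ _ => norm_nonneg _) 2

theorem S1.mono {a : ℤ → 𝕜} {b : ℤ → 𝕜'} (hb : S1 b) (h : ∀ n, ‖a n‖ ≤ ‖b n‖) :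
    S1 a ∧ N1 a ≤ N1 b := by
  have : S1 a := Summable.of_nonneg_of_le (fun _ => norm_nonneg _) h hb
  exact ⟨this, this.tsum_le_tsum h hb⟩

theorem S1.const_mul {a : ℤ → 𝕜} (ha : S1 a) (c : 𝕜) :
    S1 (fun n => c * a n) ∧ N1 (fun n => c * a n) = ‖c‖ * N1 a := by
  constructor
  · simpa [S1] using Summable.mul_left ‖c‖ ha
  · simp [N1, tsum_mul_left]

theorem S1.add {a b : ℤ → 𝕜} (ha : S1 a) (hb : S1 b) :
    S1 (fun n => a n + b n) ∧ N1 (fun n => a n + b n) ≤ N1 a + N1 b := by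
  have h := Summable.add ha hb
  have : S1 (fun n => a n + b n) :=
    Summable.of_nonneg_of_le (fun _ => norm_nonneg _) (fun n => norm_add_le _ _) h
  refine ⟨this, ?_⟩
  rw [N1, N1, N1, ← Summable.tsum_add ha hb]
  exact this.tsum_le_tsum (fun n => norm_add_le _ _) h

/-- Convolution of sequences. -/
def conv (γ β : ℤ → 𝕜) (n : ℤ) : 𝕜 := ∑' m, γ (n - m) * β m

theorem Sq.shift {γ : ℤ → 𝕜} (h : Sq γ) (n : ℤ) :
    Sq (fun m => γ (n - m)) ∧ N2 (fun m => γ (n - m)) = N2 γ := by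
  constructor
  · exact (Equiv.subLeft n).summable_iff (f := fun m => ‖γ m‖ ^ 2) |>.2 h
  · rw [N2, N2]; congr 1
    exact (Equiv.subLeft n).tsum_eq (fun m => ‖γ m‖ ^ 2)

theorem Sq.conv_summable {γ β : ℤ → 𝕜} (hγ : Sq γ) (hβ : Sq β) (n : ℤ) :
    Summable fun m => ‖γ (n - m)‖ * ‖β m‖ := ((hγ.shift n).1.mul_le hβ).1

theorem Sq.conv_summable' {γ β : ℤ → 𝕜} (hγ : Sq γ) (hβ : Sq β) (n : ℤ) :
    Summable fun m => γ (n - m) * β m :=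
  Summable.of_norm (by simpa using hγ.conv_summable hβ n)

theorem norm_conv_le (γ β : ℤ → 𝕜) (hγ : Sq γ) (hβ : Sq β) (n : ℤ) :
    ‖conv γ β n‖ ≤ conv (fun n => ‖γ n‖) (fun n => ‖β n‖) n := by
  have := norm_tsum_le_tsum_norm (f := fun m => γ (n - m) * β m)
    (by simpa using hγ.conv_summable hβ n)
  simpa [conv] using this

theorem norm_conv_le_N2 {γ β : ℤ → 𝕜} (hγ : Sq γ) (hβ : Sq β) (n : ℤ) :
    ‖conv γ β n‖ ≤ N2 γ * N2 β := by
  refine (norm_conv_le γ β hγ hβ n).trans ?_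
  have := ((hγ.shift n).1.mul_le hβ).2
  rwa [(hγ.shift n).2] at this

theorem conv_comm (γ β : ℤ → 𝕜) : conv γ β = conv β γ := by
  funext n
  rw [conv, conv, ← (Equiv.subLeft n).tsum_eq]
  refine tsum_congr fun m => ?_
  simp [mul_comm]

/-- The shear `(n, m) ↦ (n - m, m)`. -/
def shearEquiv : ℤ × ℤ ≃ ℤ × ℤ where
  toFun p := (p.1 - p.2, p.2)
  invFun p := (p.1 + p.2, p.2)
  left_inv p := by simp
  right_inv p := by simp

/-- Writing `|γ| |β| = √|γ| · (√|γ| |β|)` and applying Cauchy–Schwarz in `m` bounds `|conv γ β n|²`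
by `N1 γ` times the convolution of `|γ|` with `|β|²`. The shear of `ℤ × ℤ` and Tonelli then evaluate
the sum over `n`. -/
theorem young {γ β : ℤ → 𝕜} (hγ : S1 γ) (hβ : Sq β) :
    Sq (conv γ β) ∧ N2 (conv γ β) ≤ N1 γ * N2 β := by
  have hp : Summable fun p : ℤ × ℤ => ‖γ (p.1 - p.2)‖ * ‖β p.2‖ ^ 2 :=
    shearEquiv.summable_iff (f := fun p : ℤ × ℤ => ‖γ p.1‖ * ‖β p.2‖ ^ 2) |>.2
      (Summable.mul_of_nonneg (f := fun n => ‖γ n‖) (g := fun n => ‖β n‖ ^ 2) hγ hβ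
        (fun _ => norm_nonneg _) fun _ => by positivity)
  have htot : ∑' p : ℤ × ℤ, ‖γ (p.1 - p.2)‖ * ‖β p.2‖ ^ 2 = N1 γ * N2 β ^ 2 := by
    have h := Summable.tsum_mul_tsum (f := fun n => ‖γ n‖) (g := fun n => ‖β n‖ ^ 2) hγ hβ
      (Summable.mul_of_nonneg (f := fun n => ‖γ n‖) (g := fun n => ‖β n‖ ^ 2) hγ hβ
        (fun _ => norm_nonneg _) fun _ => by positivity)
    rw [N2_sq, N1, h]
    exact shearEquiv.tsum_eq (fun p : ℤ × ℤ => ‖γ p.1‖ * ‖β p.2‖ ^ 2)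
  have hpt : ∀ n, ‖conv γ β n‖ ^ 2 ≤ N1 γ * ∑' m, ‖γ (n - m)‖ * ‖β m‖ ^ 2 := fun n => by
    have h1 : Summable fun m => ‖γ (n - m)‖ := (Equiv.subLeft n).summable_iff.2 hγ
    have h1t : ∑' m, ‖γ (n - m)‖ = N1 γ := (Equiv.subLeft n).tsum_eq fun m => ‖γ m‖
    have h2 : Summable fun m => ‖γ (n - m)‖ * ‖β m‖ ^ 2 := hp.prod_factor n
    have ha : Sq (fun m => √‖γ (n - m)‖) := by
      simpa [Sq, Real.sq_sqrt] using h1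
    have hb : Sq (fun m => √‖γ (n - m)‖ * ‖β m‖) := by
      simpa [Sq, mul_pow, Real.sq_sqrt] using h2
    have hcs := (ha.mul_le hb).2
    have e1 : N2 (fun m => √‖γ (n - m)‖) ^ 2 = N1 γ := by
      rw [N2_sq]; simp [Real.sq_sqrt, h1t]
    have e2 : N2 (fun m => √‖γ (n - m)‖ * ‖β m‖) ^ 2 = ∑' m, ‖γ (n - m)‖ * ‖β m‖ ^ 2 := by
      rw [N2_sq]; simp [mul_pow, Real.sq_sqrt]
    have e3 : ‖conv γ β n‖ ≤ ∑' m, ‖√‖γ (n - m)‖‖ * ‖√‖γ (n - m)‖ * ‖β m‖‖ := by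
      refine (norm_conv_le γ β hγ.sq hβ n).trans (le_of_eq (tsum_congr fun m => ?_))
      rw [norm_mul, ← mul_assoc, Real.norm_of_nonneg (Real.sqrt_nonneg _),
        Real.mul_self_sqrt (norm_nonneg _), norm_norm]
    calc ‖conv γ β n‖ ^ 2 ≤ _ := pow_le_pow_left₀ (norm_nonneg _) (e3.trans hcs) 2
      _ = _ := by rw [mul_pow, e1, e2]
  have hsum : Summable fun n => N1 γ * ∑' m, ‖γ (n - m)‖ * ‖β m‖ ^ 2 := hp.prod.mul_left _
  have hSq : Sq (conv γ β) := Summable.of_nonneg_of_le (fun _ => by positivity) hpt hsum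
  refine ⟨hSq, ?_⟩
  refine (sq_le_sq₀ (N2_nonneg _) (mul_nonneg (N1_nonneg _) (N2_nonneg _))).1 ?_
  rw [N2_sq]
  refine (hSq.tsum_le_tsum hpt hsum).trans (le_of_eq ?_)
  rw [tsum_mul_left, ← hp.tsum_prod, htot]
  ring

theorem young' {γ β : ℤ → 𝕜} (hγ : Sq γ) (hβ : S1 β) :
    Sq (conv γ β) ∧ N2 (conv γ β) ≤ N2 γ * N1 β := by
  rw [conv_comm, mul_comm]
  exact young hβ hγ

theorem conv_sub_right {γ β β' : ℤ → 𝕜} (hγ : Sq γ) (hβ : Sq β) (hβ' : Sq β') (n : ℤ) :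
    conv γ (fun m => β m - β' m) n = conv γ β n - conv γ β' n := by
  simp only [conv, mul_sub]
  exact Summable.tsum_sub (hγ.conv_summable' hβ n) (hγ.conv_summable' hβ' n)

theorem conv_sub_left {γ γ' β : ℤ → 𝕜} (hγ : Sq γ) (hγ' : Sq γ') (hβ : Sq β) (n : ℤ) :
    conv (fun m => γ m - γ' m) β n = conv γ β n - conv γ' β n := by
  rw [conv_comm, conv_sub_right hβ hγ hγ', conv_comm β, conv_comm β]

/-- Lower semicontinuity of the `ℓ²` norm under coefficientwise convergence. -/
theorem sq_of_tendsto {ι : Type*} {l : Filter ι} [l.NeBot] {u : ι → ℤ → 𝕜} {a : ℤ → 𝕜} {C : ℝ}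
    (hC : 0 ≤ C) (hlim : ∀ n, Tendsto (fun i => u i n) l (𝓝 (a n)))
    (hu : ∀ᶠ i in l, Sq (u i) ∧ N2 (u i) ≤ C) : Sq a ∧ N2 a ≤ C := by
  refine sq_of_sum_le hC fun s => ?_
  refine le_of_tendsto (tendsto_finsetSum s fun n _ => ((hlim n).norm.pow 2)) ?_
  filter_upwards [hu] with i hi
  exact (hi.1.sum_le s).trans (pow_le_pow_left₀ (N2_nonneg _) hi.2 2)

/-- Weak convergence together with convergence of norms is strong convergence. A finite set carries
almost all of the mass of `a`; on it convergence is coefficientwise, and off it the mass of `u i` is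
small because the total masses converge. -/
theorem tendsto_N2_sub {ι : Type*} {l : Filter ι} {u : ι → ℤ → 𝕜} {a : ℤ → 𝕜}
    (ha : Sq a) (hu : ∀ᶠ i in l, Sq (u i)) (hlim : ∀ n, Tendsto (fun i => u i n) l (𝓝 (a n)))
    (hnorm : Tendsto (fun i => N2 (u i) ^ 2) l (𝓝 (N2 a ^ 2))) :
    Tendsto (fun i => N2 (fun n => u i n - a n) ^ 2) l (𝓝 0) := by
  rw [Metric.tendsto_nhds]
  intro ε hε
  have hsum : Tendsto (fun s : Finset ℤ => ∑ n ∈ s, ‖a n‖ ^ 2) atTop (𝓝 (N2 a ^ 2)) := by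
    rw [N2_sq]; exact ha.hasSum
  obtain ⟨s, hs⟩ := (hsum.eventually (lt_mem_nhds (sub_lt_self (N2 a ^ 2)
    (show 0 < ε / 8 by positivity)))).exists
  have h1 : Tendsto (fun i => ∑ n ∈ s, ‖u i n - a n‖ ^ 2) l (𝓝 0) := by
    have := tendsto_finsetSum s fun n _ => (((hlim n).sub_const (a n)).norm.pow 2)
    simpa using this
  have h2 : Tendsto (fun i => ∑ n ∈ s, ‖u i n‖ ^ 2) l (𝓝 (∑ n ∈ s, ‖a n‖ ^ 2)) :=
    tendsto_finsetSum s fun n _ => ((hlim n).norm.pow 2)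
  filter_upwards [hu, h1.eventually (gt_mem_nhds (show (0 : ℝ) < ε / 8 by positivity)),
    (hnorm.sub h2).eventually (gt_mem_nhds (show N2 a ^ 2 - ∑ n ∈ s, ‖a n‖ ^ 2 < ε / 8 by
      linarith))] with i hi1 hi2 hi3
  have hd := (hi1.sub ha).1
  rw [Real.dist_eq, sub_zero, abs_of_nonneg (by positivity), N2_sq,
    ← hd.sum_add_tsum_subtype_compl s]
  have e1 := hi1.sum_add_tsum_subtype_compl s
  have e2 := ha.sum_add_tsum_subtype_compl s
  rw [← N2_sq] at e1 e2
  have e3 : ∑' n : {x // x ∉ s}, ‖u i n - a n‖ ^ 2 ≤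
      ∑' n : {x // x ∉ s}, (2 * ‖u i n‖ ^ 2 + 2 * ‖a n‖ ^ 2) := by
    refine Summable.tsum_le_tsum (fun n => ?_) (hd.subtype _)
      (((hi1.subtype _).mul_left 2).add ((ha.subtype _).mul_left 2))
    have := pow_le_pow_left₀ (norm_nonneg _) (norm_sub_le (u i n) (a n)) 2
    nlinarith [sq_nonneg (‖u i n‖ - ‖a n‖)]
  have e4 := Summable.tsum_add ((hi1.subtype (fun n => n ∉ s)).mul_left 2)
    ((ha.subtype (fun n => n ∉ s)).mul_left 2)
  rw [tsum_mul_left, tsum_mul_left] at e4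
  simp only [Function.comp_def] at e4
  have e5 := e3.trans e4.le
  linarith

end Sequences

/-! ### Weights -/

section Weights

/-- The Sobolev weight `(1 + |n|)^k`. -/
def wt (k : ℕ) (n : ℤ) : ℝ := (1 + |(n : ℝ)|) ^ k

/-- The weighted sequence `(1 + |n|)^k a n`. -/
def W (k : ℕ) (a : ℤ → ℂ) (n : ℤ) : ℂ := (wt k n : ℂ) * a n

/-- Sequences of Fourier coefficients of functions in `H^k`. -/
def InH (k : ℕ) (a : ℤ → ℂ) : Prop := Sq (W k a)

theorem one_le_wt (k : ℕ) (n : ℤ) : 1 ≤ wt k n := one_le_pow₀ (by simp)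

theorem wt_pos (k : ℕ) (n : ℤ) : 0 < wt k n := zero_lt_one.trans_le (one_le_wt k n)

theorem wt_mono {j k : ℕ} (h : j ≤ k) (n : ℤ) : wt j n ≤ wt k n :=
  pow_le_pow_right₀ (by simp) h

theorem norm_W (k : ℕ) (a : ℤ → ℂ) (n : ℤ) : ‖W k a n‖ = wt k n * ‖a n‖ := by
  rw [W, norm_mul, Complex.norm_real, Real.norm_of_nonneg (wt_pos k n).le]

theorem W_zero (a : ℤ → ℂ) : W 0 a = a := by funext n; simp [W, wt]

theorem W_W (j k : ℕ) (a : ℤ → ℂ) : W j (W k a) = W (j + k) a := by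
  funext n; simp only [W, wt]; push_cast; ring

theorem InH.mono {j k : ℕ} (h : j ≤ k) {a : ℤ → ℂ} (ha : InH k a) :
    InH j a ∧ N2 (W j a) ≤ N2 (W k a) :=
  Sq.mono ha fun n => by
    rw [norm_W, norm_W]; exact mul_le_mul_of_nonneg_right (wt_mono h n) (norm_nonneg _)

theorem InH.sq {k : ℕ} {a : ℤ → ℂ} (ha : InH k a) : Sq a ∧ N2 a ≤ N2 (W k a) := by
  simpa only [InH, W_zero] using ha.mono (Nat.zero_le k)

theorem InH.of_norm_le {k : ℕ} {a b : ℤ → ℂ} (hb : InH k b) (h : ∀ n, ‖a n‖ ≤ ‖b n‖) :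
    InH k a ∧ N2 (W k a) ≤ N2 (W k b) :=
  Sq.mono hb fun n => by
    rw [norm_W, norm_W]; exact mul_le_mul_of_nonneg_left (h n) (wt_pos k n).le

theorem InH.sub {k : ℕ} {a b : ℤ → ℂ} (ha : InH k a) (hb : InH k b) :
    InH k (fun n => a n - b n) ∧ N2 (W k fun n => a n - b n) ≤ N2 (W k a) + N2 (W k b) := by
  have h : (W k fun n => a n - b n) = fun n => W k a n - W k b n := by
    funext n; simp only [W, mul_sub]
  rw [InH, h]
  exact Sq.sub ha hb

theorem wt_le_mul (k : ℕ) (n m : ℤ) : wt k n ≤ wt k (n - m) * wt k m := by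
  rw [wt, wt, wt, ← mul_pow]
  refine pow_le_pow_left₀ (by positivity) ?_ k
  push_cast
  have h : |(n : ℝ)| ≤ |(n : ℝ) - m| + |(m : ℝ)| := by
    simpa using abs_add_le ((n : ℝ) - m) m
  nlinarith [abs_nonneg ((n : ℝ) - m), abs_nonneg (m : ℝ)]

/-- Both `1 + |n|` and `1 + |m|` are at most twice `1 + max |n - m| |m|`. The maximum on the left is
what the mean value bound in `wt_commutator` produces. -/
theorem max_pow_le (k : ℕ) (n m : ℤ) :
    (max (1 + |(n : ℝ)|) (1 + |(m : ℝ)|)) ^ k ≤ 2 ^ k * (wt k (n - m) + wt k m) := by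
  have h : |(n : ℝ)| ≤ |(n : ℝ) - m| + |(m : ℝ)| := by
    simpa using abs_add_le ((n : ℝ) - m) m
  have h0 := abs_nonneg ((n : ℝ) - m)
  have h1 := abs_nonneg (m : ℝ)
  rcases le_total (|(n : ℝ) - m|) |(m : ℝ)| with hc | hc
  · calc (max (1 + |(n : ℝ)|) (1 + |(m : ℝ)|)) ^ k ≤ (2 * (1 + |(m : ℝ)|)) ^ k :=
          pow_le_pow_left₀ (by positivity) (max_le (by linarith) (by linarith)) k
      _ = 2 ^ k * wt k m := by rw [mul_pow, wt]
      _ ≤ _ := mul_le_mul_of_nonneg_left (by linarith [wt_pos k (n - m)]) (by positivity)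
  · calc (max (1 + |(n : ℝ)|) (1 + |(m : ℝ)|)) ^ k ≤ (2 * (1 + |(n : ℝ) - m|)) ^ k :=
          pow_le_pow_left₀ (by positivity) (max_le (by linarith) (by linarith)) k
      _ = 2 ^ k * wt k (n - m) := by rw [mul_pow, wt]; push_cast; rfl
      _ ≤ _ := mul_le_mul_of_nonneg_left (by linarith [wt_pos k m]) (by positivity)

theorem wt_le_add (k : ℕ) (n m : ℤ) : wt k n ≤ 2 ^ k * (wt k (n - m) + wt k m) :=
  (pow_le_pow_left₀ (by positivity) (le_max_left _ _) k).trans (max_pow_le k n m)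

/-- This is the symbol of the commutator of the `H^k` weight with transport. The difference of two
`k`-th powers gains `|n - m|` and loses one power of the larger base; the factor `|m|` gives that
power back. So the derivative moves from the transported function to the velocity. -/
theorem wt_commutator (k : ℕ) (n m : ℤ) :
    |wt k n - wt k m| * |(m : ℝ)| ≤
      k * 2 ^ k * |((n - m : ℤ) : ℝ)| * (wt k (n - m) + wt k m) := by
  rcases Nat.eq_zero_or_pos k with rfl | hk
  · simp [wt]
  set M := max (1 + |(n : ℝ)|) (1 + |(m : ℝ)|) with hM
  have hM0 : 0 ≤ M := le_max_of_le_left (by positivity)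
  have h1 : |wt k n - wt k m| ≤ |((n - m : ℤ) : ℝ)| * k * M ^ (k - 1) := by
    have := abs_pow_sub_pow_le (1 + |(n : ℝ)|) (1 + |(m : ℝ)|) k
    rw [abs_of_nonneg (show 0 ≤ 1 + |(n : ℝ)| by positivity),
      abs_of_nonneg (show 0 ≤ 1 + |(m : ℝ)| by positivity)] at this
    refine this.trans ?_
    refine mul_le_mul_of_nonneg_right (mul_le_mul_of_nonneg_right ?_ (by positivity)) (by positivity)
    push_cast
    rw [add_sub_add_left_eq_sub]
    exact abs_abs_sub_abs_le_abs_sub (n : ℝ) (m : ℝ)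
  have h2 : |(m : ℝ)| ≤ M := le_max_of_le_right (by linarith)
  calc |wt k n - wt k m| * |(m : ℝ)| ≤ (|((n - m : ℤ) : ℝ)| * k * M ^ (k - 1)) * M := by gcongr
    _ = k * |((n - m : ℤ) : ℝ)| * M ^ k := by
        obtain ⟨j, rfl⟩ : ∃ j, k = j + 1 := ⟨k - 1, by omega⟩
        simp only [Nat.add_sub_cancel, pow_succ]; ring
    _ ≤ k * |((n - m : ℤ) : ℝ)| * (2 ^ k * (wt k (n - m) + wt k m)) := by
        gcongr; exact max_pow_le k n m
    _ = _ := by ring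

/-- The `ℓ²` norm of `(1 + |n|)⁻¹`. -/
def kap : ℝ := N2 fun n : ℤ => (1 + |(n : ℝ)|)⁻¹

theorem kap_nonneg : 0 ≤ kap := N2_nonneg _

theorem sq_inv_wt : Sq fun n : ℤ => (1 + |(n : ℝ)|)⁻¹ := by
  have h : Summable fun n : ℤ => 1 / |(n : ℝ)| ^ (2 : ℝ) :=
    Real.summable_abs_int_rpow (b := 2) (by norm_num) |>.congr fun n => by
      rw [Real.rpow_neg (abs_nonneg _), one_div]
  refine Summable.of_norm_bounded_eventually (g := fun n : ℤ => 1 / |(n : ℝ)| ^ (2 : ℝ)) h ?_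
  filter_upwards [(Set.finite_singleton (0 : ℤ)).compl_mem_cofinite] with n hn
  have hn' : 0 < |(n : ℝ)| := abs_pos.2 (by simpa using hn)
  rw [Real.norm_of_nonneg (by positivity), Real.norm_of_nonneg (by positivity), inv_pow, one_div,
    Real.rpow_two]
  gcongr
  linarith

theorem sq.summable_mul_inv {b : ℤ → ℂ} (hb : Sq b) :
    S1 (fun n => (1 + |(n : ℝ)|)⁻¹ * ‖b n‖) ∧
      N1 (fun n => (1 + |(n : ℝ)|)⁻¹ * ‖b n‖) ≤ kap * N2 b := by
  have := sq_inv_wt.mul_le hb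
  simpa only [S1, N1, norm_mul, norm_norm, kap] using this

/-- The embedding of `H¹` into absolutely convergent Fourier series: Cauchy–Schwarz against the
square summable sequence `(1 + |n|)⁻¹`. -/
theorem InH.s1 {a : ℤ → ℂ} (ha : InH 1 a) : S1 a ∧ N1 a ≤ kap * N2 (W 1 a) := by
  obtain ⟨h1, h2⟩ := sq.summable_mul_inv ha
  have h : (fun n : ℤ => (1 + |(n : ℝ)|)⁻¹ * ‖W 1 a n‖) = fun n => ‖a n‖ := by
    funext n
    rw [norm_W, wt, pow_one, inv_mul_cancel_left₀ (by positivity)]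
  rw [h] at h1 h2
  simpa only [S1, N1, norm_norm] using And.intro h1 h2

theorem InH.s1_W {k : ℕ} {a : ℤ → ℂ} (ha : InH (k + 1) a) :
    S1 (W k a) ∧ N1 (W k a) ≤ kap * N2 (W (k + 1) a) := by
  have h : InH 1 (W k a) := by rw [InH, W_W, add_comm]; exact ha
  have := h.s1
  rwa [W_W, add_comm 1 k] at this

/-- Weighted Young inequality. -/
theorem conv_W {k : ℕ} {γ β : ℤ → ℂ} (hγ : S1 (W k γ)) (hβ : InH k β) :
    InH k (conv γ β) ∧ N2 (W k (conv γ β)) ≤ N1 (W k γ) * N2 (W k β) := by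
  have hγ0 : Sq γ := (InH.sq (k := k) hγ.sq).1
  have h1 : Sq (fun n => ‖W k γ n‖) := by simpa [Sq] using hγ.sq
  have h2 : Sq (fun n => ‖W k β n‖) := by simpa [Sq, InH] using hβ
  obtain ⟨h3, h4⟩ := young (𝕜 := ℝ) (γ := fun n => ‖W k γ n‖) (β := fun n => ‖W k β n‖)
    (by simpa [S1] using hγ) h2
  have e1 : N1 (fun n => ‖W k γ n‖) = N1 (W k γ) := by simp [N1]
  have e2 : N2 (fun n => ‖W k β n‖) = N2 (W k β) := by simp [N2]
  rw [e1, e2] at h4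
  have := Sq.mono (a := W k (conv γ β)) h3 fun n => ?_
  · exact ⟨this.1, this.2.trans h4⟩
  rw [norm_W, Real.norm_of_nonneg (by unfold conv; exact tsum_nonneg fun m => by positivity)]
  refine (mul_le_mul_of_nonneg_left (norm_conv_le γ β hγ0 hβ.sq.1 n) (wt_pos k n).le).trans ?_
  rw [conv, ← tsum_mul_left]
  refine Summable.tsum_le_tsum (fun m => ?_) ((hγ0.conv_summable hβ.sq.1 n).mul_left _)
    (h1.conv_summable' h2 n)
  simp only [norm_W]
  nlinarith [wt_le_mul k n m, mul_nonneg (norm_nonneg (γ (n - m))) (norm_nonneg (β m))]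

/-- Tame weighted Young inequality, for anything dominated by the symmetrized convolution. -/
theorem tame_of_le {k : ℕ} {γ β : ℤ → ℂ} {c : ℤ → ℂ} {C : ℝ} (hC : 0 ≤ C) (hγ : InH k γ)
    (hγ1 : S1 γ) (hβ : InH k β) (hβ1 : S1 β)
    (h : ∀ n, ‖c n‖ ≤ C * ∑' m, (wt k (n - m) + wt k m) * (‖γ (n - m)‖ * ‖β m‖)) :
    Sq c ∧ N2 c ≤ C * (N2 (W k γ) * N1 β + N1 γ * N2 (W k β)) := by
  have a1 : Sq (fun n => ‖W k γ n‖) := by simpa [Sq, InH] using hγ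
  have a2 : Sq (fun n => ‖W k β n‖) := by simpa [Sq, InH] using hβ
  have a3 : S1 (fun n => ‖γ n‖) := by simpa [S1] using hγ1
  have a4 : S1 (fun n => ‖β n‖) := by simpa [S1] using hβ1
  have y1 := young' (𝕜 := ℝ) a1 a4
  have y2 := young (𝕜 := ℝ) a3 a2
  have y3 := y1.1.add y2.1
  have y4 := y3.1.const_mul C
  have e1 : N1 (fun n => ‖γ n‖) = N1 γ := by simp [N1]
  have e2 : N1 (fun n => ‖β n‖) = N1 β := by simp [N1]
  have e3 : N2 (fun n => ‖W k γ n‖) = N2 (W k γ) := by simp [N2]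
  have e4 : N2 (fun n => ‖W k β n‖) = N2 (W k β) := by simp [N2]
  have y5 := Sq.mono (a := c) y4.1 fun n => ?_
  · refine ⟨y5.1, y5.2.trans ?_⟩
    rw [y4.2, Real.norm_of_nonneg hC, ← e1, ← e2, ← e3, ← e4]
    exact mul_le_mul_of_nonneg_left (y3.2.trans (add_le_add y1.2 y2.2)) hC
  · refine (h n).trans (le_trans (le_of_eq ?_) (le_abs_self _))
    congr 1
    rw [conv, conv, ← Summable.tsum_add (a1.conv_summable' a4.sq n) (a3.sq.conv_summable' a2 n)]
    refine tsum_congr fun m => ?_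
    rw [norm_W, norm_W]; ring

/-- The summability behind `tame_of_le`. -/
theorem tame_summable {k : ℕ} {γ β : ℤ → ℂ} (hγ : InH k γ) (hβ : InH k β) (n : ℤ) :
    Summable fun m => (wt k (n - m) + wt k m) * (‖γ (n - m)‖ * ‖β m‖) := by
  have y1 := Sq.conv_summable hγ hβ.sq.1 n
  have y2 := Sq.conv_summable hγ.sq.1 hβ n
  refine (y1.add y2).congr fun m => ?_
  rw [norm_W, norm_W]; ring

end Weights

/-! ### The nonlinearity on the Fourier side -/

section Operators

/-- The Hilbert transform on Fourier coefficients. -/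
def Hs (a : ℤ → ℂ) (n : ℤ) : ℂ := -Complex.I * (SignType.sign n : ℤ) * a n

/-- The derivative on Fourier coefficients. -/
def Ds (a : ℤ → ℂ) (n : ℤ) : ℂ := Complex.I * n * a n

/-- The velocity on Fourier coefficients; the mean is fixed by `u(0) = 0`. -/
def us (g : ℤ → ℂ) (n : ℤ) : ℂ :=
  -- For `n ≠ 0` the relation `u_θ = Hg` reads `i n u_n = -i sgn(n) g_n`. The mean is minus the sum
  -- of the other coefficients, so that the series vanishes at the origin; the term `j = 0` is a
  -- division by zero and contributes `0`.
  if n = 0 then ∑' j : ℤ, g j / ((|j| : ℤ) : ℂ) else -(g n / ((|n| : ℤ) : ℂ))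

/-- The nonlinearity `p f Hg + q g Hf - a u(g) f_θ` on Fourier coefficients. -/
def nl (a p q : ℝ) (f g : ℤ → ℂ) (n : ℤ) : ℂ :=
  p * conv (Hs g) f n + q * conv (Hs f) g n - a * conv (us g) (Ds f) n

/-- The sequence of Fourier coefficients of the complex conjugate. -/
def refl (a : ℤ → ℂ) (n : ℤ) : ℂ := (starRingEnd ℂ) (a (-n))

/-- Fourier coefficients of a real-valued function. -/
def Sym (a : ℤ → ℂ) : Prop := refl a = a

theorem Sym.apply {a : ℤ → ℂ} (h : Sym a) (n : ℤ) : (starRingEnd ℂ) (a (-n)) = a n := congrFun h n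

theorem norm_Hs_le (a : ℤ → ℂ) (n : ℤ) : ‖Hs a n‖ ≤ ‖a n‖ := by
  rw [Hs, norm_mul, norm_mul]
  have : ‖((SignType.sign n : ℤ) : ℂ)‖ ≤ 1 := by
    rcases lt_trichotomy n 0 with h | h | h <;> simp [h]
  simpa using mul_le_of_le_one_left (norm_nonneg (a n)) this

theorem norm_Ds (a : ℤ → ℂ) (n : ℤ) : ‖Ds a n‖ = |(n : ℝ)| * ‖a n‖ := by
  simp [Ds]

theorem norm_Ds_le (a : ℤ → ℂ) (n : ℤ) : ‖Ds a n‖ ≤ ‖W 1 a n‖ := by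
  rw [norm_Ds, norm_W, wt, pow_one]
  gcongr
  linarith

theorem W_Ds (k : ℕ) (a : ℤ → ℂ) : W k (Ds a) = Ds (W k a) := by
  funext n; simp only [W, Ds]; ring

theorem InH.Ds {k : ℕ} {a : ℤ → ℂ} (ha : InH (k + 1) a) :
    InH k (Ds a) ∧ N2 (W k (MHD.Ds a)) ≤ N2 (W (k + 1) a) := by
  have := Sq.mono (a := W k (MHD.Ds a)) (b := W (k + 1) a) ha fun n => by
    rw [W_Ds, add_comm k, ← W_W]; exact norm_Ds_le _ _
  exact this

theorem InH.Hs {k : ℕ} {a : ℤ → ℂ} (ha : InH k a) :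
    InH k (Hs a) ∧ N2 (W k (MHD.Hs a)) ≤ N2 (W k a) := ha.of_norm_le (norm_Hs_le a)

theorem W_Hs (k : ℕ) (a : ℤ → ℂ) : W k (Hs a) = Hs (W k a) := by
  funext n; simp only [W, Hs]; ring

theorem S1.Hs {a : ℤ → ℂ} (ha : S1 a) : S1 (Hs a) ∧ N1 (MHD.Hs a) ≤ N1 a := ha.mono (norm_Hs_le a)

theorem norm_div_abs_le (z : ℂ) (n : ℤ) :
    ‖z / ((|n| : ℤ) : ℂ)‖ ≤ 2 * ((1 + |(n : ℝ)|)⁻¹ * ‖z‖) := by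
  rw [norm_div]
  have h : ‖((|n| : ℤ) : ℂ)‖ = |(n : ℝ)| := by simp
  rw [h]
  rcases eq_or_ne n 0 with rfl | hn
  · simp
  have h1 : (1 : ℝ) ≤ |(n : ℝ)| := by exact_mod_cast Int.one_le_abs hn
  rw [div_le_iff₀ (by linarith)]
  have : 1 ≤ 2 * ((1 + |(n : ℝ)|)⁻¹ * |(n : ℝ)|) := by
    rw [← div_eq_inv_mul, ← mul_div_assoc, le_div_iff₀ (by positivity)]; linarith
  calc ‖z‖ = ‖z‖ * 1 := (mul_one _).symm
    _ ≤ ‖z‖ * (2 * ((1 + |(n : ℝ)|)⁻¹ * |(n : ℝ)|)) := by gcongr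
    _ = _ := by ring

theorem summable_div_abs {g : ℤ → ℂ} (hg : Sq g) :
    S1 (fun j => g j / ((|j| : ℤ) : ℂ)) ∧
      N1 (fun j => g j / ((|j| : ℤ) : ℂ)) ≤ 2 * kap * N2 g := by
  obtain ⟨h1, h2⟩ := sq.summable_mul_inv hg
  have h3 := h1.const_mul 2
  have := S1.mono (a := fun j => g j / ((|j| : ℤ) : ℂ)) h3.1 fun n => by
    rw [Real.norm_of_nonneg (by positivity)]; exact norm_div_abs_le _ _
  refine ⟨this.1, this.2.trans ?_⟩
  rw [h3.2]
  norm_num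
  linarith

/-- The velocity gains a full derivative, and Cauchy–Schwarz spends it on passing from `ℓ²` to `ℓ¹`
with the same weight. Of the constant `4 * kap`, one half pays for the mean and one half for the
other frequencies. -/
theorem us_bound {k : ℕ} {g : ℤ → ℂ} (hg : InH k g) :
    S1 (W k (us g)) ∧ N1 (W k (us g)) ≤ 4 * kap * N2 (W k g) := by
  obtain ⟨h1, h2⟩ := summable_div_abs hg
  obtain ⟨h3, h4⟩ := summable_div_abs hg.sq.1
  have h0 : ‖us g 0‖ ≤ 2 * kap * N2 (W k g) := by
    rw [us, if_pos rfl]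
    refine (norm_tsum_le_tsum_norm h3).trans (h4.trans ?_)
    exact mul_le_mul_of_nonneg_left hg.sq.2 (by linarith [kap_nonneg])
  set e : ℤ → ℂ := Pi.single 0 (us g 0) with he
  have hee : ∀ n, n ≠ 0 → ‖e n‖ = 0 := fun n hn => by simp [he, hn]
  have he1 : S1 e := summable_of_ne_finset_zero (s := {0}) fun n hn => hee n (by simpa using hn)
  have he2 : N1 e = ‖us g 0‖ := by
    rw [N1, tsum_eq_single 0 fun n hn => hee n hn, he, Pi.single_eq_same]
  have h5 := S1.add (a := fun n => ‖e n‖) (b := fun j => ‖W k g j / ((|j| : ℤ) : ℂ)‖)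
    (by simpa [S1] using he1) (by simpa [S1] using h1)
  have h6 := S1.mono (a := W k (us g)) h5.1 fun n => ?_
  · refine ⟨h6.1, h6.2.trans (h5.2.trans ?_)⟩
    have e1 : N1 (fun n => ‖e n‖) = N1 e := by simp [N1]
    have e2 : N1 (fun j => ‖W k g j / ((|j| : ℤ) : ℂ)‖) = N1 (fun j => W k g j / ((|j| : ℤ) : ℂ)) := by
      simp [N1]
    rw [e1, e2, he2]
    linarith
  · rw [Real.norm_of_nonneg (by positivity), norm_W]
    rcases eq_or_ne n 0 with rfl | hn
    · simp [he, wt]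
    · rw [hee n hn, us, if_neg hn, norm_neg, norm_div, norm_div, norm_W]
      apply le_of_eq; ring

theorem us_S1 {g : ℤ → ℂ} (hg : Sq g) : S1 (us g) ∧ N1 (us g) ≤ 4 * kap * N2 g := by
  have := us_bound (k := 0) (g := g) (by rwa [InH, W_zero])
  simpa only [W_zero] using this

theorem Ds_us (g : ℤ → ℂ) : Ds (us g) = Hs g := by
  funext n
  simp only [Ds, us, Hs]
  rcases lt_trichotomy n 0 with h | h | h
  · have : (n : ℂ) ≠ 0 := by exact_mod_cast h.ne
    rw [if_neg h.ne, abs_of_neg h, sign_neg h]; push_cast; simp; field_simp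
  · simp [h]
  · have : (n : ℂ) ≠ 0 := by exact_mod_cast h.ne'
    rw [if_neg h.ne', abs_of_pos h, sign_pos h]; simp; field_simp

theorem Hs_sub (a b : ℤ → ℂ) : Hs (fun n => a n - b n) = fun n => Hs a n - Hs b n := by
  funext n; simp only [Hs]; ring

theorem Ds_sub (a b : ℤ → ℂ) : Ds (fun n => a n - b n) = fun n => Ds a n - Ds b n := by
  funext n; simp only [Ds]; ring

theorem us_sub {a b : ℤ → ℂ} (ha : Sq a) (hb : Sq b) :
    us (fun n => a n - b n) = fun n => us a n - us b n := by
  funext n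
  simp only [us]
  split_ifs with h
  · rw [← Summable.tsum_sub (summable_div_abs ha).1.of_norm (summable_div_abs hb).1.of_norm]
    exact tsum_congr fun j => sub_div _ _ _
  · ring

theorem refl_Hs (a : ℤ → ℂ) : Hs (refl a) = refl (Hs a) := by
  funext n
  have : ((SignType.sign (-n) : SignType) : ℤ) = -((SignType.sign n : SignType) : ℤ) := by
    rcases lt_trichotomy n 0 with h | h | h <;> simp [h]
  simp only [Hs, refl, map_mul, this, map_intCast]
  simp

theorem refl_Ds (a : ℤ → ℂ) : Ds (refl a) = refl (Ds a) := by
  funext n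
  simp only [Ds, refl, map_mul]
  simp

theorem refl_us (a : ℤ → ℂ) : us (refl a) = refl (us a) := by
  funext n
  simp only [us, refl, neg_eq_zero]
  split_ifs with h
  · rw [Complex.conj_tsum, ← (Equiv.neg ℤ).tsum_eq]
    refine tsum_congr fun j => ?_
    simp
  · simp

theorem refl_conv (γ β : ℤ → ℂ) : conv (refl γ) (refl β) = refl (conv γ β) := by
  funext n
  simp only [conv, refl]
  rw [Complex.conj_tsum, ← (Equiv.neg ℤ).tsum_eq]
  refine tsum_congr fun j => ?_
  simp only [Equiv.neg_apply, map_mul, neg_neg]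
  rw [show -(n - -j) = -n - j by ring]

/-- The nonlinearity commutes with complex conjugation, so real data evolve into real solutions.
Reality of the velocity is what makes transport skew-symmetric in `ip_transport`. -/
theorem refl_nl (a p q : ℝ) (f g : ℤ → ℂ) :
    nl a p q (refl f) (refl g) = refl (nl a p q f g) := by
  funext n
  simp only [nl, refl_Hs, refl_us, refl_Ds, refl_conv]
  simp [refl, nl]

theorem Sym.us {g : ℤ → ℂ} (h : Sym g) : Sym (us g) := by rw [Sym, ← refl_us, h]

/-- The real `ℓ²` inner product. -/
def ip (a b : ℤ → ℂ) : ℝ := ∑' n, ((starRingEnd ℂ) (a n) * b n).re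

theorem ip_summable {a b : ℤ → ℂ} (ha : Sq a) (hb : Sq b) :
    Summable fun n => ((starRingEnd ℂ) (a n) * b n).re :=
  Summable.of_norm_bounded (ha.mul_le hb).1 fun n => by
    refine (Complex.abs_re_le_norm _).trans ?_
    simp

theorem abs_ip_le {a b : ℤ → ℂ} (ha : Sq a) (hb : Sq b) : |ip a b| ≤ N2 a * N2 b := by
  refine le_trans ?_ (ha.mul_le hb).2
  rw [ip, ← Real.norm_eq_abs]
  refine tsum_of_norm_bounded (ha.mul_le hb).1.hasSum fun n => ?_
  refine (Complex.abs_re_le_norm _).trans ?_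
  simp

theorem ip_add {a b c : ℤ → ℂ} (ha : Sq a) (hb : Sq b) (hc : Sq c) :
    ip a (fun n => b n + c n) = ip a b + ip a c := by
  rw [ip, ip, ip, ← Summable.tsum_add (ip_summable ha hb) (ip_summable ha hc)]
  simp [mul_add]

theorem ip_const_mul (r : ℝ) (a b : ℤ → ℂ) : ip a (fun n => r * b n) = r * ip a b := by
  rw [ip, ip, ← tsum_mul_left]
  refine tsum_congr fun n => ?_
  rw [mul_left_comm, Complex.re_ofReal_mul]

/-- Absolute summability over `ℤ × ℤ` is the point: it permits the exchange of the two frequencies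
in `ip_transport`, which is integration by parts on the Fourier side. -/
theorem ip_conv_eq_tsum {F γ β : ℤ → ℂ} (hF : Sq F) (hγ : S1 γ) (hβ : Sq β) :
    Summable (fun x : ℤ × ℤ => ((starRingEnd ℂ) (F x.1) * (γ (x.1 - x.2) * β x.2)).re) ∧
      ∑' x : ℤ × ℤ, ((starRingEnd ℂ) (F x.1) * (γ (x.1 - x.2) * β x.2)).re = ip F (conv γ β) := by
  have hγ' : S1 (fun n => ‖γ n‖) := by simpa [S1] using hγ
  have hβ' : Sq (fun n => ‖β n‖) := by simpa [Sq] using hβ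
  have hs0 : Summable fun n => ‖F n‖ * ∑' m, ‖γ (n - m)‖ * ‖β m‖ := by
    have h := (hF.mul_le (young (𝕜 := ℝ) hγ' hβ').1).1
    have e : ∀ n, ‖conv (fun n => ‖γ n‖) (fun n => ‖β n‖) n‖ = ∑' m, ‖γ (n - m)‖ * ‖β m‖ := by
      intro n
      rw [Real.norm_of_nonneg (by unfold conv; exact tsum_nonneg fun _ => by positivity)]
      rfl
    simpa only [e] using h
  have hs : Summable (fun x : ℤ × ℤ => ‖F x.1‖ * (‖γ (x.1 - x.2)‖ * ‖β x.2‖)) := by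
    have h0 : (0 : ℤ × ℤ → ℝ) ≤ fun x => ‖F x.1‖ * (‖γ (x.1 - x.2)‖ * ‖β x.2‖) :=
      fun x => mul_nonneg (norm_nonneg _) (mul_nonneg (norm_nonneg _) (norm_nonneg _))
    have hrow : ∀ n, Summable fun m => ‖F n‖ * (‖γ (n - m)‖ * ‖β m‖) := fun n =>
      Summable.mul_left ‖F n‖ (hγ.sq.conv_summable hβ n)
    refine (summable_prod_of_nonneg h0).2 ⟨hrow, ?_⟩
    simpa only [tsum_mul_left] using hs0
  have hs' : Summable (fun x : ℤ × ℤ => (starRingEnd ℂ) (F x.1) * (γ (x.1 - x.2) * β x.2)) := by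
    refine Summable.of_norm ?_
    simpa only [norm_mul, RCLike.norm_conj] using hs
  have hre := (Complex.hasSum_re hs'.hasSum).summable
  refine ⟨hre, ?_⟩
  rw [hre.tsum_prod, ip]
  refine tsum_congr fun n => ?_
  rw [conv, ← tsum_mul_left, Complex.re_tsum ((hγ.sq.conv_summable' hβ n).mul_left _)]

/-- Skew symmetry of the transport term. -/
theorem ip_transport {u F : ℤ → ℂ} (hu : S1 u) (hDu : S1 (Ds u)) (hsym : Sym u) (hF : InH 1 F) :
    ip F (conv u (Ds F)) = -(1 / 2) * ip F (conv (Ds u) F) := by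
  have hFs := hF.sq.1
  have hDF : Sq (Ds F) := by simpa only [InH, W_zero] using (InH.Ds (k := 0) hF).1
  set Φ : ℤ × ℤ → ℝ := fun x => ((starRingEnd ℂ) (F x.1) * (u (x.1 - x.2) * Ds F x.2)).re with hΦ
  set Ψ : ℤ × ℤ → ℝ := fun x => ((starRingEnd ℂ) (F x.1) * (Ds u (x.1 - x.2) * F x.2)).re with hΨ
  obtain ⟨s1, e1⟩ := ip_conv_eq_tsum hFs hu hDF
  obtain ⟨s2, e2⟩ := ip_conv_eq_tsum hFs hDu hFs
  have hswap : ∑' x, Φ x = ∑' x : ℤ × ℤ, Φ x.swap := ((Equiv.prodComm ℤ ℤ).tsum_eq Φ).symm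
  have s1' : Summable fun x : ℤ × ℤ => Φ x.swap := (Equiv.prodComm ℤ ℤ).summable_iff.2 s1
  -- Since `u (m - n)` is the conjugate of `u (n - m)`, conjugating the swapped term leaves the
  -- common factor `conj (F n) * u (n - m) * F m`. The symbols `i m` and `-i n` add up to `-i (n -
  -- m)`, a derivative of `u` alone.
  have hpt : ∀ x : ℤ × ℤ, Φ x + Φ x.swap = -Ψ x := by
    rintro ⟨n, m⟩
    simp only [hΦ, hΨ, Prod.swap]
    have hu' : u (m - n) = (starRingEnd ℂ) (u (n - m)) := by
      rw [← hsym.apply (m - n)]; simp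
    rw [hu', ← Complex.conj_re ((starRingEnd ℂ) (F m) * ((starRingEnd ℂ) (u (n - m)) * Ds F n)),
      ← Complex.add_re, ← Complex.neg_re]
    congr 1
    simp only [Ds, map_mul, Complex.conj_conj, Complex.conj_I, map_intCast]
    push_cast
    ring
  have : 2 * ∑' x, Φ x = -∑' x, Ψ x := by
    rw [two_mul]
    nth_rewrite 2 [hswap]
    rw [← s1.tsum_add s1', ← tsum_neg]
    exact tsum_congr hpt
  rw [← e1, ← e2]
  linarith

theorem abs_ip_transport_le {u F : ℤ → ℂ} (hu : S1 u) (hDu : S1 (Ds u)) (hsym : Sym u)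
    (hF : InH 1 F) : |ip F (conv u (Ds F))| ≤ N1 (Ds u) * N2 F ^ 2 := by
  rw [ip_transport hu hDu hsym hF, abs_mul]
  have h := young hDu hF.sq.1
  have h2 := abs_ip_le hF.sq.1 h.1
  have h3 : N2 F * N2 (conv (Ds u) F) ≤ N2 F * (N1 (Ds u) * N2 F) :=
    mul_le_mul_of_nonneg_left h.2 (N2_nonneg _)
  have : 0 ≤ N1 (Ds u) * N2 F ^ 2 := mul_nonneg (N1_nonneg _) (sq_nonneg _)
  norm_num
  nlinarith [abs_nonneg (ip F (conv (Ds u) F))]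

end Operators

/-! ### Estimates of the nonlinearity -/

section Estimates

theorem Sq.comb {x y z : ℤ → ℂ} (hx : Sq x) (hy : Sq y) (hz : Sq z) (p q a : ℝ) :
    Sq (fun n => (p : ℂ) * x n + q * y n - a * z n) ∧
      N2 (fun n => (p : ℂ) * x n + q * y n - a * z n) ≤
        |p| * N2 x + |q| * N2 y + |a| * N2 z := by
  have h1 := hx.const_mul (p : ℂ)
  have h2 := hy.const_mul (q : ℂ)
  have h3 := hz.const_mul (a : ℂ)
  have h4 := h1.1.add h2.1
  have h5 := h4.1.sub h3.1
  refine ⟨h5.1, h5.2.trans ?_⟩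
  have e1 := h1.2
  have e2 := h2.2
  have e3 := h3.2
  simp only [Complex.norm_real, Real.norm_eq_abs] at e1 e2 e3
  linarith [h4.2]

/-- The constant of the quadratic estimate. -/
def Cn (a p q : ℝ) : ℝ := kap * (|p| + |q|) + 4 * kap * |a|

/-- The constant of the difference estimate. -/
def Cd (a p q : ℝ) : ℝ := Cn a p q + |a| * kap

theorem Cn_nonneg (a p q : ℝ) : 0 ≤ Cn a p q := by
  have := kap_nonneg
  unfold Cn; positivity

theorem Cn_le_Cd (a p q : ℝ) : Cn a p q ≤ Cd a p q := by
  have := mul_nonneg (abs_nonneg a) kap_nonneg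
  unfold Cd; linarith

/-- The crude estimate with loss of one derivative. It controls time derivatives, hence Lipschitz
bounds in the weaker norm, but cannot close an energy estimate. -/
theorem nl_bound (a p q : ℝ) {k : ℕ} {f g : ℤ → ℂ} (hf : InH (k + 1) f) (hg : InH (k + 1) g) :
    InH k (nl a p q f g) ∧
      N2 (W k (nl a p q f g)) ≤ Cn a p q * N2 (W (k + 1) f) * N2 (W (k + 1) g) := by
  have hf0 := hf.mono (Nat.le_succ k)
  have hg0 := hg.mono (Nat.le_succ k)
  have hk := kap_nonneg
  have nf := N2_nonneg (W (k + 1) f)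
  have ng := N2_nonneg (W (k + 1) g)
  have b1 : ∀ {h : ℤ → ℂ}, InH (k + 1) h →
      S1 (W k (Hs h)) ∧ N1 (W k (Hs h)) ≤ kap * N2 (W (k + 1) h) := fun {h} hh => by
    rw [W_Hs]
    exact ⟨hh.s1_W.1.Hs.1, hh.s1_W.1.Hs.2.trans hh.s1_W.2⟩
  have c1 := conv_W (b1 hg).1 hf0.1
  have c2 := conv_W (b1 hf).1 hg0.1
  have c3 := conv_W (us_bound hg0.1).1 hf.Ds.1
  have hc := Sq.comb c1.1 c2.1 c3.1 p q a
  have e : W k (nl a p q f g) = fun n => (p : ℂ) * W k (conv (Hs g) f) n +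
      q * W k (conv (Hs f) g) n - a * W k (conv (us g) (Ds f)) n := by
    funext n; simp only [W, nl]; ring
  rw [InH, e]
  refine ⟨hc.1, hc.2.trans ?_⟩
  have d1 : N2 (W k (conv (Hs g) f)) ≤ kap * N2 (W (k + 1) g) * N2 (W (k + 1) f) :=
    c1.2.trans (mul_le_mul (b1 hg).2 hf0.2 (N2_nonneg _) (by positivity))
  have d2 : N2 (W k (conv (Hs f) g)) ≤ kap * N2 (W (k + 1) f) * N2 (W (k + 1) g) :=
    c2.2.trans (mul_le_mul (b1 hf).2 hg0.2 (N2_nonneg _) (by positivity))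
  have d3 : N2 (W k (conv (us g) (Ds f))) ≤ 4 * kap * N2 (W (k + 1) g) * N2 (W (k + 1) f) :=
    c3.2.trans (mul_le_mul ((us_bound hg0.1).2.trans
      (mul_le_mul_of_nonneg_left hg0.2 (by positivity))) hf.Ds.2 (N2_nonneg _) (by positivity))
  calc _ ≤ |p| * (kap * N2 (W (k + 1) g) * N2 (W (k + 1) f)) +
      |q| * (kap * N2 (W (k + 1) f) * N2 (W (k + 1) g)) +
      |a| * (4 * kap * N2 (W (k + 1) g) * N2 (W (k + 1) f)) := by gcongr
    _ = _ := by rw [Cn]; ring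

theorem nl_sq (a p q : ℝ) {f g : ℤ → ℂ} (hf : InH 1 f) (hg : InH 1 g) :
    Sq (nl a p q f g) ∧ N2 (nl a p q f g) ≤ Cn a p q * N2 (W 1 f) * N2 (W 1 g) := by
  have := nl_bound a p q (k := 0) hf hg
  simpa only [InH, W_zero, zero_add] using this

/-- The part of the difference `nl f g - nl f' g'` without loss of derivatives. -/
def nlDiff (a p q : ℝ) (f g f' g' : ℤ → ℂ) (n : ℤ) : ℂ :=
  (p : ℂ) * (conv (Hs g') (fun n => f n - f' n) n + conv (Hs fun n => g n - g' n) f n) +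
    q * (conv (Hs fun n => f n - f' n) g n + conv (Hs f') (fun n => g n - g' n) n) -
    a * conv (us fun n => g n - g' n) (Ds f) n

/-! ### Differences of the nonlinearity at two pairs of functions. -/

section Difference

variable {a p q ρ : ℝ} {f g f' g' : ℤ → ℂ}

/-- Telescoping is arranged so that the only derivative of a difference stands in a pure transport
term with velocity `us g'`, where skew symmetry applies. -/
theorem nl_sub_nl (hf : InH 1 f) (hg : InH 1 g) (hf' : InH 1 f') (hg' : InH 1 g') (n : ℤ) :
    nl a p q f g n - nl a p q f' g' n = nlDiff a p q f g f' g' n -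
      a * conv (us g') (Ds fun n => f n - f' n) n := by
  have hDf : Sq (Ds f) := by simpa only [InH, W_zero] using (InH.Ds (k := 0) hf).1
  have hDf' : Sq (Ds f') := by simpa only [InH, W_zero] using (InH.Ds (k := 0) hf').1
  simp only [nl, nlDiff]
  rw [Hs_sub, Hs_sub, Ds_sub, us_sub hg.sq.1 hg'.sq.1,
    conv_sub_right hg'.Hs.1.sq.1 hf.sq.1 hf'.sq.1,
    conv_sub_left hg.Hs.1.sq.1 hg'.Hs.1.sq.1 hf.sq.1,
    conv_sub_left hf.Hs.1.sq.1 hf'.Hs.1.sq.1 hg.sq.1,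
    conv_sub_right hf'.Hs.1.sq.1 hg.sq.1 hg'.sq.1,
    conv_sub_left (us_S1 hg.sq.1).1.sq (us_S1 hg'.sq.1).1.sq hDf,
    conv_sub_right (us_S1 hg'.sq.1).1.sq hDf hDf']
  ring

/-- In the stretching terms the difference is kept in `ℓ²` and the other factor, bounded in `H¹`,
goes into `ℓ¹`. In the velocity term the roles are reversed: the velocity of a difference is in `ℓ¹`
and `Ds f` is only in `ℓ²`. -/
theorem nlDiff_bound (hf : InH 1 f) (hg : InH 1 g) (hf' : InH 1 f') (hg' : InH 1 g')
    (bf : N2 (W 1 f) ≤ ρ) (bg : N2 (W 1 g) ≤ ρ) (bf' : N2 (W 1 f') ≤ ρ) (bg' : N2 (W 1 g') ≤ ρ) :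
    Sq (nlDiff a p q f g f' g') ∧ N2 (nlDiff a p q f g f' g') ≤
      Cn a p q * ρ * (N2 (fun n => f n - f' n) + N2 (fun n => g n - g' n)) := by
  have hk := kap_nonneg
  have hρ : 0 ≤ ρ := (N2_nonneg _).trans bf
  set F : ℤ → ℂ := fun n => f n - f' n with hF
  set G : ℤ → ℂ := fun n => g n - g' n with hG
  have sF : Sq F := (hf.sub hf').1.sq.1
  have sG : Sq G := (hg.sub hg').1.sq.1
  have nF := N2_nonneg F
  have nG := N2_nonneg G
  have hHs : ∀ {x : ℤ → ℂ}, Sq x → Sq (Hs x) ∧ N2 (Hs x) ≤ N2 x := fun hx =>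
    hx.mono (norm_Hs_le _)
  have b1 : ∀ {x : ℤ → ℂ}, InH 1 x → N2 (W 1 x) ≤ ρ → S1 x ∧ N1 x ≤ kap * ρ := fun hx h =>
    ⟨hx.s1.1, hx.s1.2.trans (mul_le_mul_of_nonneg_left h hk)⟩
  have hDf : Sq (Ds f) ∧ N2 (Ds f) ≤ N2 (W 1 f) := by
    simpa only [InH, W_zero] using InH.Ds (k := 0) hf
  have c1 := young (b1 hg' bg').1.Hs.1 sF
  have c2 := young' (hHs sG).1 (b1 hf bf).1
  have c3 := young' (hHs sF).1 (b1 hg bg).1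
  have c4 := young (b1 hf' bf').1.Hs.1 sG
  have c5 := young (us_S1 sG).1 hDf.1
  have c12 := c1.1.add c2.1
  have c34 := c3.1.add c4.1
  have hc := Sq.comb c12.1 c34.1 c5.1 p q a
  refine ⟨hc.1, hc.2.trans ?_⟩
  have d1 : N2 (conv (Hs g') F) ≤ kap * ρ * N2 F :=
    c1.2.trans (mul_le_mul_of_nonneg_right ((b1 hg' bg').1.Hs.2.trans (b1 hg' bg').2) nF)
  have d2 : N2 (conv (Hs G) f) ≤ N2 G * (kap * ρ) :=
    c2.2.trans (mul_le_mul (hHs sG).2 (b1 hf bf).2 (N1_nonneg _) nG)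
  have d3 : N2 (conv (Hs F) g) ≤ N2 F * (kap * ρ) :=
    c3.2.trans (mul_le_mul (hHs sF).2 (b1 hg bg).2 (N1_nonneg _) nF)
  have d4 : N2 (conv (Hs f') G) ≤ kap * ρ * N2 G :=
    c4.2.trans (mul_le_mul_of_nonneg_right ((b1 hf' bf').1.Hs.2.trans (b1 hf' bf').2) nG)
  have d5 : N2 (conv (us G) (Ds f)) ≤ 4 * kap * N2 G * ρ :=
    c5.2.trans (mul_le_mul (us_S1 sG).2 (hDf.2.trans bf) (N2_nonneg _) (by positivity))
  calc _ ≤ |p| * (kap * ρ * N2 F + N2 G * (kap * ρ)) +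
      |q| * (N2 F * (kap * ρ) + kap * ρ * N2 G) + |a| * (4 * kap * N2 G * ρ) := by
        refine add_le_add (add_le_add ?_ ?_) ?_
        · exact mul_le_mul_of_nonneg_left (c12.2.trans (add_le_add d1 d2)) (abs_nonneg _)
        · exact mul_le_mul_of_nonneg_left (c34.2.trans (add_le_add d3 d4)) (abs_nonneg _)
        · exact mul_le_mul_of_nonneg_left d5 (abs_nonneg _)
    _ ≤ |p| * (kap * ρ * N2 F + N2 G * (kap * ρ)) +
      |q| * (N2 F * (kap * ρ) + kap * ρ * N2 G) + |a| * (4 * kap * (N2 F + N2 G) * ρ) := by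
        gcongr; linarith
    _ = _ := by rw [Cn]; ring

/-- The `L²` difference estimate without loss of derivatives: after pairing with `f - f'`, the
remaining transport term costs only the `ℓ¹` norm of `Hs g'`. -/
theorem ip_nl_sub_le (hf : InH 1 f) (hg : InH 1 g) (hf' : InH 1 f') (hg' : InH 1 g')
    (bf : N2 (W 1 f) ≤ ρ) (bg : N2 (W 1 g) ≤ ρ) (bf' : N2 (W 1 f') ≤ ρ) (bg' : N2 (W 1 g') ≤ ρ)
    (hsym : Sym g') :
    |ip (fun n => f n - f' n) (fun n => nl a p q f g n - nl a p q f' g' n)| ≤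
      Cd a p q * ρ * (N2 (fun n => f n - f' n) + N2 (fun n => g n - g' n)) *
        N2 (fun n => f n - f' n) := by
  have hρ : 0 ≤ ρ := (N2_nonneg _).trans bf
  obtain ⟨h1, h2⟩ := nlDiff_bound (a := a) (p := p) (q := q) hf hg hf' hg' bf bg bf' bg'
  have h3 : (fun n => nl a p q f g n - nl a p q f' g' n) = fun n => nlDiff a p q f g f' g' n +
      ((-a : ℝ) : ℂ) * conv (us g') (Ds fun n => f n - f' n) n := by
    funext n; rw [nl_sub_nl hf hg hf' hg']; push_cast; ring
  set F : ℤ → ℂ := fun n => f n - f' n with hF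
  set G : ℤ → ℂ := fun n => g n - g' n with hG
  have iF : InH 1 F := (hf.sub hf').1
  have nF := N2_nonneg F
  have nG := N2_nonneg G
  have hDF : Sq (Ds F) := by simpa only [InH, W_zero] using (InH.Ds (k := 0) iF).1
  have hu := us_S1 hg'.sq.1
  have hc := (young hu.1 hDF).1
  have hDu : S1 (Ds (us g')) := by rw [Ds_us]; exact hg'.s1.1.Hs.1
  have ht := abs_ip_transport_le hu.1 hDu hsym.us iF
  have hN : N1 (Ds (us g')) ≤ kap * ρ := by
    rw [Ds_us]
    exact hg'.s1.1.Hs.2.trans (hg'.s1.2.trans (mul_le_mul_of_nonneg_left bg' kap_nonneg))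
  rw [h3, ip_add iF.sq.1 h1 (hc.const_mul _).1, ip_const_mul]
  refine (abs_add_le _ _).trans ?_
  rw [abs_mul, abs_neg]
  have k1 : |ip F (nlDiff a p q f g f' g')| ≤ N2 F * (Cn a p q * ρ * (N2 F + N2 G)) :=
    (abs_ip_le iF.sq.1 h1).trans (mul_le_mul_of_nonneg_left h2 nF)
  have k2 : |ip F (conv (us g') (Ds F))| ≤ kap * ρ * ((N2 F + N2 G) * N2 F) :=
    ht.trans (mul_le_mul hN (by nlinarith) (sq_nonneg _) (mul_nonneg kap_nonneg hρ))
  calc _ ≤ N2 F * (Cn a p q * ρ * (N2 F + N2 G)) + |a| * (kap * ρ * ((N2 F + N2 G) * N2 F)) :=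
        add_le_add k1 (mul_le_mul_of_nonneg_left k2 (abs_nonneg _))
    _ = _ := by rw [Cd]; ring

/-- At one fixed frequency the nonlinearity is Lipschitz in the plain `ℓ²` norm, the lost derivative
being paid by a factor `|n|`. This is enough to pass to the limit in each equation of the Galerkin
scheme. -/
theorem norm_nl_sub_le (hf : InH 1 f) (hg : InH 1 g) (hf' : InH 1 f') (hg' : InH 1 g')
    (bf : N2 (W 1 f) ≤ ρ) (bg : N2 (W 1 g) ≤ ρ) (bf' : N2 (W 1 f') ≤ ρ) (bg' : N2 (W 1 g') ≤ ρ)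
    (n : ℤ) :
    ‖nl a p q f g n - nl a p q f' g' n‖ ≤
      (Cn a p q + |a| * (4 * kap * |(n : ℝ)| + 1)) * ρ *
        (N2 (fun n => f n - f' n) + N2 (fun n => g n - g' n)) := by
  have hρ : 0 ≤ ρ := (N2_nonneg _).trans bf
  have hk := kap_nonneg
  obtain ⟨h1, h2⟩ := nlDiff_bound (a := a) (p := p) (q := q) hf hg hf' hg' bf bg bf' bg'
  rw [nl_sub_nl hf hg hf' hg']
  set F : ℤ → ℂ := fun n => f n - f' n with hF
  set G : ℤ → ℂ := fun n => g n - g' n with hG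
  have iF : InH 1 F := (hf.sub hf').1
  have nF := N2_nonneg F
  have nG := N2_nonneg G
  have hu := us_S1 hg'.sq.1
  have hHg := hg'.Hs.1.sq.1
  have hDF : Sq (Ds F) := by simpa only [InH, W_zero] using (InH.Ds (k := 0) iF).1
  -- The product rule `u F_θ = (u F)_θ - u_θ F`, with `i n = i (n - m) + i m`.
  have e : conv (us g') (Ds F) n = Complex.I * n * conv (us g') F n - conv (Hs g') F n := by
    rw [conv, conv, conv, ← tsum_mul_left, ← Summable.tsum_sub
      ((hu.1.sq.conv_summable' iF.sq.1 n).mul_left _) (hHg.conv_summable' iF.sq.1 n)]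
    refine tsum_congr fun m => ?_
    rw [← Ds_us]
    simp only [Ds]
    push_cast
    ring
  have k1 : ‖conv (us g') F n‖ ≤ 4 * kap * ρ * N2 F := by
    have y := young hu.1 iF.sq.1
    refine (y.1.norm_le n).trans (y.2.trans (mul_le_mul_of_nonneg_right ?_ nF))
    exact hu.2.trans (mul_le_mul_of_nonneg_left (hg'.sq.2.trans bg') (by positivity))
  have k2 : ‖conv (Hs g') F n‖ ≤ ρ * N2 F := by
    refine (norm_conv_le_N2 hHg iF.sq.1 n).trans (mul_le_mul_of_nonneg_right ?_ nF)
    exact (hg'.sq.1.mono (norm_Hs_le g')).2.trans (hg'.sq.2.trans bg')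
  have k3 : ‖conv (us g') (Ds F) n‖ ≤ |(n : ℝ)| * (4 * kap * ρ * N2 F) + ρ * N2 F := by
    rw [e]
    refine (norm_sub_le _ _).trans (add_le_add ?_ k2)
    rw [norm_mul, norm_mul, Complex.norm_I, one_mul, Complex.norm_intCast]
    exact mul_le_mul_of_nonneg_left k1 (abs_nonneg _)
  have k4 := (h1.norm_le n).trans h2
  refine (norm_sub_le _ _).trans ?_
  rw [norm_mul, Complex.norm_real, Real.norm_eq_abs]
  calc _ ≤ Cn a p q * ρ * (N2 F + N2 G) +
        |a| * (|(n : ℝ)| * (4 * kap * ρ * N2 F) + ρ * N2 F) :=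
        add_le_add k4 (mul_le_mul_of_nonneg_left k3 (abs_nonneg _))
    _ ≤ Cn a p q * ρ * (N2 F + N2 G) +
        |a| * (|(n : ℝ)| * (4 * kap * ρ * (N2 F + N2 G)) + ρ * (N2 F + N2 G)) := by
        gcongr <;> linarith
    _ = _ := by ring

end Difference

/-! ### Truncated sums -/

/-- The frequencies of modulus at most `K`. -/
def freq (K : ℕ) : Finset ℤ := Finset.Icc (-(K : ℤ)) K

theorem mem_freq {K : ℕ} {n : ℤ} : n ∈ freq K ↔ |n| ≤ K := by
  rw [freq, Finset.mem_Icc, abs_le]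

/-- The high frequency part. -/
def tail (K : ℕ) (F : ℤ → ℂ) (n : ℤ) : ℂ := if n ∈ freq K then 0 else F n

theorem tail_bound (K : ℕ) {F : ℤ → ℂ} (hF : InH 1 F) :
    Sq (tail K F) ∧ N2 (tail K F) ≤ (1 + (K : ℝ))⁻¹ * N2 (W 1 F) := by
  have h := hF.const_mul (((1 + (K : ℝ))⁻¹ : ℝ) : ℂ)
  have := Sq.mono (a := tail K F) h.1 fun n => ?_
  · refine ⟨this.1, this.2.trans (le_of_eq ?_)⟩
    rw [h.2, Complex.norm_real, Real.norm_of_nonneg (by positivity)]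
  · rw [norm_mul, Complex.norm_real, Real.norm_of_nonneg (by positivity), norm_W, tail]
    split_ifs with hn
    · rw [norm_zero]; exact mul_nonneg (by positivity) (mul_nonneg (wt_pos _ _).le (norm_nonneg _))
    · rw [mem_freq, not_le] at hn
      have hn' : (K : ℝ) < |(n : ℝ)| := by exact_mod_cast hn
      rw [← mul_assoc, wt, pow_one]
      refine le_mul_of_one_le_left (norm_nonneg _) ?_
      rw [inv_mul_eq_div, one_le_div (by positivity)]
      linarith

theorem N2_sq_le_sum_add_tail (K : ℕ) {F : ℤ → ℂ} (hF : InH 1 F) :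
    N2 F ^ 2 ≤ ∑ n ∈ freq K, ‖F n‖ ^ 2 + (N2 (W 1 F)) ^ 2 * (1 + (K : ℝ))⁻¹ := by
  have ht := tail_bound K hF
  have h1 : N2 F ^ 2 = ∑ n ∈ freq K, ‖F n‖ ^ 2 + N2 (tail K F) ^ 2 := by
    rw [N2_sq, N2_sq, ← hF.sq.1.sum_add_tsum_subtype_compl (freq K),
      ← ht.1.sum_add_tsum_subtype_compl (freq K)]
    congr 1
    rw [Finset.sum_eq_zero fun n hn => by simp [tail, hn], zero_add]
    refine tsum_congr fun n => ?_
    simp [tail, n.2]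
  rw [h1]
  refine add_le_add le_rfl ?_
  have h2 := pow_le_pow_left₀ (N2_nonneg _) ht.2 2
  rw [mul_pow] at h2
  refine h2.trans ?_
  rw [mul_comm]
  refine mul_le_mul_of_nonneg_left ?_ (sq_nonneg _)
  refine pow_le_of_le_one (by positivity) ?_ two_ne_zero
  rw [inv_le_one₀ (by positivity)]; linarith [Nat.cast_nonneg (α := ℝ) K]

/-- A Galerkin solution satisfies the equation at low frequencies only, so only a truncated pairing
appears in the derivative of an energy. The full pairing, for which skew symmetry holds, differs
from it by a tail that the `H¹` bound makes `O(1/K)`. -/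
theorem abs_sum_sub_ip_le (K : ℕ) {F b : ℤ → ℂ} (hF : InH 1 F) (hb : Sq b) :
    |∑ n ∈ freq K, ((starRingEnd ℂ) (F n) * b n).re| ≤
      |ip F b| + (1 + (K : ℝ))⁻¹ * N2 (W 1 F) * N2 b := by
  have ht := tail_bound K hF
  have h1 : ip F b = ∑ n ∈ freq K, ((starRingEnd ℂ) (F n) * b n).re + ip (tail K F) b := by
    rw [ip, ip, ← (ip_summable hF.sq.1 hb).sum_add_tsum_subtype_compl (freq K),
      ← (ip_summable ht.1 hb).sum_add_tsum_subtype_compl (freq K)]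
    congr 1
    rw [Finset.sum_eq_zero fun n hn => by simp [tail, hn], zero_add]
    refine tsum_congr fun n => ?_
    simp [tail, n.2]
  have h2 := (abs_ip_le ht.1 hb).trans (mul_le_mul_of_nonneg_right ht.2 (N2_nonneg b))
  have h3 : ∑ n ∈ freq K, ((starRingEnd ℂ) (F n) * b n).re = ip F b - ip (tail K F) b := by
    linarith
  rw [h3]
  exact (abs_sub _ _).trans (by linarith)

/-- The truncated `L²` energy of a pair. -/
def eng (K : ℕ) (F G : ℤ → ℂ) : ℝ := ∑ n ∈ freq K, (‖F n‖ ^ 2 + ‖G n‖ ^ 2)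

theorem eng_eq (K : ℕ) (F G : ℤ → ℂ) :
    eng K F G = ∑ n ∈ freq K, ‖F n‖ ^ 2 + ∑ n ∈ freq K, ‖G n‖ ^ 2 := Finset.sum_add_distrib

/-- The difference estimate for the truncated energy. -/
theorem difference_estimate {a p q ρ : ℝ} {f g f' g' : ℤ → ℂ} (K : ℕ)
    (hf : InH 1 f) (hg : InH 1 g) (hf' : InH 1 f') (hg' : InH 1 g')
    (bf : N2 (W 1 f) ≤ ρ) (bg : N2 (W 1 g) ≤ ρ) (bf' : N2 (W 1 f') ≤ ρ) (bg' : N2 (W 1 g') ≤ ρ)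
    (sf : Sym f') (sg : Sym g') :
    |∑ n ∈ freq K, 2 * (((starRingEnd ℂ) (f n - f' n) * (nl a p q f g n - nl a p q f' g' n)).re +
        ((starRingEnd ℂ) (g n - g' n) * (nl a p q g f n - nl a p q g' f' n)).re)| ≤
      4 * Cd a p q * ρ * (eng K (fun n => f n - f' n) (fun n => g n - g' n) +
        12 * ρ ^ 2 * (1 + (K : ℝ))⁻¹) := by
  have hρ : 0 ≤ ρ := (N2_nonneg _).trans bf
  have hCd := (Cn_nonneg a p q).trans (Cn_le_Cd a p q)
  have hnn : ∀ {x y : ℤ → ℂ}, InH 1 x → InH 1 y → N2 (W 1 x) ≤ ρ → N2 (W 1 y) ≤ ρ →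
      Sq (nl a p q x y) ∧ N2 (nl a p q x y) ≤ Cd a p q * ρ ^ 2 := fun hx hy bx bY => by
    refine ⟨(nl_sq a p q hx hy).1, (nl_sq a p q hx hy).2.trans ?_⟩
    rw [pow_two, ← mul_assoc]
    exact mul_le_mul (mul_le_mul (Cn_le_Cd _ _ _) bx (N2_nonneg _) hCd) bY (N2_nonneg _)
      (by positivity)
  have i1 := ip_nl_sub_le (a := a) (p := p) (q := q) hf hg hf' hg' bf bg bf' bg' sg
  have i2 := ip_nl_sub_le (a := a) (p := p) (q := q) hg hf hg' hf' bg bf bg' bf' sf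
  have n1 := (hnn hf hg bf bg).1.sub (hnn hf' hg' bf' bg').1
  have n2 := (hnn hg hf bg bf).1.sub (hnn hg' hf' bg' bf').1
  have m1 := n1.2.trans (add_le_add (hnn hf hg bf bg).2 (hnn hf' hg' bf' bg').2)
  have m2 := n2.2.trans (add_le_add (hnn hg hf bg bf).2 (hnn hg' hf' bg' bf').2)
  have w1 := (hf.sub hf').2.trans (add_le_add bf bf')
  have w2 := (hg.sub hg').2.trans (add_le_add bg bg')
  have t1 := abs_sum_sub_ip_le K (hf.sub hf').1 n1.1
  have t2 := abs_sum_sub_ip_le K (hg.sub hg').1 n2.1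
  have s1 := N2_sq_le_sum_add_tail K (hf.sub hf').1
  have s2 := N2_sq_le_sum_add_tail K (hg.sub hg').1
  rw [← Finset.mul_sum, Finset.sum_add_distrib, abs_mul, abs_two, eng_eq]
  set F : ℤ → ℂ := fun n => f n - f' n with hF
  set G : ℤ → ℂ := fun n => g n - g' n with hG
  set ε : ℝ := (1 + (K : ℝ))⁻¹ with hε
  have hε0 : 0 ≤ ε := by positivity
  have nF := N2_nonneg F
  have nG := N2_nonneg G
  have p1 : ε * N2 (W 1 F) * N2 (fun n => nl a p q f g n - nl a p q f' g' n) ≤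
      ε * (ρ + ρ) * (Cd a p q * ρ ^ 2 + Cd a p q * ρ ^ 2) :=
    mul_le_mul (mul_le_mul_of_nonneg_left w1 hε0) m1 (N2_nonneg _) (by positivity)
  have p2 : ε * N2 (W 1 G) * N2 (fun n => nl a p q g f n - nl a p q g' f' n) ≤
      ε * (ρ + ρ) * (Cd a p q * ρ ^ 2 + Cd a p q * ρ ^ 2) :=
    mul_le_mul (mul_le_mul_of_nonneg_left w2 hε0) m2 (N2_nonneg _) (by positivity)
  have q1 : N2 (W 1 F) ^ 2 * ε ≤ (ρ + ρ) ^ 2 * ε :=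
    mul_le_mul_of_nonneg_right (pow_le_pow_left₀ (N2_nonneg _) w1 2) hε0
  have q2 : N2 (W 1 G) ^ 2 * ε ≤ (ρ + ρ) ^ 2 * ε :=
    mul_le_mul_of_nonneg_right (pow_le_pow_left₀ (N2_nonneg _) w2 2) hε0
  set x := ∑ n ∈ freq K, ‖F n‖ ^ 2
  set y := ∑ n ∈ freq K, ‖G n‖ ^ 2
  have r : Cd a p q * ρ * (N2 F + N2 G) * N2 F + Cd a p q * ρ * (N2 G + N2 F) * N2 G ≤
      2 * (Cd a p q * ρ) * (x + y + 8 * ρ ^ 2 * ε) := by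
    have : (N2 F + N2 G) ^ 2 ≤ 2 * (x + y + 8 * ρ ^ 2 * ε) := by
      nlinarith [sq_nonneg (N2 F - N2 G)]
    calc _ = Cd a p q * ρ * (N2 F + N2 G) ^ 2 := by ring
      _ ≤ Cd a p q * ρ * (2 * (x + y + 8 * ρ ^ 2 * ε)) :=
        mul_le_mul_of_nonneg_left this (by positivity)
      _ = _ := by ring
  -- Of the constant `12`, the tails of the two squared norms give `8` through `r`; the two tails of
  -- the pairings, `p1` and `p2`, give the remaining `4`.
  have fin := abs_add_le (∑ n ∈ freq K, ((starRingEnd ℂ) (F n) *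
      (nl a p q f g n - nl a p q f' g' n)).re) (∑ n ∈ freq K, ((starRingEnd ℂ) (G n) *
      (nl a p q g f n - nl a p q g' f' n)).re)
  nlinarith

/-! ### The energy estimate in `H^k` -/

/-- The constant of the energy estimate. -/
def Ce (a p q : ℝ) (k : ℕ) : ℝ := (|p| + |q| + |a| * k) * 2 ^ k + |a|

theorem Ce_nonneg (a p q : ℝ) (k : ℕ) : 0 ≤ Ce a p q k := by unfold Ce; positivity

/-- The weight is commuted with the transport term: the commutator is tame by `wt_commutator`, and
transport of `W k f` is handled by skew symmetry. Membership in `H^{k+1}` only makes the pairing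
meaningful and does not enter the bound, which is linear in the `ℓ¹` norms and quadratic in the
`H^k` norms. -/
theorem energy_estimate (a p q : ℝ) {k : ℕ} {f g : ℤ → ℂ} (hf : InH (k + 1) f) (hg : InH k g)
    (hf1 : S1 f) (hg1 : S1 g) (hsym : Sym g) :
    |ip (W k f) (W k (nl a p q f g))| ≤
      Ce a p q k * (N1 f + N1 g) * (N2 (W k f) + N2 (W k g)) * N2 (W k f) := by
  have hf0 : InH k f := (hf.mono (Nat.le_succ k)).1
  have nf := N1_nonneg f
  have ng := N1_nonneg g
  have mf := N2_nonneg (W k f)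
  have mg := N2_nonneg (W k g)
  have hu := us_S1 hg.sq.1
  have hDf : InH k (Ds f) := hf.Ds.1
  set X := (N1 f + N1 g) * (N2 (W k f) + N2 (W k g)) with hX
  have hX0 : 0 ≤ X := by positivity
  have prod : ∀ {x y : ℤ → ℂ}, InH k x → S1 x → InH k y → S1 y →
      Sq (W k (conv (Hs x) y)) ∧ N2 (W k (conv (Hs x) y)) ≤
        2 ^ k * (N2 (W k x) * N1 y + N1 x * N2 (W k y)) := by
    intro x y hx hx1 hy hy1
    refine tame_of_le (by positivity) hx hx1 hy hy1 fun n => ?_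
    rw [norm_W, ← tsum_mul_left]
    refine (mul_le_mul_of_nonneg_left (norm_conv_le _ _ hx1.Hs.1.sq hy1.sq n)
      (wt_pos k n).le).trans ?_
    rw [conv, ← tsum_mul_left]
    refine Summable.tsum_le_tsum (fun m => ?_) ((hx1.Hs.1.sq.conv_summable hy1.sq n).mul_left _)
      ((tame_summable hx hy n).mul_left _)
    calc wt k n * (‖Hs x (n - m)‖ * ‖y m‖) ≤
        (2 ^ k * (wt k (n - m) + wt k m)) * (‖x (n - m)‖ * ‖y m‖) := by
          refine mul_le_mul (wt_le_add k n m)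
            (mul_le_mul_of_nonneg_right (norm_Hs_le _ _) (norm_nonneg _)) (by positivity) ?_
          have := wt_pos k (n - m); have := wt_pos k m; positivity
      _ = _ := by ring
  set c : ℤ → ℂ := fun n => W k (conv (us g) (Ds f)) n - conv (us g) (Ds (W k f)) n with hc
  have hDWf : Sq (Ds (W k f)) := by rw [← W_Ds]; exact hDf
  have comm : Sq c ∧ N2 c ≤ (k * 2 ^ k : ℝ) * (N2 (W k g) * N1 f + N1 g * N2 (W k f)) := by
    refine tame_of_le (by positivity) hg hg1 hf0 hf1 fun n => ?_
    have e : c n = ∑' m, us g (n - m) * (((wt k n - wt k m : ℝ) : ℂ) * Ds f m) := by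
      rw [hc]
      simp only [W, conv]
      rw [← tsum_mul_left, ← Summable.tsum_sub ((hu.1.sq.conv_summable' hDf.sq.1 n).mul_left _)
        (hu.1.sq.conv_summable' hDWf n)]
      refine tsum_congr fun m => ?_
      simp only [Ds, W]; push_cast; ring
    rw [e, ← tsum_mul_left]
    refine tsum_of_norm_bounded ((tame_summable hg hf0 n).mul_left _).hasSum fun m => ?_
    rw [norm_mul, norm_mul, Complex.norm_real, Real.norm_eq_abs, norm_Ds]
    have h1 := wt_commutator k n m
    -- The factor `|n - m|` gained from the weights differentiates the velocity and turns it into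
    -- `Hs g`.
    have h2 : |((n - m : ℤ) : ℝ)| * ‖us g (n - m)‖ ≤ ‖g (n - m)‖ := by
      rw [← norm_Ds, Ds_us]; exact norm_Hs_le _ _
    have hw : 0 ≤ wt k (n - m) + wt k m := by
      have := wt_pos k (n - m); have := wt_pos k m; positivity
    calc _ = (|wt k n - wt k m| * |(m : ℝ)|) * (‖us g (n - m)‖ * ‖f m‖) := by ring
      _ ≤ (k * 2 ^ k * |((n - m : ℤ) : ℝ)| * (wt k (n - m) + wt k m)) *
          (‖us g (n - m)‖ * ‖f m‖) := mul_le_mul_of_nonneg_right h1 (by positivity)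
      _ = k * 2 ^ k * (wt k (n - m) + wt k m) *
          ((|((n - m : ℤ) : ℝ)| * ‖us g (n - m)‖) * ‖f m‖) := by ring
      _ ≤ k * 2 ^ k * (wt k (n - m) + wt k m) * (‖g (n - m)‖ * ‖f m‖) := by gcongr
      _ = _ := by ring
  have p1 := prod hg hg1 hf0 hf1
  have p2 := prod hf0 hf1 hg hg1
  have hP := Sq.comb p1.1 p2.1 comm.1 p q a
  have hT : Sq (conv (us g) (Ds (W k f))) := (young hu.1 hDWf).1
  have e : W k (nl a p q f g) = fun n => ((p : ℂ) * W k (conv (Hs g) f) n +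
      q * W k (conv (Hs f) g) n - a * c n) + ((-a : ℝ) : ℂ) * conv (us g) (Ds (W k f)) n := by
    funext n; simp only [hc, W, nl]; push_cast; ring
  have hDu : S1 (Ds (us g)) := by rw [Ds_us]; exact hg1.Hs.1
  have iW : InH 1 (W k f) := by rw [InH, W_W, add_comm]; exact hf
  have ht := abs_ip_transport_le hu.1 hDu hsym.us iW
  rw [e, ip_add hf0 hP.1 (hT.const_mul _).1, ip_const_mul]
  refine (abs_add_le _ _).trans ?_
  rw [abs_mul, abs_neg]
  have x1 : N2 (W k g) * N1 f + N1 g * N2 (W k f) ≤ X := by rw [hX]; nlinarith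
  have x2 : N2 (W k f) * N1 g + N1 f * N2 (W k g) ≤ X := by rw [hX]; nlinarith
  have k1 := (abs_ip_le hf0 hP.1).trans (mul_le_mul_of_nonneg_left (hP.2.trans
    (add_le_add (add_le_add
      (mul_le_mul_of_nonneg_left (p1.2.trans (mul_le_mul_of_nonneg_left x1 (by positivity)))
        (abs_nonneg p))
      (mul_le_mul_of_nonneg_left (p2.2.trans (mul_le_mul_of_nonneg_left x2 (by positivity)))
        (abs_nonneg q)))
      (mul_le_mul_of_nonneg_left (comm.2.trans (mul_le_mul_of_nonneg_left x1 (by positivity)))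
        (abs_nonneg a)))) mf)
  have k2 : |ip (W k f) (conv (us g) (Ds (W k f)))| ≤ X * N2 (W k f) := by
    refine ht.trans ?_
    have : N1 (Ds (us g)) ≤ N1 g := by rw [Ds_us]; exact hg1.Hs.2
    calc _ ≤ N1 g * N2 (W k f) ^ 2 := mul_le_mul_of_nonneg_right this (sq_nonneg _)
      _ = (N1 g * N2 (W k f)) * N2 (W k f) := by ring
      _ ≤ X * N2 (W k f) := by
        refine mul_le_mul_of_nonneg_right ?_ mf
        rw [hX]; nlinarith
  calc _ ≤ _ := add_le_add k1 (mul_le_mul_of_nonneg_left k2 (abs_nonneg a))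
    _ = _ := by rw [Ce, hX]; ring

end Estimates

/-! ### Coefficientwise solutions and uniqueness -/

section Uniqueness

/-- Two-sided Grönwall inequality. -/
theorem gronwall_two_sided {α β C ε : ℝ} {y y' : ℝ → ℝ}
    (hy : ∀ t ∈ Ioo α β, HasDerivAt y (y' t) t)
    (hb : ∀ t ∈ Ioo α β, |y' t| ≤ C * (y t + ε)) {s t : ℝ} (hs : s ∈ Ioo α β) (ht : t ∈ Ioo α β) :
    y t + ε ≤ (y s + ε) * Real.exp (C * |t - s|) := by
  have hexp : ∀ c t : ℝ, HasDerivAt (fun τ => Real.exp (c * τ)) (Real.exp (c * t) * c) t :=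
    fun c t => by simpa using ((hasDerivAt_id t).const_mul c).exp
  have hd : ∀ c, ∀ t ∈ Ioo α β, HasDerivAt (fun τ => (y τ + ε) * Real.exp (c * τ))
      ((y' t + c * (y t + ε)) * Real.exp (c * t)) t := fun c t ht =>
    (((hy t ht).add_const ε).fun_mul (hexp c t)).congr_deriv (by ring)
  have hcont : ∀ c, ContinuousOn (fun τ => (y τ + ε) * Real.exp (c * τ)) (Ioo α β) := fun c t ht =>
    (hd c t ht).continuousAt.continuousWithinAt
  have hmono : MonotoneOn (fun τ => (y τ + ε) * Real.exp (C * τ)) (Ioo α β) := by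
    refine monotoneOn_of_deriv_nonneg (convex_Ioo α β) (hcont C) ?_ ?_
    · rw [interior_Ioo]; exact fun t ht => (hd C t ht).differentiableAt.differentiableWithinAt
    · rw [interior_Ioo]; intro t ht
      rw [(hd C t ht).deriv]
      exact mul_nonneg (by linarith [(abs_le.1 (hb t ht)).1]) (Real.exp_pos _).le
  have hanti : AntitoneOn (fun τ => (y τ + ε) * Real.exp (-C * τ)) (Ioo α β) := by
    refine antitoneOn_of_deriv_nonpos (convex_Ioo α β) (hcont (-C)) ?_ ?_
    · rw [interior_Ioo]; exact fun t ht => (hd (-C) t ht).differentiableAt.differentiableWithinAt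
    · rw [interior_Ioo]; intro t ht
      rw [(hd (-C) t ht).deriv]
      exact mul_nonpos_of_nonpos_of_nonneg (by linarith [(abs_le.1 (hb t ht)).2])
        (Real.exp_pos _).le
  have key : ∀ u v w : ℝ, u * Real.exp v ≤ w → u ≤ w * Real.exp (-v) := fun u v w h => by
    calc u = u * Real.exp v * Real.exp (-v) := by
          rw [mul_assoc, ← Real.exp_add, add_neg_cancel, Real.exp_zero, mul_one]
      _ ≤ _ := mul_le_mul_of_nonneg_right h (Real.exp_pos _).le
  rcases le_total s t with h | h
  · have := key _ _ _ (hanti hs ht h)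
    rw [abs_of_nonneg (sub_nonneg.2 h)]
    refine this.trans (le_of_eq ?_)
    rw [mul_assoc, ← Real.exp_add]; congr 2; ring
  · have := key _ _ _ (hmono ht hs h)
    rw [abs_of_nonpos (sub_nonpos.2 h)]
    refine this.trans (le_of_eq ?_)
    rw [mul_assoc, ← Real.exp_add]; congr 2; ring

/-- The pair `(f, g)` solves the system at the frequencies in `S` and the times in `J`. -/
def SolOn (a p q : ℝ) (S : Set ℤ) (J : Set ℝ) (f g : ℝ → ℤ → ℂ) : Prop :=
  ∀ t ∈ J, ∀ n ∈ S, HasDerivAt (fun s => f s n) (nl a p q (f t) (g t) n) t ∧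
    HasDerivAt (fun s => g s n) (nl a p q (g t) (f t) n) t

/-- On `J` both components are real, lie in `H^k` and have `H^k` norm at most `ρ`. -/
def BddOn (k : ℕ) (ρ : ℝ) (J : Set ℝ) (f g : ℝ → ℤ → ℂ) : Prop :=
  ∀ t ∈ J, (InH k (f t) ∧ N2 (W k (f t)) ≤ ρ ∧ Sym (f t)) ∧
    (InH k (g t) ∧ N2 (W k (g t)) ≤ ρ ∧ Sym (g t))

variable {a p q ρ : ℝ} {f g f' g' : ℝ → ℤ → ℂ} {J : Set ℝ}

theorem hasDerivAt_norm_sq {z : ℝ → ℂ} {z' : ℂ} {t : ℝ} (h : HasDerivAt z z' t) :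
    HasDerivAt (fun s => ‖z s‖ ^ 2) (2 * ((starRingEnd ℂ) (z t) * z').re) t := by
  have := h.norm_sq
  rw [Complex.inner, mul_comm z'] at this
  exact this

/-- Only the equations at frequencies up to `K` are required, so the statement serves both for
comparing two Galerkin solutions and for two exact ones. Grönwall is applied with the tail error of
`difference_estimate` as its additive constant. -/
theorem stability {K : ℕ} {α β : ℝ} (h : SolOn a p q (freq K) (Ioo α β) f g)
    (h' : SolOn a p q (freq K) (Ioo α β) f' g') (hb : BddOn 1 ρ (Ioo α β) f g)
    (hb' : BddOn 1 ρ (Ioo α β) f' g') {s t : ℝ} (hs : s ∈ Ioo α β) (ht : t ∈ Ioo α β) :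
    eng K (fun n => f t n - f' t n) (fun n => g t n - g' t n) + 12 * ρ ^ 2 * (1 + (K : ℝ))⁻¹ ≤
      (eng K (fun n => f s n - f' s n) (fun n => g s n - g' s n) + 12 * ρ ^ 2 * (1 + (K : ℝ))⁻¹) *
        Real.exp (4 * Cd a p q * ρ * |t - s|) := by
  refine gronwall_two_sided
    (y := fun t => eng K (fun n => f t n - f' t n) (fun n => g t n - g' t n))
    (y' := fun t => ∑ n ∈ freq K, 2 *
      (((starRingEnd ℂ) (f t n - f' t n) *
        (nl a p q (f t) (g t) n - nl a p q (f' t) (g' t) n)).re +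
      ((starRingEnd ℂ) (g t n - g' t n) *
        (nl a p q (g t) (f t) n - nl a p q (g' t) (f' t) n)).re)) ?_ ?_ hs ht
  · intro t ht
    refine HasDerivAt.fun_sum fun n hn => ?_
    rw [mul_add]
    exact (hasDerivAt_norm_sq ((h t ht n hn).1.sub (h' t ht n hn).1)).add
      (hasDerivAt_norm_sq ((h t ht n hn).2.sub (h' t ht n hn).2))
  · intro t ht
    obtain ⟨⟨i1, b1, -⟩, i2, b2, -⟩ := hb t ht
    obtain ⟨⟨i3, b3, s3⟩, i4, b4, s4⟩ := hb' t ht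
    exact difference_estimate K i1 i2 i3 i4 b1 b2 b3 b4 s3 s4

theorem SolOn.mono {S S' : Set ℤ} {J' : Set ℝ} (h : SolOn a p q S J f g) (hS : S' ⊆ S)
    (hJ : J' ⊆ J) : SolOn a p q S' J' f g := fun t ht n hn => h t (hJ ht) n (hS hn)

theorem BddOn.mono {k : ℕ} {J' : Set ℝ} (h : BddOn k ρ J f g) (hJ : J' ⊆ J) : BddOn k ρ J' f g :=
  fun t ht => h t (hJ ht)

theorem norm_sq_le_eng {K : ℕ} {n : ℤ} (hn : n ∈ freq K) (F G : ℤ → ℂ) :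
    ‖F n‖ ^ 2 + ‖G n‖ ^ 2 ≤ eng K F G :=
  Finset.single_le_sum (f := fun n => ‖F n‖ ^ 2 + ‖G n‖ ^ 2) (fun _ _ => by positivity) hn

theorem mem_freq_natAbs {n : ℤ} {K : ℕ} (h : n.natAbs ≤ K) : n ∈ freq K := by
  rw [mem_freq, Int.abs_eq_natAbs]; exact_mod_cast h

theorem tendsto_inv_one_add : Tendsto (fun K : ℕ => (1 + (K : ℝ))⁻¹) atTop (𝓝 0) := by
  simpa [add_comm] using tendsto_one_div_add_atTop_nhds_zero_nat (𝕜 := ℝ)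

/-- The truncated energy vanishes at time `s`, so `stability` bounds each coefficient by a tail
error that tends to zero as `K` grows. -/
theorem uniqueness {α β : ℝ} (h : SolOn a p q univ (Ioo α β) f g)
    (h' : SolOn a p q univ (Ioo α β) f' g') (hb : BddOn 1 ρ (Ioo α β) f g)
    (hb' : BddOn 1 ρ (Ioo α β) f' g') {s : ℝ} (hs : s ∈ Ioo α β) (hf : f s = f' s)
    (hg : g s = g' s) {t : ℝ} (ht : t ∈ Ioo α β) : f t = f' t ∧ g t = g' t := by
  have key : ∀ n, ‖f t n - f' t n‖ ^ 2 + ‖g t n - g' t n‖ ^ 2 ≤ 0 := fun n => by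
    have hlim : Tendsto (fun K : ℕ => (12 * ρ ^ 2 * (1 + (K : ℝ))⁻¹) *
        Real.exp (4 * Cd a p q * ρ * |t - s|)) atTop (𝓝 0) := by
      simpa using (tendsto_inv_one_add.const_mul (12 * ρ ^ 2)).mul_const
        (Real.exp (4 * Cd a p q * ρ * |t - s|))
    refine ge_of_tendsto hlim ?_
    filter_upwards [eventually_ge_atTop n.natAbs] with K hK
    have h1 := stability (K := K) (h.mono (subset_univ _) le_rfl) (h'.mono (subset_univ _) le_rfl)
      hb hb' hs ht
    have h2 : eng K (fun n => f s n - f' s n) (fun n => g s n - g' s n) = 0 := by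
      simp [eng, hf, hg]
    rw [h2, zero_add] at h1
    have h3 := norm_sq_le_eng (mem_freq_natAbs hK) (fun n => f t n - f' t n)
      (fun n => g t n - g' t n)
    have : 0 ≤ 12 * ρ ^ 2 * (1 + (K : ℝ))⁻¹ := by positivity
    linarith
  constructor <;> funext n <;> have := key n
  · have : ‖f t n - f' t n‖ ^ 2 = 0 := by
      nlinarith [sq_nonneg ‖f t n - f' t n‖, sq_nonneg ‖g t n - g' t n‖]
    exact sub_eq_zero.1 (norm_eq_zero.1 (pow_eq_zero_iff two_ne_zero |>.1 this))
  · have : ‖g t n - g' t n‖ ^ 2 = 0 := by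
      nlinarith [sq_nonneg ‖f t n - f' t n‖, sq_nonneg ‖g t n - g' t n‖]
    exact sub_eq_zero.1 (norm_eq_zero.1 (pow_eq_zero_iff two_ne_zero |>.1 this))

end Uniqueness

/-! ### The Galerkin approximation -/

section Galerkin

variable {N : ℕ}

/-- The state space of the Galerkin system. -/
abbrev State (N : ℕ) : Type := Bool × freq N → ℂ

/-- A component of a state, extended by zero. -/
def ext (x : State N) (b : Bool) (n : ℤ) : ℂ := if h : n ∈ freq N then x (b, ⟨n, h⟩) else 0

theorem ext_of_notMem (x : State N) (b : Bool) {n : ℤ} (h : n ∉ freq N) : ext x b n = 0 :=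
  dif_neg h

theorem ext_of_mem (x : State N) (b : Bool) {n : ℤ} (h : n ∈ freq N) :
    ext x b n = x (b, ⟨n, h⟩) := dif_pos h

theorem sq_of_support {F : ℤ → ℂ} (h : ∀ n ∉ freq N, F n = 0) :
    Sq F ∧ N2 F ^ 2 = ∑ n ∈ freq N, ‖F n‖ ^ 2 := by
  have h' : ∀ n ∉ freq N, ‖F n‖ ^ 2 = 0 := fun n hn => by simp [h n hn]
  exact ⟨summable_of_ne_finset_zero h', by rw [N2_sq, tsum_eq_sum h']⟩

theorem W_support {k : ℕ} {F : ℤ → ℂ} (h : ∀ n ∉ freq N, F n = 0) : ∀ n ∉ freq N, W k F n = 0 :=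
  fun n hn => by simp [W, h n hn]

theorem ip_of_support {F b : ℤ → ℂ} (h : ∀ n ∉ freq N, F n = 0) :
    ip F b = ∑ n ∈ freq N, ((starRingEnd ℂ) (F n) * b n).re :=
  tsum_eq_sum fun n hn => by simp [h n hn]

theorem eng_of_support {F G : ℤ → ℂ} (hF : ∀ n ∉ freq N, F n = 0) (hG : ∀ n ∉ freq N, G n = 0) :
    eng N F G = N2 F ^ 2 + N2 G ^ 2 := by
  rw [eng_eq, (sq_of_support hF).2, (sq_of_support hG).2]

/-- The `H^1` energy of a state. -/
def energy (x : State N) : ℝ := eng N (W 1 (ext x true)) (W 1 (ext x false))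

/-- The cut off. -/
def cutoff (R : ℝ) (x : State N) : ℝ := Real.smoothTransition (2 - energy x / R)

/-- The cut off Galerkin vector field. -/
def field (a p q R : ℝ) (x : State N) : State N := fun i =>
  (cutoff R x : ℂ) * nl a p q (ext x i.1) (ext x !i.1) i.2

theorem contDiff_ext (b : Bool) (n : ℤ) : ContDiff ℝ ∞ fun x : State N => ext x b n := by
  unfold ext
  split_ifs with h
  · exact contDiff_apply ℝ ℂ _
  · exact contDiff_const

theorem contDiff_conv_ext {γ β : State N → ℤ → ℂ} (hγ : ∀ n, ContDiff ℝ ∞ fun x => γ x n)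
    (hβ : ∀ n, ContDiff ℝ ∞ fun x => β x n) (h0 : ∀ x, ∀ n ∉ freq N, β x n = 0) (n : ℤ) :
    ContDiff ℝ ∞ fun x => conv (γ x) (β x) n := by
  have : (fun x => conv (γ x) (β x) n) = fun x => ∑ m ∈ freq N, γ x (n - m) * β x m := by
    funext x
    exact tsum_eq_sum fun m hm => by rw [h0 x m hm, mul_zero]
  rw [this]
  exact ContDiff.sum fun m _ => (hγ _).mul (hβ _)

theorem contDiff_us_ext (b : Bool) (n : ℤ) :
    ContDiff ℝ ∞ fun x : State N => us (ext x b) n := by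
  unfold us
  split_ifs
  · have : (fun x : State N => ∑' j : ℤ, ext x b j / ((|j| : ℤ) : ℂ)) =
        fun x => ∑ j ∈ freq N, ext x b j / ((|j| : ℤ) : ℂ) := by
      funext x
      exact tsum_eq_sum fun m hm => by rw [ext_of_notMem x b hm, zero_div]
    rw [this]
    exact ContDiff.sum fun m _ => (contDiff_ext b m).div_const _
  · exact ((contDiff_ext b n).div_const _).neg

theorem contDiff_energy : ContDiff ℝ ∞ (energy : State N → ℝ) := by
  unfold energy eng W
  exact ContDiff.sum fun n _ =>
    ((contDiff_const.mul (contDiff_ext true n)).norm_sq ℝ).add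
      ((contDiff_const.mul (contDiff_ext false n)).norm_sq ℝ)

theorem contDiff_field (a p q R : ℝ) : ContDiff ℝ ∞ (field a p q R : State N → State N) := by
  rw [contDiff_pi]
  intro i
  have h1 : ContDiff ℝ ∞ fun x : State N => (cutoff R x : ℂ) :=
    Complex.ofRealCLM.contDiff.comp
      (Real.smoothTransition.contDiff.comp (contDiff_const.sub (contDiff_energy.div_const R)))
  have hH : ∀ (b : Bool) (n : ℤ), ContDiff ℝ ∞ fun x : State N => Hs (ext x b) n := fun b n =>
    contDiff_const.mul (contDiff_ext b n)
  have hD : ∀ (b : Bool) (n : ℤ), ContDiff ℝ ∞ fun x : State N => Ds (ext x b) n := fun b n =>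
    contDiff_const.mul (contDiff_ext b n)
  refine h1.mul (((contDiff_const.mul ?_).add (contDiff_const.mul ?_)).sub (contDiff_const.mul ?_))
  · exact contDiff_conv_ext (hH _) (contDiff_ext _) (fun x n hn => ext_of_notMem x _ hn) _
  · exact contDiff_conv_ext (hH _) (contDiff_ext _) (fun x n hn => ext_of_notMem x _ hn) _
  · exact contDiff_conv_ext (contDiff_us_ext _) (hD _)
      (fun x n hn => by rw [Ds, ext_of_notMem x _ hn, mul_zero]) _

theorem norm_sq_le_energy (x : State N) (i : Bool × freq N) : ‖x i‖ ^ 2 ≤ energy x := by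
  obtain ⟨b, n, hn⟩ := i
  have h := norm_sq_le_eng hn (W 1 (ext x true)) (W 1 (ext x false))
  have h1 : ‖x (b, ⟨n, hn⟩)‖ ≤ ‖W 1 (ext x b) n‖ := by
    rw [norm_W, ext_of_mem x b hn]
    exact le_mul_of_one_le_left (norm_nonneg _) (one_le_wt _ _)
  have h2 := pow_le_pow_left₀ (norm_nonneg _) h1 2
  refine le_trans ?_ h
  cases b
  · exact h2.trans (le_add_of_nonneg_left (by positivity))
  · exact h2.trans (le_add_of_nonneg_right (by positivity))

theorem cutoff_eq_zero {R : ℝ} (hR : 0 < R) {x : State N} (h : 2 * R ≤ energy x) :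
    cutoff R x = 0 := by
  apply Real.smoothTransition.zero_of_nonpos
  rw [sub_nonpos, le_div_iff₀ hR]; exact h

theorem cutoff_eq_one {R : ℝ} (hR : 0 < R) {x : State N} (h : energy x ≤ R) :
    cutoff R x = 1 := by
  apply Real.smoothTransition.one_of_one_le
  have : energy x / R ≤ 1 := (div_le_one hR).2 h
  linarith

/-- The energy dominates every coordinate and the cut off vanishes where the energy exceeds `2 * R`.
Compact support makes the smooth field bounded and globally Lipschitz, so its solutions exist on a
fixed time interval for every `N`. -/
theorem hasCompactSupport_field (a p q : ℝ) {R : ℝ} (hR : 0 < R) :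
    HasCompactSupport (field a p q R : State N → State N) := by
  refine HasCompactSupport.intro (isCompact_closedBall (0 : State N) √(2 * R)) fun x hx => ?_
  rw [mem_closedBall_zero_iff, pi_norm_le_iff_of_nonneg (Real.sqrt_nonneg _)] at hx
  push Not at hx
  obtain ⟨i, hi⟩ := hx
  have h1 : 2 * R < ‖x i‖ ^ 2 := (Real.sqrt_lt' (by
    exact (Real.sqrt_nonneg _).trans_lt hi)).1 hi
  funext j
  simp [field, cutoff_eq_zero hR (h1.le.trans (norm_sq_le_energy x i))]

theorem exists_field_solution (a p q : ℝ) {R : ℝ} (hR : 0 < R) (x₀ : State N) :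
    ∃ α : ℝ → State N, α 0 = x₀ ∧ ∀ t ∈ Ioo (-1 : ℝ) 1, HasDerivAt α (field a p q R (α t)) t := by
  obtain ⟨K, hK⟩ := ContDiff.lipschitzWith_of_hasCompactSupport (𝕂 := ℝ)
    (hasCompactSupport_field (N := N) a p q hR) (contDiff_field a p q R) (by simp)
  obtain ⟨L, hL⟩ := (hasCompactSupport_field (N := N) a p q hR).exists_bound_of_continuous
    (contDiff_field a p q R).continuous
  -- The field is bounded by `L` everywhere and time runs up to distance `1` from the centre, so a
  -- ball of radius `L` contains the solution.
  have hpl : IsPicardLindelof (fun _ : ℝ => (field a p q R : State N → State N))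
      (tmin := -1) (tmax := 1) ⟨0, by norm_num⟩ x₀ L.toNNReal 0 L.toNNReal K :=
    { lipschitzOnWith := fun _ _ => hK.lipschitzOnWith
      continuousOn := fun _ _ => continuousOn_const
      norm_le := fun _ _ x _ => (hL x).trans (Real.le_coe_toNNReal L)
      mul_max_le := by simp }
  obtain ⟨α, h0, hα⟩ := hpl.exists_eq_forall_mem_Icc_hasDerivWithinAt₀
  exact ⟨α, h0, fun t ht => (hα t (Ioo_subset_Icc_self ht)).hasDerivAt (Icc_mem_nhds ht.1 ht.2)⟩

theorem neg_mem_freq {n : ℤ} (h : n ∈ freq N) : -n ∈ freq N := by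
  rw [mem_freq, abs_neg]; exact mem_freq.1 h

/-- The action of complex conjugation on states. -/
def conjState (x : State N) : State N := fun i =>
  (starRingEnd ℂ) (x (i.1, ⟨-i.2, neg_mem_freq i.2.2⟩))

theorem ext_conjState (x : State N) (b : Bool) : ext (conjState x) b = refl (ext x b) := by
  funext n
  by_cases h : n ∈ freq N
  · rw [ext_of_mem _ _ h, refl, ext_of_mem _ _ (neg_mem_freq h)]; rfl
  · have h' : -n ∉ freq N := fun h' => h (by simpa using neg_mem_freq h')
    rw [ext_of_notMem _ _ h, refl, ext_of_notMem _ _ h', map_zero]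

theorem energy_conjState (x : State N) : energy (conjState x) = energy x := by
  unfold energy eng
  rw [ext_conjState, ext_conjState]
  refine Finset.sum_equiv (Equiv.neg ℤ) (fun n => ?_) fun n _ => ?_
  · exact ⟨neg_mem_freq, fun h => by simpa using neg_mem_freq h⟩
  · simp [norm_W, refl, wt]

theorem field_conjState (a p q R : ℝ) (x : State N) :
    field a p q R (conjState x) = conjState (field a p q R x) := by
  funext i
  simp only [field, conjState, cutoff]
  rw [energy_conjState, ext_conjState, ext_conjState, refl_nl]
  simp [refl]

/-- The conjugated curve solves the same equation with the same initial value, so ODE uniqueness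
identifies the two. -/
theorem conjState_solution {a p q R : ℝ} (hR : 0 < R) {α : ℝ → State N}
    (hα : ∀ t ∈ Ioo (-1 : ℝ) 1, HasDerivAt α (field a p q R (α t)) t)
    (h0 : conjState (α 0) = α 0) {t : ℝ} (ht : t ∈ Ioo (-1 : ℝ) 1) : conjState (α t) = α t := by
  obtain ⟨K, hK⟩ := ContDiff.lipschitzWith_of_hasCompactSupport (𝕂 := ℝ)
    (hasCompactSupport_field (N := N) a p q hR) (contDiff_field a p q R) (by simp)
  refine ODE_solution_unique_of_mem_Ioo (t₀ := 0) (v := fun _ => field a p q R) (s := fun _ => univ)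
    (fun _ _ => hK.lipschitzOnWith) (by norm_num)
    (f := fun t => conjState (α t)) (g := α) (fun t ht => ⟨?_, mem_univ _⟩)
    (fun t ht => ⟨hα t ht, mem_univ _⟩) h0 ht
  rw [field_conjState, hasDerivAt_pi]
  intro i
  exact (hasDerivAt_pi.1 (hα t ht) _).star

/-- The growth rate of the `H^k` energy in terms of a bound `R` of the `H^1` energy. -/
def rate (a p q : ℝ) (k : ℕ) (R : ℝ) : ℝ := 8 * kap * √(2 * R) * Ce a p q k

theorem rate_nonneg (a p q : ℝ) (k : ℕ) (R : ℝ) : 0 ≤ rate a p q k R := by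
  have := kap_nonneg
  have := Ce_nonneg a p q k
  unfold rate; positivity

/-- The state is supported in `freq N`, so the truncated pairing is the full one and
`energy_estimate` applies. Where the cut off is nonzero, the `H¹` energy is below `2 * R`, which
bounds the `ℓ¹` norms; elsewhere the sum vanishes. The summand `0` matches the shape of
`gronwall_two_sided`. -/
theorem field_energy_estimate (a p q : ℝ) {R : ℝ} (hR : 0 < R) (k : ℕ) {x : State N}
    (hx : conjState x = x) :
    |∑ n ∈ freq N, 2 * (((starRingEnd ℂ) (W k (ext x true) n) *
        (cutoff R x * W k (nl a p q (ext x true) (ext x false)) n)).re +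
      ((starRingEnd ℂ) (W k (ext x false) n) *
        (cutoff R x * W k (nl a p q (ext x false) (ext x true)) n)).re)| ≤
      rate a p q k R * (eng N (W k (ext x true)) (W k (ext x false)) + 0) := by
  set f := ext x true with hf
  set g := ext x false with hg
  have zf : ∀ n ∉ freq N, f n = 0 := fun n hn => ext_of_notMem x _ hn
  have zg : ∀ n ∉ freq N, g n = 0 := fun n hn => ext_of_notMem x _ hn
  have sf : Sym f := by rw [Sym, hf, ← ext_conjState, hx]
  have sg : Sym g := by rw [Sym, hg, ← ext_conjState, hx]
  have If : ∀ k, InH k f := fun k => (sq_of_support (W_support zf)).1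
  have Ig : ∀ k, InH k g := fun k => (sq_of_support (W_support zg)).1
  set χ := cutoff R x with hχ
  have hχ0 : 0 ≤ χ := Real.smoothTransition.nonneg _
  have hχ1 : χ ≤ 1 := Real.smoothTransition.le_one _
  have e1 := energy_estimate a p q (If (k + 1)) (Ig k) (If 1).s1.1 (Ig 1).s1.1 sg
  have e2 := energy_estimate a p q (Ig (k + 1)) (If k) (Ig 1).s1.1 (If 1).s1.1 sf
  have hsum : ∑ n ∈ freq N, 2 * (((starRingEnd ℂ) (W k f n) *
        ((χ : ℂ) * W k (nl a p q f g) n)).re +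
      ((starRingEnd ℂ) (W k g n) * ((χ : ℂ) * W k (nl a p q g f) n)).re) =
      2 * χ * (ip (W k f) (W k (nl a p q f g)) + ip (W k g) (W k (nl a p q g f))) := by
    rw [ip_of_support (W_support zf), ip_of_support (W_support zg), ← Finset.sum_add_distrib,
      Finset.mul_sum]
    refine Finset.sum_congr rfl fun n _ => ?_
    rw [mul_left_comm, Complex.re_ofReal_mul, mul_left_comm _ (χ : ℂ), Complex.re_ofReal_mul]
    ring
  rw [hsum, add_zero, eng_of_support (W_support zf) (W_support zg)]
  by_cases hE : 2 * R ≤ energy x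
  · rw [hχ, cutoff_eq_zero hR hE, mul_zero, zero_mul, abs_zero]
    exact mul_nonneg (rate_nonneg _ _ _ _ _) (by positivity)
  rw [not_le, energy, eng_of_support (W_support zf) (W_support zg)] at hE
  have mf := N2_nonneg (W k f)
  have mg := N2_nonneg (W k g)
  have b : ∀ {h : ℤ → ℂ}, InH 1 h → N2 (W 1 h) ^ 2 ≤ 2 * R → N1 h ≤ kap * √(2 * R) :=
    fun hi hb => hi.s1.2.trans (mul_le_mul_of_nonneg_left (Real.le_sqrt_of_sq_le hb) kap_nonneg)
  have b1 := b (If 1) (by nlinarith [sq_nonneg (N2 (W 1 g))])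
  have b2 := b (Ig 1) (by nlinarith [sq_nonneg (N2 (W 1 f))])
  have hCe := Ce_nonneg a p q k
  set A := N2 (W k f)
  set B := N2 (W k g)
  set M := kap * √(2 * R) with hM
  have hM0 : 0 ≤ M := mul_nonneg kap_nonneg (Real.sqrt_nonneg _)
  have e1' : |ip (W k f) (W k (nl a p q f g))| ≤ Ce a p q k * (2 * M) * (A + B) * A :=
    e1.trans (by gcongr; linarith)
  have e2' : |ip (W k g) (W k (nl a p q g f))| ≤ Ce a p q k * (2 * M) * (B + A) * B :=
    e2.trans (by gcongr; linarith)
  rw [abs_mul, abs_of_nonneg (show 0 ≤ 2 * χ by positivity)]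
  have h3 := abs_add_le (ip (W k f) (W k (nl a p q f g))) (ip (W k g) (W k (nl a p q g f)))
  calc _ ≤ 2 * 1 * (Ce a p q k * (2 * M) * (A + B) * A + Ce a p q k * (2 * M) * (B + A) * B) := by
        gcongr; linarith
    _ = 4 * (Ce a p q k * M) * (A + B) ^ 2 := by ring
    _ ≤ 4 * (Ce a p q k * M) * (2 * (A ^ 2 + B ^ 2)) := by
        gcongr; nlinarith [sq_nonneg (A - B)]
    _ = _ := by rw [rate, hM]; ring

/-- The life span attached to a bound of the `H^1` energy. -/
def lifespan (a p q R : ℝ) : ℝ := min 1 (Real.log 2 / (rate a p q 1 (2 * R) + 1))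

theorem lifespan_pos (a p q R : ℝ) : 0 < lifespan a p q R := by
  have := rate_nonneg a p q 1 (2 * R)
  exact lt_min one_pos (div_pos (Real.log_pos one_lt_two) (by linarith))

/-- Within the life span the `H¹` energy at most doubles. -/
theorem exp_rate_le {a p q R t : ℝ} (ht : |t| ≤ lifespan a p q R) :
    Real.exp (rate a p q 1 (2 * R) * |t|) ≤ 2 := by
  have h := rate_nonneg a p q 1 (2 * R)
  rw [← Real.le_log_iff_exp_le two_pos]
  have h1 : |t| ≤ Real.log 2 / (rate a p q 1 (2 * R) + 1) := ht.trans (min_le_right _ _)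
  rw [le_div_iff₀ (by linarith)] at h1
  nlinarith [abs_nonneg t]

/-- The truncation of a sequence. -/
def trunc (N : ℕ) (F : ℤ → ℂ) (n : ℤ) : ℂ := if n ∈ freq N then F n else 0

/-- The cut off is placed at level `2 * R`, twice the initial energy bound. During the life span the
energy does not exceed this level, so the cut off equals one and the curve solves the true truncated
system. Nothing in the bounds depends on `N`. -/
theorem exists_galerkin (a p q : ℝ) {R : ℝ} (hR : 0 < R) {f₀ g₀ : ℤ → ℂ} (N : ℕ)
    (hf₀ : InH 1 f₀) (hg₀ : InH 1 g₀) (sf : Sym f₀) (sg : Sym g₀)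
    (hb : N2 (W 1 f₀) ^ 2 + N2 (W 1 g₀) ^ 2 ≤ R) :
    ∃ f g : ℝ → ℤ → ℂ, f 0 = trunc N f₀ ∧ g 0 = trunc N g₀ ∧
      SolOn a p q (freq N) (Ioo (-lifespan a p q R) (lifespan a p q R)) f g ∧
      BddOn 1 √(2 * R) (Ioo (-lifespan a p q R) (lifespan a p q R)) f g ∧
      ∀ k, InH k f₀ → InH k g₀ → ∀ t ∈ Ioo (-lifespan a p q R) (lifespan a p q R),
        InH k (f t) ∧ InH k (g t) ∧ N2 (W k (f t)) ^ 2 + N2 (W k (g t)) ^ 2 ≤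
          (N2 (W k f₀) ^ 2 + N2 (W k g₀) ^ 2) * Real.exp (rate a p q k (2 * R) * |t|) := by
  set δ := lifespan a p q R with hδ
  have hδ0 : 0 < δ := lifespan_pos a p q R
  have hδ1 : δ ≤ 1 := min_le_left _ _
  have h2R : 0 < 2 * R := by positivity
  set x₀ : State N := fun i => if i.1 then f₀ i.2 else g₀ i.2 with hx₀
  obtain ⟨α, h0, hα⟩ := exists_field_solution a p q h2R x₀
  have ef : ext x₀ true = trunc N f₀ := by
    funext n
    by_cases h : n ∈ freq N
    · rw [ext_of_mem _ _ h, trunc, if_pos h]; simp [hx₀]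
    · rw [ext_of_notMem _ _ h, trunc, if_neg h]
  have eg : ext x₀ false = trunc N g₀ := by
    funext n
    by_cases h : n ∈ freq N
    · rw [ext_of_mem _ _ h, trunc, if_pos h]; simp [hx₀]
    · rw [ext_of_notMem _ _ h, trunc, if_neg h]
  have hsym0 : conjState (α 0) = α 0 := by
    rw [h0]; funext ⟨b, n⟩
    cases b
    · simpa [conjState, hx₀] using sg.apply n
    · simpa [conjState, hx₀] using sf.apply n
  have hsym : ∀ t ∈ Ioo (-1 : ℝ) 1, conjState (α t) = α t := fun t ht =>
    conjState_solution h2R hα hsym0 ht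
  have hsub : Ioo (-δ) δ ⊆ Ioo (-1) 1 := Ioo_subset_Ioo (by linarith) hδ1
  have hcoef : ∀ (b : Bool), ∀ t ∈ Ioo (-1 : ℝ) 1, ∀ n ∈ freq N,
      HasDerivAt (fun s => ext (α s) b n)
        (cutoff (2 * R) (α t) * nl a p q (ext (α t) b) (ext (α t) !b) n) t := by
    intro b t ht n hn
    have := hasDerivAt_pi.1 (hα t ht) (b, ⟨n, hn⟩)
    simpa only [ext_of_mem _ _ hn, field] using this
  have hgrow : ∀ k, ∀ t ∈ Ioo (-1 : ℝ) 1,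
      eng N (W k (ext (α t) true)) (W k (ext (α t) false)) ≤
        eng N (W k (trunc N f₀)) (W k (trunc N g₀)) *
          Real.exp (rate a p q k (2 * R) * |t|) := by
    intro k t ht
    have hd : ∀ t ∈ Ioo (-1 : ℝ) 1,
        HasDerivAt (fun s => eng N (W k (ext (α s) true)) (W k (ext (α s) false)))
        (∑ n ∈ freq N, 2 * (((starRingEnd ℂ) (W k (ext (α t) true) n) *
        (cutoff (2 * R) (α t) * W k (nl a p q (ext (α t) true) (ext (α t) false)) n)).re +
      ((starRingEnd ℂ) (W k (ext (α t) false) n) *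
        (cutoff (2 * R) (α t) * W k (nl a p q (ext (α t) false) (ext (α t) true)) n)).re)) t := by
      intro t ht
      refine HasDerivAt.fun_sum fun n hn => ?_
      rw [mul_add]
      refine HasDerivAt.add ?_ ?_
      · refine hasDerivAt_norm_sq (z := fun s => W k (ext (α s) true) n) ?_
        have := (hcoef true t ht n hn).const_mul (wt k n : ℂ)
        exact this.congr_deriv (mul_left_comm _ _ _)
      · refine hasDerivAt_norm_sq (z := fun s => W k (ext (α s) false) n) ?_
        have := (hcoef false t ht n hn).const_mul (wt k n : ℂ)
        exact this.congr_deriv (mul_left_comm _ _ _)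
    have := gronwall_two_sided hd
      (fun t ht => field_energy_estimate a p q h2R k (hsym t ht))
      (s := 0) (t := t) (by norm_num) ht
    simpa only [add_zero, sub_zero, h0, ef, eg] using this
  have ztr : ∀ F : ℤ → ℂ, ∀ n ∉ freq N, trunc N F n = 0 := fun F n hn => if_neg hn
  have htr : ∀ k (F : ℤ → ℂ), InH k F → N2 (W k (trunc N F)) ≤ N2 (W k F) := fun k F hF =>
    (hF.of_norm_le fun n => by rw [trunc]; split_ifs <;> simp).2
  have hgrow' : ∀ k, InH k f₀ → InH k g₀ → ∀ t ∈ Ioo (-1 : ℝ) 1,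
      N2 (W k (ext (α t) true)) ^ 2 + N2 (W k (ext (α t) false)) ^ 2 ≤
          (N2 (W k f₀) ^ 2 + N2 (W k g₀) ^ 2) * Real.exp (rate a p q k (2 * R) * |t|) := by
    intro k hkf hkg t ht
    have := hgrow k t ht
    rw [eng_of_support (W_support (ztr _)) (W_support (ztr _)),
      eng_of_support (W_support fun n hn => ext_of_notMem _ _ hn)
      (W_support fun n hn => ext_of_notMem _ _ hn)] at this
    refine this.trans (mul_le_mul_of_nonneg_right ?_ (Real.exp_pos _).le)
    exact add_le_add (pow_le_pow_left₀ (N2_nonneg _) (htr k _ hkf) 2)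
      (pow_le_pow_left₀ (N2_nonneg _) (htr k _ hkg) 2)
  have hE : ∀ t ∈ Ioo (-δ) δ,
      N2 (W 1 (ext (α t) true)) ^ 2 + N2 (W 1 (ext (α t) false)) ^ 2 ≤ 2 * R := by
    intro t ht
    refine (hgrow' 1 hf₀ hg₀ t (hsub ht)).trans ?_
    exact (mul_le_mul hb (exp_rate_le (abs_lt.2 ht).le) (Real.exp_pos _).le hR.le).trans
      (mul_comm R 2).le
  have hInH : ∀ k t b, InH k (ext (α t) b) := fun k t b =>
    (sq_of_support (W_support fun n hn => ext_of_notMem _ _ hn)).1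
  refine ⟨fun t => ext (α t) true, fun t => ext (α t) false, by rw [← ef, ← h0],
    by rw [← eg, ← h0], ?_, ?_, ?_⟩
  · intro t ht n hn
    have hc : cutoff (2 * R) (α t) = 1 := by
      apply cutoff_eq_one h2R
      rw [energy, eng_of_support (W_support fun n hn => ext_of_notMem _ _ hn)
        (W_support fun n hn => ext_of_notMem _ _ hn)]
      exact hE t ht
    have h1 := hcoef true t (hsub ht) n hn
    have h2 := hcoef false t (hsub ht) n hn
    rw [hc, Complex.ofReal_one, one_mul] at h1 h2
    exact ⟨h1, h2⟩
  · intro t ht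
    have hs := hsym t (hsub ht)
    have := hE t ht
    refine ⟨⟨hInH _ _ _, Real.le_sqrt_of_sq_le (by nlinarith [sq_nonneg (N2 (W 1 (ext (α t) false)))]), ?_⟩,
      ⟨hInH _ _ _, Real.le_sqrt_of_sq_le (by nlinarith [sq_nonneg (N2 (W 1 (ext (α t) true)))]), ?_⟩⟩
    · rw [Sym, ← ext_conjState, hs]
    · rw [Sym, ← ext_conjState, hs]
  · exact fun k hkf hkg t ht => ⟨hInH _ _ _, hInH _ _ _, hgrow' k hkf hkg t (hsub ht)⟩

end Galerkin

/-! ### Local existence on the Fourier side -/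

section LocalExistence

variable {a p q : ℝ}

theorem trunc_of_mem {N : ℕ} {n : ℤ} (h : n ∈ freq N) (F : ℤ → ℂ) : trunc N F n = F n := if_pos h

theorem freq_mono {N M : ℕ} (h : N ≤ M) : freq N ⊆ freq M := fun n hn => by
  rw [mem_freq] at hn ⊢; exact hn.trans (by exact_mod_cast h)

/-- The rate of convergence of the Galerkin approximations. -/
def galerkinError (a p q ρ T : ℝ) (N : ℕ) : ℝ :=
  √((12 * ρ ^ 2 * Real.exp (4 * Cd a p q * ρ * T) + 4 * ρ ^ 2) * (1 + (N : ℝ))⁻¹)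

theorem tendsto_galerkinError (a p q ρ T : ℝ) :
    Tendsto (galerkinError a p q ρ T) atTop (𝓝 0) := by
  have := (tendsto_inv_one_add.const_mul
    (12 * ρ ^ 2 * Real.exp (4 * Cd a p q * ρ * T) + 4 * ρ ^ 2)).sqrt
  rw [mul_zero, Real.sqrt_zero] at this
  exact this

/-- The data agree at frequencies up to `N`, so `stability` leaves only its tail error there.
Frequencies above `N` contribute at most `(2ρ)² / (1 + N)` by the `H¹` bounds, the second summand of
`galerkinError`. -/
theorem galerkin_cauchy {ρ T : ℝ} (hρ : 0 ≤ ρ) {N M : ℕ} (hNM : N ≤ M)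
    {f g f' g' : ℝ → ℤ → ℂ} {f₀ g₀ : ℤ → ℂ}
    (h : SolOn a p q (freq N) (Ioo (-T) T) f g) (h' : SolOn a p q (freq M) (Ioo (-T) T) f' g')
    (hb : BddOn 1 ρ (Ioo (-T) T) f g) (hb' : BddOn 1 ρ (Ioo (-T) T) f' g')
    (hf : f 0 = trunc N f₀) (hg : g 0 = trunc N g₀) (hf' : f' 0 = trunc M f₀)
    (hg' : g' 0 = trunc M g₀) {t : ℝ} (ht : t ∈ Ioo (-T) T) :
    N2 (fun n => f t n - f' t n) ≤ galerkinError a p q ρ T N ∧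
      N2 (fun n => g t n - g' t n) ≤ galerkinError a p q ρ T N := by
  have hT : 0 < T := by linarith [ht.1, ht.2]
  have hCd : 0 ≤ Cd a p q := (Cn_nonneg a p q).trans (Cn_le_Cd a p q)
  have h1 := stability h (h'.mono (by exact_mod_cast freq_mono hNM) le_rfl) hb hb'
    (s := 0) (t := t) ⟨by linarith, hT⟩ ht
  have h0 : eng N (fun n => f 0 n - f' 0 n) (fun n => g 0 n - g' 0 n) = 0 := by
    rw [hf, hg, hf', hg']
    refine Finset.sum_eq_zero fun n hn => ?_
    simp [trunc_of_mem hn, trunc_of_mem (freq_mono hNM hn)]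
  rw [h0, zero_add, sub_zero, eng_eq] at h1
  obtain ⟨⟨i1, b1, -⟩, i2, b2, -⟩ := hb t ht
  obtain ⟨⟨i3, b3, -⟩, i4, b4, -⟩ := hb' t ht
  have s1 := N2_sq_le_sum_add_tail N (i1.sub i3).1
  have s2 := N2_sq_le_sum_add_tail N (i2.sub i4).1
  have w1 := (i1.sub i3).2.trans (add_le_add b1 b3)
  have w2 := (i2.sub i4).2.trans (add_le_add b2 b4)
  set ε : ℝ := (1 + (N : ℝ))⁻¹
  have hε : 0 ≤ ε := by positivity
  have q1 := mul_le_mul_of_nonneg_right (pow_le_pow_left₀ (N2_nonneg _) w1 2) hε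
  have q2 := mul_le_mul_of_nonneg_right (pow_le_pow_left₀ (N2_nonneg _) w2 2) hε
  have hexp : 12 * ρ ^ 2 * ε * Real.exp (4 * Cd a p q * ρ * |t|) ≤
      12 * ρ ^ 2 * ε * Real.exp (4 * Cd a p q * ρ * T) := by
    have := abs_lt.2 ht
    gcongr
  have p0 : 0 ≤ 12 * ρ ^ 2 * ε := by positivity
  have z1 : 0 ≤ ∑ n ∈ freq N, ‖f t n - f' t n‖ ^ 2 := Finset.sum_nonneg fun _ _ => by positivity
  have z2 : 0 ≤ ∑ n ∈ freq N, ‖g t n - g' t n‖ ^ 2 := Finset.sum_nonneg fun _ _ => by positivity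
  constructor <;> refine Real.le_sqrt_of_sq_le ?_ <;> linarith

/-- The Galerkin solutions are uniformly Cauchy in `ℓ²`. The limit inherits the `H¹` and `H^k`
bounds by lower semicontinuity. Each coefficient solves its equation because the derivatives
converge uniformly in time, by `norm_nl_sub_le`. The life span depends on the `H¹` bound `R` alone,
whatever `k` is. -/
theorem local_existence (a p q : ℝ) {R : ℝ} (hR : 0 < R) {f₀ g₀ : ℤ → ℂ}
    (hf₀ : InH 1 f₀) (hg₀ : InH 1 g₀) (sf : Sym f₀) (sg : Sym g₀)
    (hb : N2 (W 1 f₀) ^ 2 + N2 (W 1 g₀) ^ 2 ≤ R) :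
    ∃ f g : ℝ → ℤ → ℂ, f 0 = f₀ ∧ g 0 = g₀ ∧
      SolOn a p q univ (Ioo (-lifespan a p q R) (lifespan a p q R)) f g ∧
      BddOn 1 √(2 * R) (Ioo (-lifespan a p q R) (lifespan a p q R)) f g ∧
      ∀ k, InH k f₀ → InH k g₀ → ∀ t ∈ Ioo (-lifespan a p q R) (lifespan a p q R),
        InH k (f t) ∧ InH k (g t) ∧ N2 (W k (f t)) ^ 2 + N2 (W k (g t)) ^ 2 ≤
          (N2 (W k f₀) ^ 2 + N2 (W k g₀) ^ 2) * Real.exp (rate a p q k (2 * R) * |t|) := by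
  choose F G hF0 hG0 hsol hbdd hk using fun N =>
    exists_galerkin a p q hR N hf₀ hg₀ sf sg hb
  set δ := lifespan a p q R with hδ
  have hδ0 : 0 < δ := lifespan_pos a p q R
  set ρ := √(2 * R) with hρ
  have hρ0 : 0 ≤ ρ := Real.sqrt_nonneg _
  set e := galerkinError a p q ρ δ with he
  have he0 : ∀ N, 0 ≤ e N := fun N => Real.sqrt_nonneg _
  have hcau : ∀ N M, N ≤ M → ∀ t ∈ Ioo (-δ) δ, N2 (fun n => F N t n - F M t n) ≤ e N ∧
      N2 (fun n => G N t n - G M t n) ≤ e N := fun N M hNM t ht =>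
    galerkin_cauchy hρ0 hNM (hsol N) (hsol M) (hbdd N) (hbdd M) (hF0 N) (hG0 N) (hF0 M) (hG0 M) ht
  have hlim : ∀ H : ℕ → ℝ → ℤ → ℂ, (∀ N M, N ≤ M → ∀ t ∈ Ioo (-δ) δ,
      Sq (fun n => H N t n - H M t n) ∧ N2 (fun n => H N t n - H M t n) ≤ e N) →
      ∃ h : ℝ → ℤ → ℂ, ∀ t ∈ Ioo (-δ) δ, (∀ n, Tendsto (fun N => H N t n) atTop (𝓝 (h t n))) ∧
        ∀ N, N2 (fun n => H N t n - h t n) ≤ e N := by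
    intro H hH
    have h1 : ∀ t ∈ Ioo (-δ) δ, ∀ n, ∃ z, Tendsto (fun N => H N t n) atTop (𝓝 z) := by
      intro t ht n
      refine cauchySeq_tendsto_of_complete (cauchySeq_of_le_tendsto_0' e (fun N M hNM => ?_)
        (tendsto_galerkinError a p q ρ δ))
      rw [dist_eq_norm]
      exact ((hH N M hNM t ht).1.norm_le n).trans (hH N M hNM t ht).2
    refine ⟨fun t n => if ht : t ∈ Ioo (-δ) δ then (h1 t ht n).choose else 0, fun t ht => ?_⟩
    have h2 : ∀ n, Tendsto (fun N => H N t n) atTop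
        (𝓝 (if ht : t ∈ Ioo (-δ) δ then (h1 t ht n).choose else 0)) := fun n => by
      rw [dif_pos ht]; exact (h1 t ht n).choose_spec
    refine ⟨h2, fun N => ?_⟩
    refine (sq_of_tendsto (l := atTop) (u := fun M n => H N t n - H M t n) (he0 N)
      (fun n => (h2 n).const_sub (H N t n)) ?_).2
    filter_upwards [eventually_ge_atTop N] with M hM
    exact hH N M hM t ht
  obtain ⟨f, hf⟩ := hlim F fun N M hNM t ht =>
    ⟨(((hbdd N t ht).1.1).sub ((hbdd M t ht).1.1)).1.sq.1, (hcau N M hNM t ht).1⟩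
  obtain ⟨g, hg⟩ := hlim G fun N M hNM t ht =>
    ⟨(((hbdd N t ht).2.1).sub ((hbdd M t ht).2.1)).1.sq.1, (hcau N M hNM t ht).2⟩
  have hW : ∀ (k : ℕ) {u : ℕ → ℤ → ℂ} {v : ℤ → ℂ},
      (∀ n, Tendsto (fun N => u N n) atTop (𝓝 (v n))) →
      ∀ n, Tendsto (fun N => W k (u N) n) atTop (𝓝 (W k v n)) := fun k u v h n =>
    (h n).const_mul _
  have hsymlim : ∀ {u : ℕ → ℤ → ℂ} {v : ℤ → ℂ},
      (∀ n, Tendsto (fun N => u N n) atTop (𝓝 (v n))) → (∀ N, Sym (u N)) → Sym v := by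
    intro u v h hs
    funext n
    refine tendsto_nhds_unique ((Complex.continuous_conj.tendsto _).comp (h (-n))) ?_
    refine (h n).congr fun N => ?_
    exact ((hs N).apply n).symm
  have hbf : BddOn 1 ρ (Ioo (-δ) δ) f g := by
    intro t ht
    have h1 := sq_of_tendsto (l := atTop) hρ0 (hW 1 (hf t ht).1)
      (Eventually.of_forall fun N => ⟨(hbdd N t ht).1.1, (hbdd N t ht).1.2.1⟩)
    have h2 := sq_of_tendsto (l := atTop) hρ0 (hW 1 (hg t ht).1)
      (Eventually.of_forall fun N => ⟨(hbdd N t ht).2.1, (hbdd N t ht).2.2.1⟩)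
    exact ⟨⟨h1.1, h1.2, hsymlim (hf t ht).1 fun N => (hbdd N t ht).1.2.2⟩,
      ⟨h2.1, h2.2, hsymlim (hg t ht).1 fun N => (hbdd N t ht).2.2.2⟩⟩
  have h0mem : (0 : ℝ) ∈ Ioo (-δ) δ := ⟨by linarith, hδ0⟩
  have hinit : ∀ (F₀ : ℤ → ℂ) n, Tendsto (fun N => trunc N F₀ n) atTop (𝓝 (F₀ n)) := by
    intro F₀ n
    refine tendsto_const_nhds.congr' ?_
    filter_upwards [eventually_ge_atTop n.natAbs] with N hN
    rw [trunc_of_mem (mem_freq_natAbs hN)]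
  refine ⟨f, g, ?_, ?_, ?_, hbf, ?_⟩
  · funext n
    refine tendsto_nhds_unique ((hf 0 h0mem).1 n) ?_
    simp only [hF0]; exact hinit f₀ n
  · funext n
    refine tendsto_nhds_unique ((hg 0 h0mem).1 n) ?_
    simp only [hG0]; exact hinit g₀ n
  · have hunif : ∀ (n : ℤ) (u v : ℕ → ℝ → ℤ → ℂ) (u' v' : ℝ → ℤ → ℂ),
        (∀ N, BddOn 1 ρ (Ioo (-δ) δ) (u N) (v N)) → BddOn 1 ρ (Ioo (-δ) δ) u' v' →
        (∀ t ∈ Ioo (-δ) δ, ∀ N, N2 (fun n => u N t n - u' t n) ≤ e N) →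
        (∀ t ∈ Ioo (-δ) δ, ∀ N, N2 (fun n => v N t n - v' t n) ≤ e N) →
        TendstoUniformlyOn (fun N t => nl a p q (u N t) (v N t) n)
          (fun t => nl a p q (u' t) (v' t) n) atTop (Ioo (-δ) δ) := by
      intro n u v u' v' hb1 hb2 hu hv
      rw [Metric.tendstoUniformlyOn_iff]
      intro ε hε
      set C := (Cn a p q + |a| * (4 * kap * |(n : ℝ)| + 1)) * ρ with hC
      have hC0 : 0 ≤ C := by
        have := Cn_nonneg a p q
        have := kap_nonneg
        positivity
      have hlimC : Tendsto (fun N => C * (e N + e N)) atTop (𝓝 0) := by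
        have h := tendsto_galerkinError a p q ρ δ
        simpa using (h.add h).const_mul C
      filter_upwards [hlimC.eventually (gt_mem_nhds hε)] with N hN t ht
      rw [dist_comm, dist_eq_norm]
      obtain ⟨⟨i1, b1, -⟩, i2, b2, -⟩ := hb1 N t ht
      obtain ⟨⟨i3, b3, -⟩, i4, b4, -⟩ := hb2 t ht
      refine ((norm_nl_sub_le i1 i2 i3 i4 b1 b2 b3 b4 n).trans ?_).trans_lt hN
      exact mul_le_mul_of_nonneg_left (add_le_add (hu t ht N) (hv t ht N)) hC0
    have hswap : ∀ {u v : ℝ → ℤ → ℂ}, BddOn 1 ρ (Ioo (-δ) δ) u v → BddOn 1 ρ (Ioo (-δ) δ) v u :=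
      fun h t ht => (h t ht).symm
    intro t ht n _
    constructor
    · refine hasDerivAt_of_tendstoUniformlyOn isOpen_Ioo
        (hunif n F G f g hbdd hbf (fun t ht => (hf t ht).2) (fun t ht => (hg t ht).2)) ?_
        (fun t ht => (hf t ht).1 n) ht
      filter_upwards [eventually_ge_atTop n.natAbs] with N hN t ht
      exact (hsol N t ht n (mem_freq_natAbs hN)).1
    · refine hasDerivAt_of_tendstoUniformlyOn isOpen_Ioo
        (hunif n G F g f (fun N => hswap (hbdd N)) (hswap hbf) (fun t ht => (hg t ht).2)
          (fun t ht => (hf t ht).2)) ?_ (fun t ht => (hg t ht).1 n) ht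
      filter_upwards [eventually_ge_atTop n.natAbs] with N hN t ht
      exact (hsol N t ht n (mem_freq_natAbs hN)).2
  · intro k hkf hkg t ht
    set E := (N2 (W k f₀) ^ 2 + N2 (W k g₀) ^ 2) * Real.exp (rate a p q k (2 * R) * |t|) with hE
    have hE0 : 0 ≤ E := by positivity
    have h1 := sq_of_tendsto (l := atTop) (Real.sqrt_nonneg E) (hW k (hf t ht).1)
      (Eventually.of_forall fun N => ⟨(hk N k hkf hkg t ht).1, Real.le_sqrt_of_sq_le (by
        have := (hk N k hkf hkg t ht).2.2; nlinarith [sq_nonneg (N2 (W k (G N t)))])⟩)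
    have h2 := sq_of_tendsto (l := atTop) (Real.sqrt_nonneg E) (hW k (hg t ht).1)
      (Eventually.of_forall fun N => ⟨(hk N k hkf hkg t ht).2.1, Real.le_sqrt_of_sq_le (by
        have := (hk N k hkf hkg t ht).2.2; nlinarith [sq_nonneg (N2 (W k (F N t)))])⟩)
    refine ⟨h1.1, h2.1, ?_⟩
    rw [N2_sq, N2_sq, ← Summable.tsum_add h1.1 h2.1]
    -- Bounds for the two norms separately would lose a factor. The sharp bound for their sum, which
    -- time continuity needs, is passed to the limit on finite partial sums of the combined series.
    refine (Summable.add h1.1 h2.1).tsum_le_of_sum_le fun s => ?_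
    refine le_of_tendsto (tendsto_finsetSum s fun n _ =>
      ((hW k (hf t ht).1 n).norm.pow 2).add ((hW k (hg t ht).1 n).norm.pow 2)) ?_
    refine Eventually.of_forall fun N => ?_
    obtain ⟨j1, j2, j3⟩ := hk N k hkf hkg t ht
    rw [Finset.sum_add_distrib]
    exact (add_le_add (j1.sum_le s) (j2.sum_le s)).trans j3

end LocalExistence

/-! ### Regularity in time -/

section Regularity

variable {a p q ρ : ℝ} {f g : ℝ → ℤ → ℂ} {α β : ℝ}

/-- Local solutions through a point of a given solution coincide with it. -/
theorem energy_growth {R : ℝ} (hR : 0 < R) (hsol : SolOn a p q univ (Ioo α β) f g)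
    (hb : BddOn 1 ρ (Ioo α β) f g) {s t : ℝ} (hs : s ∈ Ioo α β) (ht : t ∈ Ioo α β)
    (hsR : N2 (W 1 (f s)) ^ 2 + N2 (W 1 (g s)) ^ 2 ≤ R) (hst : |t - s| < lifespan a p q R) {k : ℕ}
    (hkf : InH k (f s)) (hkg : InH k (g s)) :
    InH k (f t) ∧ InH k (g t) ∧ N2 (W k (f t)) ^ 2 + N2 (W k (g t)) ^ 2 ≤
      (N2 (W k (f s)) ^ 2 + N2 (W k (g s)) ^ 2) * Real.exp (rate a p q k (2 * R) * |t - s|) := by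
  obtain ⟨⟨i1, -, s1⟩, i2, -, s2⟩ := hb s hs
  obtain ⟨v, w, hv0, hw0, hvs, hvb, hvk⟩ := local_existence a p q hR i1 i2 s1 s2 hsR
  set δ := lifespan a p q R with hδ
  have hmem : ∀ {τ}, τ ∈ Ioo (max α (s - δ)) (min β (s + δ)) →
      τ ∈ Ioo α β ∧ τ - s ∈ Ioo (-δ) δ := by
    intro τ hτ
    have h1 := max_lt_iff.1 hτ.1
    have h2 := lt_min_iff.1 hτ.2
    exact ⟨⟨h1.1, h2.1⟩, ⟨by linarith [h1.2], by linarith [h2.2]⟩⟩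
  have hδ0 : 0 < δ := lifespan_pos a p q R
  obtain ⟨t1, t2⟩ := abs_lt.1 hst
  have hs' : s ∈ Ioo (max α (s - δ)) (min β (s + δ)) :=
    ⟨max_lt hs.1 (by linarith), lt_min hs.2 (by linarith)⟩
  have ht' : t ∈ Ioo (max α (s - δ)) (min β (s + δ)) :=
    ⟨max_lt ht.1 (by linarith), lt_min ht.2 (by linarith)⟩
  have hu := uniqueness (f' := fun τ => v (τ - s)) (g' := fun τ => w (τ - s))
    (ρ := max ρ √(2 * R))
    (hsol.mono le_rfl fun τ hτ => (hmem hτ).1) (fun τ hτ n hn => ?_) (fun τ hτ => ?_)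
    (fun τ hτ => ?_) hs' (by simp [hv0]) (by simp [hw0]) ht'
  · rw [hu.1, hu.2]
    exact hvk k hkf hkg (t - s) (hmem ht').2
  · have := hvs (τ - s) (hmem hτ).2 n hn
    exact ⟨this.1.comp_sub_const τ s, this.2.comp_sub_const τ s⟩
  · obtain ⟨⟨i1, b1, s1⟩, i2, b2, s2⟩ := hb τ (hmem hτ).1
    exact ⟨⟨i1, b1.trans (le_max_left _ _), s1⟩, i2, b2.trans (le_max_left _ _), s2⟩
  · obtain ⟨⟨i1, b1, s1⟩, i2, b2, s2⟩ := hvb (τ - s) (hmem hτ).2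
    exact ⟨⟨i1, b1.trans (le_max_right _ _), s1⟩, i2, b2.trans (le_max_right _ _), s2⟩

theorem eventually_N2_sq_gt {ι : Type*} {l : Filter ι} {u : ι → ℤ → ℂ} {v : ℤ → ℂ}
    (hv : Sq v) (hu : ∀ᶠ i in l, Sq (u i)) (h : ∀ n, Tendsto (fun i => u i n) l (𝓝 (v n)))
    {ε : ℝ} (hε : 0 < ε) : ∀ᶠ i in l, N2 v ^ 2 - ε < N2 (u i) ^ 2 := by
  have hsum : Tendsto (fun s : Finset ℤ => ∑ n ∈ s, ‖v n‖ ^ 2) atTop (𝓝 (N2 v ^ 2)) := by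
    rw [N2_sq]; exact hv.hasSum
  obtain ⟨s, hs⟩ := (hsum.eventually (lt_mem_nhds (sub_lt_self _ hε))).exists
  have h2 : Tendsto (fun i => ∑ n ∈ s, ‖u i n‖ ^ 2) l (𝓝 (∑ n ∈ s, ‖v n‖ ^ 2)) :=
    tendsto_finsetSum s fun n _ => ((h n).norm.pow 2)
  filter_upwards [hu, h2.eventually (lt_mem_nhds hs)] with i hi1 hi2
  exact hi2.trans_le (hi1.sum_le s)

/-- Each squared norm is lower semicontinuous, so neither can jump up when the sum converges. The
energy estimate controls only the sum of both components, hence this splitting. -/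
theorem tendsto_N2_sq_of_add {ι : Type*} {l : Filter ι} {u u' : ι → ℤ → ℂ} {v v' : ℤ → ℂ}
    (hv : Sq v) (hv' : Sq v') (hu : ∀ᶠ i in l, Sq (u i)) (hu' : ∀ᶠ i in l, Sq (u' i))
    (h : ∀ n, Tendsto (fun i => u i n) l (𝓝 (v n)))
    (h' : ∀ n, Tendsto (fun i => u' i n) l (𝓝 (v' n)))
    (hs : Tendsto (fun i => N2 (u i) ^ 2 + N2 (u' i) ^ 2) l (𝓝 (N2 v ^ 2 + N2 v' ^ 2))) :
    Tendsto (fun i => N2 (u i) ^ 2) l (𝓝 (N2 v ^ 2)) := by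
  rw [Metric.tendsto_nhds]
  intro ε hε
  filter_upwards [eventually_N2_sq_gt hv hu h (half_pos hε),
    eventually_N2_sq_gt hv' hu' h' (half_pos hε),
    hs.eventually (gt_mem_nhds (lt_add_of_pos_right _ (half_pos hε)))] with i h1 h2 h3
  rw [Real.dist_eq, abs_lt]
  constructor <;> linarith

/-- Strong continuity in `H^k`. -/
theorem tendsto_N2_W_sub (hsol : SolOn a p q univ (Ioo α β) f g)
    (hb : BddOn 1 ρ (Ioo α β) f g) {k : ℕ}
    (hk : ∀ t ∈ Ioo α β, InH k (f t) ∧ InH k (g t)) {t : ℝ} (ht : t ∈ Ioo α β) :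
    Tendsto (fun s => N2 (W k fun n => f s n - f t n)) (𝓝 t) (𝓝 0) ∧
      Tendsto (fun s => N2 (W k fun n => g s n - g t n)) (𝓝 t) (𝓝 0) := by
  set R := 2 * ρ ^ 2 + 1 with hR
  have hR0 : 0 < R := by positivity
  have hbR : ∀ s ∈ Ioo α β, N2 (W 1 (f s)) ^ 2 + N2 (W 1 (g s)) ^ 2 ≤ R := fun s hs => by
    obtain ⟨⟨-, b1, -⟩, -, b2, -⟩ := hb s hs
    have := pow_le_pow_left₀ (N2_nonneg _) b1 2
    have := pow_le_pow_left₀ (N2_nonneg _) b2 2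
    linarith
  set δ := lifespan a p q R with hδ
  have hδ0 : 0 < δ := lifespan_pos a p q R
  set Γ := rate a p q k (2 * R)
  set E : ℝ → ℝ := fun s => N2 (W k (f s)) ^ 2 + N2 (W k (g s)) ^ 2 with hE
  have hnear : ∀ᶠ s in 𝓝 t, s ∈ Ioo α β ∧ |s - t| < δ := by
    filter_upwards [isOpen_Ioo.mem_nhds ht, Metric.ball_mem_nhds t hδ0] with s hs hs'
    exact ⟨hs, by simpa [Real.dist_eq] using hs'⟩
  have hexp : ∀ c : ℝ, Tendsto (fun s => E t * Real.exp (c * |s - t|)) (𝓝 t) (𝓝 (E t)) := by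
    intro c
    have : Continuous fun s => E t * Real.exp (c * |s - t|) := by fun_prop
    simpa using this.tendsto t
  -- The growth bound is applied from `s` to `t` for the lower estimate and from `t` to `s` for the
  -- upper one. The bound `R` is uniform in `s`, so all local solutions used share one life span.
  -- Coefficientwise convergence then upgrades to convergence in norm.
  have hEt : Tendsto E (𝓝 t) (𝓝 (E t)) := by
    refine tendsto_of_tendsto_of_tendsto_of_le_of_le' (hexp (-Γ)) (hexp Γ) ?_ ?_
    · filter_upwards [hnear] with s hs
      have := (energy_growth hR0 hsol hb hs.1 ht (hbR s hs.1) (by rw [abs_sub_comm]; exact hs.2)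
        (hk s hs.1).1 (hk s hs.1).2).2.2
      rw [abs_sub_comm] at this
      calc E t * Real.exp (-Γ * |s - t|) ≤
          E s * Real.exp (Γ * |s - t|) * Real.exp (-Γ * |s - t|) :=
            mul_le_mul_of_nonneg_right this (Real.exp_pos _).le
        _ = E s := by rw [mul_assoc, ← Real.exp_add]; simp
    · filter_upwards [hnear] with s hs
      exact (energy_growth hR0 hsol hb ht hs.1 (hbR t ht) hs.2 (hk t ht).1 (hk t ht).2).2.2
  have hcf : ∀ n, Tendsto (fun s => W k (f s) n) (𝓝 t) (𝓝 (W k (f t) n)) := fun n =>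
    ((hsol t ht n (mem_univ n)).1.continuousAt.tendsto).const_mul _
  have hcg : ∀ n, Tendsto (fun s => W k (g s) n) (𝓝 t) (𝓝 (W k (g t) n)) := fun n =>
    ((hsol t ht n (mem_univ n)).2.continuousAt.tendsto).const_mul _
  have hSf : ∀ᶠ s in 𝓝 t, Sq (W k (f s)) := hnear.mono fun s hs => (hk s hs.1).1
  have hSg : ∀ᶠ s in 𝓝 t, Sq (W k (g s)) := hnear.mono fun s hs => (hk s hs.1).2
  have h1 := tendsto_N2_sq_of_add (hk t ht).1 (hk t ht).2 hSf hSg hcf hcg hEt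
  have h2 := tendsto_N2_sq_of_add (hk t ht).2 (hk t ht).1 hSg hSf hcg hcf
    (by simpa only [hE, add_comm] using hEt)
  have fin : ∀ {u : ℝ → ℤ → ℂ}, Tendsto (fun s => N2 (fun n => W k (u s) n - W k (u t) n) ^ 2)
      (𝓝 t) (𝓝 0) → Tendsto (fun s => N2 (W k fun n => u s n - u t n)) (𝓝 t) (𝓝 0) := by
    intro u hu
    have := hu.sqrt
    simp only [Real.sqrt_sq (N2_nonneg _), Real.sqrt_zero] at this
    refine this.congr fun s => ?_
    congr 1; funext n; simp only [W]; ring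
  exact ⟨fin (tendsto_N2_sub (hk t ht).1 hSf hcf h1), fin (tendsto_N2_sub (hk t ht).2 hSg hcg h2)⟩

/-- Mean value inequality in `ℓ²` for coefficientwise differentiable families. -/
theorem N2_sub_le_of_hasDerivAt {x x' : ℝ → ℤ → ℂ} {L : ℝ} {J : Set ℝ} (hJ : Convex ℝ J)
    (hL : 0 ≤ L) (hx : ∀ t ∈ J, ∀ n, HasDerivAt (fun s => x s n) (x' t n) t)
    (hb : ∀ t ∈ J, Sq (x' t) ∧ N2 (x' t) ≤ L) {s t : ℝ} (hs : s ∈ J) (ht : t ∈ J) :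
    Sq (fun n => x t n - x s n) ∧ N2 (fun n => x t n - x s n) ≤ L * |t - s| := by
  refine sq_of_sum_le (by positivity) fun S => ?_
  -- Restriction to a finite set of frequencies makes the curve finite-dimensional, and the bound
  -- `L` does not depend on that set.
  set y : ℝ → EuclideanSpace ℂ S := fun t => WithLp.toLp 2 fun n : S => x t n with hy
  set y' : ℝ → EuclideanSpace ℂ S := fun t => WithLp.toLp 2 fun n : S => x' t n with hy'
  have hd : ∀ t ∈ J, HasDerivWithinAt y (y' t) J t := fun t ht => by
    have h : HasDerivWithinAt (fun t => fun n : S => x t n) (fun n : S => x' t n) J t :=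
      hasDerivWithinAt_pi.2 fun n => (hx t ht n).hasDerivWithinAt
    exact (PiLp.continuousLinearEquiv 2 ℝ
      (fun _ : S => ℂ)).symm.toContinuousLinearMap.hasFDerivAt.comp_hasDerivWithinAt t h
  have hbd : ∀ t ∈ J, ‖y' t‖ ≤ L := fun t ht => by
    refine le_trans ?_ (hb t ht).2
    rw [← sq_le_sq₀ (norm_nonneg _) (N2_nonneg _), EuclideanSpace.norm_sq_eq]
    refine le_trans (le_of_eq ?_) ((hb t ht).1.sum_le S)
    exact Finset.sum_coe_sort S fun n => ‖x' t n‖ ^ 2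
  have := hJ.norm_image_sub_le_of_norm_hasDerivWithin_le hd hbd hs ht
  have h2 := pow_le_pow_left₀ (norm_nonneg _) this 2
  rw [EuclideanSpace.norm_sq_eq, Real.norm_eq_abs] at h2
  refine le_trans (le_of_eq ?_) h2
  exact (Finset.sum_coe_sort S fun n => ‖x t n - x s n‖ ^ 2).symm

/-- Bilinearity combined with `nl_sq`. The loss of a derivative is harmless, since the solution is
continuous in time with values in `H¹`. -/
theorem nl_sub_bound {f g f' g' : ℤ → ℂ} (hf : InH 1 f) (hg : InH 1 g) (hf' : InH 1 f')
    (hg' : InH 1 g') :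
    Sq (fun n => nl a p q f g n - nl a p q f' g' n) ∧
      N2 (fun n => nl a p q f g n - nl a p q f' g' n) ≤
        Cn a p q * N2 (W 1 fun n => f n - f' n) * N2 (W 1 g) +
          Cn a p q * N2 (W 1 f') * N2 (W 1 fun n => g n - g' n) := by
  have h1 := nl_sq a p q (hf.sub hf').1 hg
  have h2 := nl_sq a p q hf' (hg.sub hg').1
  have h3 := h1.1.add h2.1
  have e : (fun n => nl a p q f g n - nl a p q f' g' n) = fun n =>
      nl a p q (fun n => f n - f' n) g n + nl a p q f' (fun n => g n - g' n) n := by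
    funext n
    have hDf : Sq (Ds f) := by simpa only [InH, W_zero] using (InH.Ds (k := 0) hf).1
    have hDf' : Sq (Ds f') := by simpa only [InH, W_zero] using (InH.Ds (k := 0) hf').1
    simp only [nl]
    rw [Hs_sub, Hs_sub, Ds_sub, us_sub hg.sq.1 hg'.sq.1,
      conv_sub_right hg.Hs.1.sq.1 hf.sq.1 hf'.sq.1,
      conv_sub_left hf.Hs.1.sq.1 hf'.Hs.1.sq.1 hg.sq.1,
      conv_sub_right (us_S1 hg.sq.1).1.sq hDf hDf',
      conv_sub_left hg.Hs.1.sq.1 hg'.Hs.1.sq.1 hf'.sq.1,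
      conv_sub_right hf'.Hs.1.sq.1 hg.sq.1 hg'.sq.1,
      conv_sub_left (us_S1 hg.sq.1).1.sq (us_S1 hg'.sq.1).1.sq hDf']
    ring
  rw [e]
  exact ⟨h3.1, h3.2.trans (add_le_add h1.2 h2.2)⟩

/-- A solution that is bounded in `H^1` is differentiable in `ℓ²`. -/
theorem eventually_N2_sub_sub_le (hsol : SolOn a p q univ (Ioo α β) f g)
    (hb : BddOn 1 ρ (Ioo α β) f g) {t : ℝ} (ht : t ∈ Ioo α β) {ε : ℝ} (hε : 0 < ε) :
    ∀ᶠ s in 𝓝 t,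
      N2 (fun n => f s n - f t n - (s - t : ℝ) * nl a p q (f t) (g t) n) ≤ ε * |s - t| := by
  obtain ⟨c1, c2⟩ := tendsto_N2_W_sub hsol hb (k := 1)
    (fun t ht => ⟨(hb t ht).1.1, (hb t ht).2.1⟩) ht
  have hlim : Tendsto (fun s => Cn a p q * N2 (W 1 fun n => f s n - f t n) * ρ +
      Cn a p q * ρ * N2 (W 1 fun n => g s n - g t n)) (𝓝 t) (𝓝 0) := by
    simpa using ((c1.const_mul (Cn a p q)).mul_const ρ).add (c2.const_mul (Cn a p q * ρ))
  have hev : ∀ᶠ s in 𝓝 t, s ∈ Ioo α β ∧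
      N2 (fun n => nl a p q (f s) (g s) n - nl a p q (f t) (g t) n) ≤ ε := by
    filter_upwards [isOpen_Ioo.mem_nhds ht, hlim.eventually (gt_mem_nhds hε)] with s hs h
    refine ⟨hs, ?_⟩
    obtain ⟨⟨i1, b1, -⟩, i2, b2, -⟩ := hb s hs
    obtain ⟨⟨i3, b3, -⟩, i4, b4, -⟩ := hb t ht
    refine ((nl_sub_bound i1 i2 i3 i4).2.trans (add_le_add ?_ ?_)).trans h.le
    · exact mul_le_mul_of_nonneg_left b2 (mul_nonneg (Cn_nonneg _ _ _) (N2_nonneg _))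
    · exact mul_le_mul_of_nonneg_right (mul_le_mul_of_nonneg_left b3 (Cn_nonneg _ _ _))
        (N2_nonneg _)
  obtain ⟨η, hη, hball⟩ := Metric.eventually_nhds_iff_ball.1 hev
  filter_upwards [Metric.ball_mem_nhds t hη] with s hs
  -- The mean value inequality is applied to the curve minus its tangent at `t`, whose derivative is
  -- the oscillation of the nonlinearity and is at most `ε` on the ball.
  have key := N2_sub_le_of_hasDerivAt (convex_ball t η) hε.le
    (x := fun τ n => f τ n - (τ - t : ℝ) * nl a p q (f t) (g t) n)
    (x' := fun τ n => nl a p q (f τ) (g τ) n - nl a p q (f t) (g t) n)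
    (fun τ hτ n => ?_) (fun τ hτ => ⟨?_, (hball τ hτ).2⟩) (Metric.mem_ball_self hη) hs
  · refine le_trans (le_of_eq ?_) key.2
    congr 1; funext n; simp; ring
  · have h1 := (hsol τ (hball τ hτ).1 n (mem_univ n)).1
    have h2 : HasDerivAt (fun τ : ℝ => ((τ - t : ℝ) : ℂ) * nl a p q (f t) (g t) n)
        (nl a p q (f t) (g t) n) τ := by
      have := (((hasDerivAt_id τ).sub_const t).ofReal_comp).mul_const (nl a p q (f t) (g t) n)
      simpa using this
    exact h1.sub h2
  · obtain ⟨⟨i1, b1, -⟩, i2, b2, -⟩ := hb τ (hball τ hτ).1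
    obtain ⟨⟨i3, b3, -⟩, i4, b4, -⟩ := hb t ht
    exact (nl_sub_bound i1 i2 i3 i4).1

end Regularity

/-! ### Fourier coefficients of functions on the torus -/

section Fourier

open AddCircle

theorem ae_haar {P : Torus → Prop} : (∀ᵐ x ∂haarAddCircle, P x) ↔ ∀ᵐ x ∂(volume : Measure Torus), P x := by
  rw [volume_eq_smul_haarAddCircle, Measure.ae_ennreal_smul_measure_iff (by simp [Real.pi_pos])]

theorem fourierCoeff_sq {φ : Torus → ℂ} (h : MemLp φ 2 (volume : Measure Torus)) :
    Sq (fourierCoeff φ) ∧ 2 * π * N2 (fourierCoeff φ) ^ 2 = ∫ x, ‖φ x‖ ^ 2 := by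
  have h' := h.haarAddCircle
  have h1 := hasSum_sq_fourierCoeff h'.toLp
  rw [fourierCoeff_congr_ae h'.coeFn_toLp] at h1
  refine ⟨h1.summable, ?_⟩
  rw [N2_sq, h1.tsum_eq, integral_congr_ae (g := fun x => ‖φ x‖ ^ 2)
    (h'.coeFn_toLp.mono fun x hx => by simp only [hx]), integral_haarAddCircle, smul_eq_mul]
  field_simp

theorem ae_eq_of_fourierCoeff_eq {φ ψ : Torus → ℂ} (hφ : MemLp φ 2 (volume : Measure Torus))
    (hψ : MemLp ψ 2 (volume : Measure Torus)) (h : fourierCoeff φ = fourierCoeff ψ) :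
    φ =ᵐ[volume] ψ := by
  have h1 := hφ.haarAddCircle
  have h2 := hψ.haarAddCircle
  have : h1.toLp = h2.toLp := by
    apply (@fourierBasis (2 * π) _).repr.injective
    ext n
    rw [fourierBasis_repr, fourierBasis_repr, fourierCoeff_congr_ae h1.coeFn_toLp,
      fourierCoeff_congr_ae h2.coeFn_toLp, h]
  have h3 : φ =ᵐ[haarAddCircle] ψ := h1.coeFn_toLp.symm.trans (this ▸ h2.coeFn_toLp)
  exact ae_haar.1 h3

theorem exists_fourierCoeff_eq {a : ℤ → ℂ} (ha : Sq a) :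
    ∃ φ : Torus → ℂ, MemLp φ 2 (volume : Measure Torus) ∧ fourierCoeff φ = a := by
  have hm : Memℓp a 2 := memℓp_gen (by simpa [Sq] using ha)
  set F := (@fourierBasis (2 * π) _).repr.symm ⟨a, hm⟩ with hF
  refine ⟨F, (Lp.memLp F).of_haarAddCircle, ?_⟩
  funext n
  rw [← fourierBasis_repr, hF, LinearIsometryEquiv.apply_symm_apply]

/-- The Fourier coefficients of a real square integrable function. -/
def cf (f : L2) (n : ℤ) : ℂ := fourierCoeff (fun x : Torus => (f x : ℂ)) n

theorem memLp_ofReal (f : L2) : MemLp (fun x : Torus => (f x : ℂ)) 2 (volume : Measure Torus) :=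
  (Lp.memLp f).ofReal

theorem integrable_ofReal (f : L2) :
    Integrable (fun x : Torus => (f x : ℂ)) (haarAddCircle : Measure Torus) :=
  (memLp_ofReal f).haarAddCircle.integrable (by norm_num)

theorem cf_sq (f : L2) : Sq (cf f) := (fourierCoeff_sq (memLp_ofReal f)).1

/-- Parseval. Fourier coefficients refer to the probability measure, while `L2` carries total mass
`2π`; hence the factor. -/
theorem norm_sq_eq (f : L2) : ‖f‖ ^ 2 = 2 * π * N2 (cf f) ^ 2 := by
  rw [show cf f = fourierCoeff (fun x : Torus => (f x : ℂ)) from rfl,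
    (fourierCoeff_sq (memLp_ofReal f)).2, ← real_inner_self_eq_norm_sq, L2.inner_def]
  refine integral_congr_ae (Eventually.of_forall fun x => ?_)
  simp [pow_two]

theorem cf_congr {f : L2} {φ : Torus → ℝ} (h : f =ᵐ[volume] φ) :
    cf f = fourierCoeff fun x => (φ x : ℂ) :=
  fourierCoeff_congr_ae (ae_haar.2 (h.mono fun x hx => by simp only [hx]))

theorem cf_add (f g : L2) : cf (f + g) = fun n => cf f n + cf g n := by
  rw [cf_congr (Lp.coeFn_add f g)]
  have := fourierCoeff.add (integrable_ofReal f) (integrable_ofReal g)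
  rw [show (fun x => (((⇑f + ⇑g) x : ℝ) : ℂ)) = (fun x : Torus => (f x : ℂ)) + fun x => (g x : ℂ) by
    funext x; simp, this]
  rfl

theorem cf_smul (r : ℝ) (f : L2) : cf (r • f) = fun n => (r : ℂ) * cf f n := by
  rw [cf_congr (Lp.coeFn_smul r f)]
  funext n
  have := fourierCoeff.const_mul (fun x : Torus => (f x : ℂ)) r n
  rw [cf, ← this]
  congr 1
  funext x; simp

theorem cf_sub (f g : L2) : cf (f - g) = fun n => cf f n - cf g n := by
  rw [sub_eq_add_neg, ← neg_one_smul ℝ g, cf_add, cf_smul]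
  funext n; push_cast; ring

theorem fourierCoeff_conj (φ : Torus → ℂ) (n : ℤ) :
    fourierCoeff (fun x => (starRingEnd ℂ) (φ x)) n = (starRingEnd ℂ) (fourierCoeff φ (-n)) := by
  rw [fourierCoeff, fourierCoeff, ← integral_conj]
  congr 1
  funext x
  simp only [smul_eq_mul, map_mul, neg_neg, fourier_neg]

theorem cf_sym (f : L2) : Sym (cf f) := by
  funext n
  rw [refl, cf, ← fourierCoeff_conj]
  simp [cf]

theorem exists_cf_eq {a : ℤ → ℂ} (ha : Sq a) (hs : Sym a) : ∃ f : L2, cf f = a := by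
  obtain ⟨φ, hφ, hc⟩ := exists_fourierCoeff_eq ha
  have hconj : φ =ᵐ[volume] fun x => (starRingEnd ℂ) (φ x) := by
    refine ae_eq_of_fourierCoeff_eq hφ ?_ ?_
    · exact hφ.star
    · funext n; rw [fourierCoeff_conj, hc, hs.apply]
  refine ⟨hφ.re.toLp, ?_⟩
  rw [cf_congr hφ.re.coeFn_toLp, ← hc]
  funext n
  refine congrFun (fourierCoeff_congr_ae (ae_haar.2 ?_)) n
  filter_upwards [hconj] with x hx
  exact Complex.conj_eq_iff_re.1 hx.symm

/-- The `n`-th Fourier coefficient as a continuous linear map. -/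
def cfL (n : ℤ) : L2 →L[ℝ] ℂ :=
  LinearMap.mkContinuous
    { toFun := fun f => cf f n
      map_add' := fun f g => congrFun (cf_add f g) n
      map_smul' := fun r f => by simpa using congrFun (cf_smul r f) n } 1 fun f => by
    rw [one_mul]
    refine le_trans ((cf_sq f).norm_le n) ?_
    rw [← sq_le_sq₀ (N2_nonneg _) (norm_nonneg _), norm_sq_eq]
    exact le_mul_of_one_le_left (sq_nonneg _) (by linarith [Real.pi_gt_three])

theorem cfL_apply (n : ℤ) (f : L2) : cfL n f = cf f n := rfl

theorem N2_add_sq {a b : ℤ → ℂ} (ha : Sq a) (hb : Sq b) :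
    N2 (fun n => a n + b n) ^ 2 = N2 a ^ 2 + 2 * ip a b + N2 b ^ 2 := by
  have hA : HasSum (fun n => ‖a n‖ ^ 2) (N2 a ^ 2) := by rw [N2_sq]; exact ha.hasSum
  have hB : HasSum (fun n => ‖b n‖ ^ 2) (N2 b ^ 2) := by rw [N2_sq]; exact hb.hasSum
  have hI : HasSum (fun n => ((starRingEnd ℂ) (a n) * b n).re) (ip a b) :=
    (ip_summable ha hb).hasSum
  rw [N2_sq, ← ((hA.add (hI.mul_left 2)).add hB).tsum_eq]
  refine tsum_congr fun n => ?_
  rw [Complex.sq_norm, Complex.sq_norm, Complex.sq_norm, Complex.normSq_add,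
    ← Complex.conj_re (a n * (starRingEnd ℂ) (b n))]
  simp only [map_mul, Complex.conj_conj]
  ring

theorem inner_eq_ip (f g : L2) : inner ℝ f g = 2 * π * ip (cf f) (cf g) := by
  have h1 := norm_add_sq_real f g
  rw [norm_sq_eq, norm_sq_eq, norm_sq_eq, cf_add, N2_add_sq (cf_sq f) (cf_sq g)] at h1
  linarith

/-! ### Weak derivatives -/

theorem intervalIntegral_eq (φ : Torus → ℝ) : ∫ x in (-π)..π, φ (x : Torus) = ∫ x, φ x := by
  have := AddCircle.intervalIntegral_preimage (2 * π) (-π) φ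
  rwa [show -π + 2 * π = π by ring] at this

theorem exp_eq_fourier (n : ℤ) (x : ℝ) :
    @fourier (2 * π) n x = Complex.exp (Complex.I * n * x) := by
  rw [fourier_coe_apply]
  congr 1
  have : (π : ℂ) ≠ 0 := by exact_mod_cast Real.pi_ne_zero
  push_cast
  field_simp

theorem fourierCoeff_eq (φ : Torus → ℂ) (n : ℤ) :
    fourierCoeff φ n = (1 / (2 * π) : ℝ) • ∫ x in (-π)..π,
      Complex.exp (-(Complex.I * n * x)) * φ (x : Torus) := by
  rw [fourierCoeff_eq_intervalIntegral φ n (-π), show -π + 2 * π = π by ring]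
  congr 1
  refine intervalIntegral.integral_congr fun x _ => ?_
  simp only [smul_eq_mul, exp_eq_fourier]
  push_cast
  ring_nf

theorem intervalIntegrable_cf (f : L2) :
    IntervalIntegrable (fun x : ℝ => f (x : Torus)) volume (-π) π := by
  have h1 : Integrable (f : Torus → ℝ) := (Lp.memLp f).integrable (by norm_num)
  rw [intervalIntegrable_iff, uIoc_of_le (by linarith [Real.pi_pos])]
  have := (AddCircle.measurePreserving_mk (2 * π) (-π)).integrable_comp_of_integrable h1
  rwa [show -π + 2 * π = π by ring] at this

theorem intervalIntegrable_ofReal_mul (f : L2) {φ : ℝ → ℝ} (hφ : Continuous φ) :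
    IntervalIntegrable (fun x : ℝ => ((f (x : Torus) * φ x : ℝ) : ℂ)) volume (-π) π := by
  have := (intervalIntegrable_cf f).mul_continuousOn hφ.continuousOn
  exact ⟨this.1.ofReal, this.2.ofReal⟩

theorem cf_eq_cos_sin (f : L2) (n : ℤ) :
    cf f n = (1 / (2 * π) : ℝ) * ((∫ x in (-π)..π, f (x : Torus) * Real.cos (n * x) : ℝ) -
      Complex.I * (∫ x in (-π)..π, f (x : Torus) * Real.sin (n * x) : ℝ)) := by
  have hc : IntervalIntegrable (fun x : ℝ => ((f (x : Torus) * Real.cos (n * x) : ℝ) : ℂ))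
      volume (-π) π :=
    intervalIntegrable_ofReal_mul f (by fun_prop)
  have hs : IntervalIntegrable (fun x : ℝ => ((f (x : Torus) * Real.sin (n * x) : ℝ) : ℂ))
      volume (-π) π :=
    intervalIntegrable_ofReal_mul f (by fun_prop)
  rw [cf, fourierCoeff_eq, ← intervalIntegral.integral_ofReal, ← intervalIntegral.integral_ofReal,
    ← intervalIntegral.integral_const_mul, ← intervalIntegral.integral_sub hc (hs.const_mul _),
    Complex.real_smul]
  congr 1
  refine intervalIntegral.integral_congr fun x _ => ?_
  rw [show -(Complex.I * n * x) = ((-(n * x) : ℝ) : ℂ) * Complex.I by push_cast; ring,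
    Complex.exp_mul_I, ← Complex.ofReal_cos, ← Complex.ofReal_sin, Real.cos_neg, Real.sin_neg]
  push_cast
  ring

/-- Test functions are real, so the exponential is tested through its cosine and sine parts. -/
theorem IsWeakDeriv.cf_eq {f g : L2} (h : IsWeakDeriv f g) : cf g = Ds (cf f) := by
  funext n
  have hc := h (fun x => Real.cos (n * x)) (by fun_prop) fun x => by
    simp only
    rw [mul_add, show (n : ℝ) * (2 * π) = n * (2 * π) from rfl, Real.cos_add_int_mul_two_pi]
  have hs := h (fun x => Real.sin (n * x)) (by fun_prop) fun x => by
    simp only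
    rw [mul_add, show (n : ℝ) * (2 * π) = n * (2 * π) from rfl, Real.sin_add_int_mul_two_pi]
  have dc : deriv (fun x : ℝ => Real.cos (n * x)) = fun x => -n * Real.sin (n * x) := by
    funext x
    have := ((hasDerivAt_id x).const_mul (n : ℝ)).cos
    simp only [id, mul_one] at this
    rw [this.deriv]; ring
  have ds : deriv (fun x : ℝ => Real.sin (n * x)) = fun x => n * Real.cos (n * x) := by
    funext x
    have := ((hasDerivAt_id x).const_mul (n : ℝ)).sin
    simp only [id, mul_one] at this
    rw [this.deriv]; ring
  rw [dc] at hc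
  rw [ds] at hs
  simp only [mul_left_comm _ (-(n : ℝ)), mul_left_comm _ (n : ℝ),
    intervalIntegral.integral_const_mul] at hc hs
  rw [Ds, cf_eq_cos_sin, cf_eq_cos_sin]
  set A := ∫ x in (-π)..π, f (x : Torus) * Real.cos (n * x)
  set B := ∫ x in (-π)..π, f (x : Torus) * Real.sin (n * x)
  rw [show ∫ x in (-π)..π, g (x : Torus) * Real.cos (n * x) = n * B by linarith,
    show ∫ x in (-π)..π, g (x : Torus) * Real.sin (n * x) = -(n * A) by linarith]
  push_cast
  linear_combination ((1 / (2 * π) : ℂ) * n * B) * Complex.I_mul_I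

/-- Presents integration against a test function as a Parseval pairing, so that the weak derivative
identity becomes skew symmetry of `Ds` in `isWeakDeriv_of_cf_eq`. -/
theorem exists_periodic_lift {φ : ℝ → ℝ} (hc : Continuous φ) (hp : Function.Periodic φ (2 * π)) :
    ∃ Φ : L2, (∀ f : L2, ∫ x in (-π)..π, f (x : Torus) * φ x = 2 * π * ip (cf f) (cf Φ)) ∧
      ∀ n : ℤ, cf Φ n = (1 / (2 * π) : ℝ) • ∫ x in (-π)..π,
        Complex.exp (-(Complex.I * n * x)) * φ x := by
  set ψ : Torus → ℝ := hp.lift with hψ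
  have hlift : ∀ x : ℝ, ψ (x : Torus) = φ x := hp.lift_coe
  have hcl : Continuous ψ := hc.quotient_liftOn' _
  have hm : MemLp ψ 2 (volume : Measure Torus) :=
    hcl.memLp_of_hasCompactSupport (HasCompactSupport.of_compactSpace _)
  refine ⟨hm.toLp, fun f => ?_, fun n => ?_⟩
  · rw [← inner_eq_ip, L2.inner_def]
    have := intervalIntegral_eq fun x => f x * ψ x
    simp only [hlift] at this
    rw [this]
    refine integral_congr_ae ?_
    filter_upwards [hm.coeFn_toLp] with x hx
    simp [hx, mul_comm]
  · rw [cf_congr hm.coeFn_toLp, fourierCoeff_eq]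
    simp only [hlift]

theorem integral_exp_mul_deriv {φ : ℝ → ℝ} (hd : ContDiff ℝ ∞ φ)
    (hp : Function.Periodic φ (2 * π)) (n : ℤ) :
    ∫ x in (-π)..π, Complex.exp (-(Complex.I * n * x)) * ((deriv φ x : ℝ) : ℂ) =
      Complex.I * n * ∫ x in (-π)..π, Complex.exp (-(Complex.I * n * x)) * φ x := by
  have h1 : ∀ x : ℝ, HasDerivAt (fun x : ℝ => Complex.exp (-(Complex.I * n * x)))
      (-(Complex.I * n) * Complex.exp (-(Complex.I * n * x))) x := fun x => by
    have := (((hasDerivAt_id x).ofReal_comp).const_mul (Complex.I * n)).neg.cexp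
    refine this.congr_deriv ?_
    simp only [id, Complex.ofReal_one, Pi.neg_apply]; ring
  have h2 : ∀ x : ℝ, HasDerivAt (fun x : ℝ => (φ x : ℂ)) ((deriv φ x : ℝ) : ℂ) x := fun x =>
    ((hd.differentiable (by simp)) x).hasDerivAt.ofReal_comp
  have hcd : Continuous (deriv φ) := hd.continuous_deriv (by simp)
  rw [intervalIntegral.integral_mul_deriv_eq_deriv_mul (fun x _ => h1 x) (fun x _ => h2 x)
    (Continuous.intervalIntegrable (by fun_prop) _ _)
    (Continuous.intervalIntegrable (by fun_prop) _ _)]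
  have hper : φ π = φ (-π) := by
    have := hp (-π)
    rwa [show -π + 2 * π = π by ring] at this
  have hexp : Complex.exp (-(Complex.I * n * (π : ℝ))) =
      Complex.exp (-(Complex.I * n * ((-π : ℝ) : ℂ))) := by
    rw [Complex.exp_eq_exp_iff_exists_int]
    exact ⟨-n, by push_cast; ring⟩
  rw [hper, hexp, sub_self, zero_sub, ← intervalIntegral.integral_const_mul,
    ← intervalIntegral.integral_neg]
  exact intervalIntegral.integral_congr fun x _ => by ring

theorem isWeakDeriv_of_cf_eq {f g : L2} (h : cf g = Ds (cf f)) : IsWeakDeriv f g := by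
  intro φ hd hp
  have hp' : Function.Periodic (deriv φ) (2 * π) := fun x => by
    rw [← deriv_comp_add_const]
    congr 1
    funext y; exact hp y
  obtain ⟨Φ, h1, h2⟩ := exists_periodic_lift hd.continuous hp
  obtain ⟨Φ', h3, h4⟩ := exists_periodic_lift (hd.continuous_deriv (by simp)) hp'
  rw [h1, h3, ← mul_neg]
  congr 1
  have h5 : cf Φ' = Ds (cf Φ) := by
    funext n
    rw [h4, Ds, h2, integral_exp_mul_deriv hd hp, Complex.real_smul, Complex.real_smul]
    ring
  rw [h5, h, ip, ip, ← tsum_neg]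
  refine tsum_congr fun n => ?_
  rw [← Complex.neg_re]
  congr 1
  simp only [Ds, map_mul, Complex.conj_I, map_intCast]
  ring

theorem Sym.Ds {a : ℤ → ℂ} (h : Sym a) : Sym (Ds a) := by rw [Sym, ← refl_Ds, h]

theorem InH.of_Ds {k : ℕ} {a : ℤ → ℂ} (ha : Sq a) (h : InH k (MHD.Ds a)) : InH (k + 1) a := by
  have h0 : ∀ n, n ≠ 0 → ‖W (k + 1) a n‖ ≤ 2 * ‖W k (MHD.Ds a) n‖ := fun n hn => by
    have h1 : (1 : ℝ) ≤ |(n : ℝ)| := by exact_mod_cast Int.one_le_abs hn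
    rw [norm_W, norm_W, norm_Ds, wt, wt, pow_succ]
    have : 0 ≤ (1 + |(n : ℝ)|) ^ k * ‖a n‖ := by positivity
    nlinarith
  have hs : Sq (fun n => 2 * ‖W k (MHD.Ds a) n‖ + ‖a n‖) := by
    refine (Sq.add (Sq.const_mul (a := fun n => ‖W k (MHD.Ds a) n‖) ?_ 2).1 ?_).1
    · simpa [Sq, InH] using h
    · simpa [Sq] using ha
  refine (Sq.mono hs fun n => ?_).1
  rw [Real.norm_of_nonneg (by positivity)]
  rcases eq_or_ne n 0 with rfl | hn
  · rw [norm_W, wt]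
    have := norm_nonneg (W k (MHD.Ds a) 0)
    simp only [Int.cast_zero, abs_zero, add_zero, one_pow, one_mul]
    linarith
  · linarith [h0 n hn, norm_nonneg (a n)]

/-- Weak differentiation is the multiplier `i n`. Conversely, `Ds (cf f)` is square summable and
conjugation symmetric, so it is realised by a real `L²` function, which is the weak derivative. -/
theorem memH_iff {k : ℕ} {f : L2} : MemH k f ↔ InH k (cf f) := by
  induction k generalizing f with
  | zero => simpa [MemH, InH, W_zero] using cf_sq f
  | succ k ih =>
    constructor
    · rintro ⟨g, hg, hk⟩
      rw [ih, hg.cf_eq] at hk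
      exact hk.of_Ds (cf_sq f)
    · intro h
      obtain ⟨g, hg⟩ := exists_cf_eq h.Ds.1.sq.1 (cf_sym f).Ds
      exact ⟨g, isWeakDeriv_of_cf_eq hg, ih.2 (hg ▸ h.Ds.1)⟩

theorem cf_weakDeriv {f : L2} (h : InH 1 (cf f)) : cf (weakDeriv f) = Ds (cf f) := by
  have hex : ∃ g, IsWeakDeriv f g := by
    obtain ⟨g, hg, -⟩ := memH_iff.2 h
    exact ⟨g, hg⟩
  rw [weakDeriv, dif_pos hex]
  exact hex.choose_spec.cf_eq

theorem iterate_weakDeriv {k : ℕ} {f : L2} (h : InH k (cf f)) {j : ℕ} (hj : j ≤ k) :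
    InH (k - j) (cf (weakDeriv^[j] f)) ∧
      N2 (W (k - j) (cf (weakDeriv^[j] f))) ≤ N2 (W k (cf f)) := by
  induction j with
  | zero => exact ⟨h, le_rfl⟩
  | succ j ih =>
    obtain ⟨h1, h2⟩ := ih (by omega)
    rw [show k - j = (k - (j + 1)) + 1 by omega] at h1 h2
    rw [Function.iterate_succ_apply', cf_weakDeriv (h1.mono (by omega)).1]
    exact ⟨h1.Ds.1, h1.Ds.2.trans h2⟩

theorem hNorm_nonneg (k : ℕ) (f : L2) : 0 ≤ hNorm k f := Real.sqrt_nonneg _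

theorem hNorm_le {k : ℕ} {f : L2} (h : InH k (cf f)) :
    hNorm k f ≤ √((k + 1) * (2 * π)) * N2 (W k (cf f)) := by
  refine Real.sqrt_le_iff.2 ⟨mul_nonneg (Real.sqrt_nonneg _) (N2_nonneg _), ?_⟩
  rw [mul_pow, Real.sq_sqrt (by positivity)]
  have : ∀ j ∈ Finset.range (k + 1), ‖weakDeriv^[j] f‖ ^ 2 ≤ 2 * π * N2 (W k (cf f)) ^ 2 := by
    intro j hj
    rw [norm_sq_eq]
    obtain ⟨h1, h2⟩ := iterate_weakDeriv h (j := j) (by simpa [Nat.lt_succ_iff] using hj)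
    have := pow_le_pow_left₀ (N2_nonneg _) (h1.sq.2.trans h2) 2
    exact mul_le_mul_of_nonneg_left this (by positivity)
  refine (Finset.sum_le_sum this).trans (le_of_eq ?_)
  rw [Finset.sum_const, Finset.card_range, nsmul_eq_mul]
  push_cast; ring

theorem N2_W_le_hNorm {k : ℕ} {f : L2} (h : InH k (cf f)) :
    N2 (W k (cf f)) ≤ 2 ^ k * hNorm k f := by
  induction k generalizing f with
  | zero =>
    have h1 : N2 (cf f) ^ 2 ≤ ‖f‖ ^ 2 := by
      rw [norm_sq_eq]
      exact le_mul_of_one_le_left (sq_nonneg _) (by linarith [Real.pi_gt_three])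
    simpa [W_zero, hNorm] using (sq_le_sq₀ (N2_nonneg _) (norm_nonneg _)).1 h1
  | succ k ih =>
    have h1 := (h.mono (Nat.le_succ k)).1
    have hc := cf_weakDeriv (h.mono (Nat.le_add_left 1 k)).1
    have h2 : InH k (cf (weakDeriv f)) := by rw [hc]; exact h.Ds.1
    have b1 : hNorm k f ≤ hNorm (k + 1) f := by
      refine Real.sqrt_le_sqrt ?_
      rw [Finset.sum_range_succ _ (k + 1)]
      exact le_add_of_nonneg_right (by positivity)
    have b2 : hNorm k (weakDeriv f) ≤ hNorm (k + 1) f := by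
      refine Real.sqrt_le_sqrt ?_
      rw [Finset.sum_range_succ' _ (k + 1)]
      simp only [Function.iterate_succ_apply]
      exact le_add_of_nonneg_right (by positivity)
    have i1 := (ih h1).trans (mul_le_mul_of_nonneg_left b1 (by positivity))
    have i2 := (ih h2).trans (mul_le_mul_of_nonneg_left b2 (by positivity))
    have s1 : Sq (fun n => ‖W k (cf f) n‖) := by simpa [InH, Sq] using h1
    have s2 : Sq (fun n => ‖W k (cf (weakDeriv f)) n‖) := by simpa [InH, Sq] using h2
    have s3 := s1.add s2
    have e : ∀ a : ℤ → ℂ, N2 (fun n => ‖a n‖) = N2 a := fun a => by simp [N2]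
    -- One factor splits as `1 + |n|`, the weight of `f` plus that of its derivative; each order
    -- thus costs a factor `2`.
    have := (Sq.mono (a := W (k + 1) (cf f)) s3.1 fun n => by
      rw [Real.norm_of_nonneg (by positivity), norm_W, norm_W, norm_W, hc, norm_Ds, wt, wt,
        pow_succ]
      exact le_of_eq (by ring)).2
    rw [e, e] at s3
    rw [pow_succ]
    linarith [s3.2]

end Fourier

/-! ### Absolutely convergent Fourier series -/

section FourierSeries

open AddCircle

/-- The continuous function with absolutely summable Fourier coefficients `a`. -/
def SC (a : ℤ → ℂ) : C(Torus, ℂ) := ∑' n, a n • fourier n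

theorem SC_summable {a : ℤ → ℂ} (ha : S1 a) : Summable fun n => a n • (fourier n : C(Torus, ℂ)) :=
  Summable.of_norm (by simpa [S1, norm_smul, fourier_norm] using ha)

theorem norm_SC_le {a : ℤ → ℂ} (ha : S1 a) : ‖SC a‖ ≤ N1 a := by
  have h : Summable fun n => ‖a n • (fourier n : C(Torus, ℂ))‖ := by
    simpa [S1, norm_smul, fourier_norm] using ha
  refine (norm_tsum_le_tsum_norm h).trans (le_of_eq ?_)
  simp [norm_smul, fourier_norm, N1]

theorem SC_apply {a : ℤ → ℂ} (ha : S1 a) (θ : Torus) : SC a θ = ∑' n, a n * fourier n θ := by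
  rw [SC, ← ContinuousMap.tsum_apply (SC_summable ha)]
  rfl

theorem norm_fourier_apply (n : ℤ) (θ : Torus) : ‖(fourier n θ : ℂ)‖ = 1 := by
  rw [fourier_apply]; exact Circle.norm_coe _

theorem SC_sub {a b : ℤ → ℂ} (ha : S1 a) (hb : S1 b) : SC (fun n => a n - b n) = SC a - SC b := by
  simp only [SC, sub_smul]
  exact (SC_summable ha).tsum_sub (SC_summable hb)

/-- Expanding the absolutely convergent series of `α` under the integral turns multiplication into
convolution, with `φ` merely in `L²`. -/
theorem fourierCoeff_SC_mul {α : ℤ → ℂ} (hα : S1 α) {φ : Torus → ℂ}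
    (hφ : MemLp φ 2 (volume : Measure Torus)) :
    fourierCoeff (fun x => SC α x * φ x) = conv α (fourierCoeff φ) := by
  funext n
  have hint : Integrable φ (haarAddCircle : Measure Torus) := hφ.haarAddCircle.integrable (by norm_num)
  let F : ℤ → Torus → ℂ := fun m x => α m * (fourier (-(n - m)) x * φ x)
  have hF : ∀ m, Integrable (F m) haarAddCircle := fun m => by
    have h := (hint.fourier_smul (-(n - m))).const_mul (α m)
    simpa only [smul_eq_mul] using h
  have hn : ∀ m x, ‖F m x‖ = ‖α m‖ * ‖φ x‖ := fun m x => by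
    simp only [F, norm_mul, norm_fourier_apply, one_mul]
  have hs : Summable fun m => ∫ x : Torus, ‖F m x‖ ∂haarAddCircle := by
    simp only [hn, integral_const_mul]
    exact Summable.mul_right (∫ x : Torus, ‖φ x‖ ∂haarAddCircle) hα
  have key := (hasSum_integral_of_summable_integral_norm hF hs).tsum_eq
  have e : ∀ m, ∫ x : Torus, F m x ∂haarAddCircle = fourierCoeff φ (n - m) * α m := fun m => by
    simp only [F]
    rw [integral_const_mul, fourierCoeff, mul_comm]
    simp only [smul_eq_mul]
  simp only [e] at key
  rw [conv_comm, conv, key, fourierCoeff]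
  refine integral_congr_ae (Eventually.of_forall fun x => ?_)
  simp only [smul_eq_mul, F]
  rw [SC_apply hα, ← tsum_mul_right, ← tsum_mul_left]
  refine tsum_congr fun m => ?_
  rw [show -(n - m) = -n + m by ring, fourier_add]
  ring

theorem fourierCoeff_SC {α : ℤ → ℂ} (hα : S1 α) : fourierCoeff (SC α) = α := by
  have h1 : MemLp (fun _ : Torus => (1 : ℂ)) 2 (volume : Measure Torus) := memLp_const 1
  have h := fourierCoeff_SC_mul hα h1
  have h2 : fourierCoeff (fun _ : Torus => (1 : ℂ)) = Pi.single 0 1 := by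
    have h3 : (fun _ : Torus => (1 : ℂ)) = ⇑(fourier 0 : C(Torus, ℂ)) := by funext; simp
    rw [h3]
    exact fourierCoeff_fourier 0
  rw [h2] at h
  simp only [mul_one] at h
  rw [h]
  funext n
  rw [conv_comm, conv, tsum_eq_single n fun m hm => by
    rw [Pi.single_eq_of_ne (sub_ne_zero.2 hm.symm), zero_mul]]
  simp

theorem memLp_SC_mul (α : ℤ → ℂ) {φ : Torus → ℂ} (hφ : MemLp φ 2 (volume : Measure Torus)) :
    MemLp (fun x => SC α x * φ x) 2 (volume : Measure Torus) :=
  MemLp.of_le_mul (c := ‖SC α‖) hφ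
    ((SC α).continuous.aestronglyMeasurable.mul hφ.aestronglyMeasurable)
    (Eventually.of_forall fun x => by
      rw [norm_mul]; exact mul_le_mul_of_nonneg_right ((SC α).norm_coe_le_norm x) (norm_nonneg _))

/-- Multiplication by a bounded function is bounded on `ℓ²`. -/
theorem N2_conv_le_norm_SC {α β : ℤ → ℂ} (hα : S1 α) (hβ : Sq β) :
    N2 (conv α β) ≤ ‖SC α‖ * N2 β := by
  obtain ⟨φ, hφ, rfl⟩ := exists_fourierCoeff_eq hβ
  have h1 := (fourierCoeff_sq hφ).2
  have h2 := (fourierCoeff_sq (memLp_SC_mul α hφ)).2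
  rw [fourierCoeff_SC_mul hα hφ] at h2
  have hi : Integrable (fun x : Torus => ‖φ x‖ ^ 2) := hφ.integrable_norm_pow (by norm_num)
  have hi' : Integrable (fun x : Torus => ‖SC α x * φ x‖ ^ 2) :=
    (memLp_SC_mul α hφ).integrable_norm_pow (by norm_num)
  have h3 : ∫ x : Torus, ‖SC α x * φ x‖ ^ 2 ≤ ∫ x : Torus, ‖SC α‖ ^ 2 * ‖φ x‖ ^ 2 := by
    refine integral_mono hi' (hi.const_mul _) fun x => ?_
    simp only
    rw [norm_mul, mul_pow]
    gcongr
    exact (SC α).norm_coe_le_norm x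
  rw [integral_const_mul, ← h1, ← h2] at h3
  refine (sq_le_sq₀ (N2_nonneg _) (mul_nonneg (norm_nonneg _) (N2_nonneg _))).1 ?_
  have hpi := Real.pi_pos
  rw [mul_pow]
  nlinarith

theorem hasDerivAt_SC {u : ℤ → ℂ} (hu : S1 u) (hDu : S1 (Ds u)) (y : ℝ) :
    HasDerivAt (fun y : ℝ => SC u (y : Torus)) (SC (Ds u) (y : Torus)) y := by
  have h := hasDerivAt_tsum (u := fun n => ‖Ds u n‖) hDu
    (g := fun n (y : ℝ) => u n * fourier n (y : Torus))
    (g' := fun n (y : ℝ) => Ds u n * fourier n (y : Torus)) (fun n y => ?_) (fun n y => ?_)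
    (y₀ := 0) ?_ y
  · simpa only [SC_apply hu, SC_apply hDu] using h
  · have := (hasDerivAt_fourier (2 * π) n y).const_mul (u n)
    refine this.congr_deriv ?_
    have hpi : (π : ℂ) ≠ 0 := by exact_mod_cast Real.pi_ne_zero
    simp only [Ds]
    push_cast
    field_simp
  · rw [norm_mul, norm_fourier_apply, mul_one]
  · refine Summable.of_norm ?_
    simpa only [S1, norm_mul, norm_fourier_apply, mul_one] using hu

theorem ae_eq_SC {f : L2} (h : S1 (cf f)) : ∀ᵐ x : Torus, (f x : ℂ) = SC (cf f) x :=
  ae_eq_of_fourierCoeff_eq (memLp_ofReal f)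
    ((SC (cf f)).continuous.memLp_of_hasCompactSupport (HasCompactSupport.of_compactSpace _))
    (fourierCoeff_SC h).symm

/-- A continuous function exceeds an almost everywhere bound on an open null set, which is empty. -/
theorem ofReal_norm_le_supNorm {φ : Torus → ℝ} {ψ : C(Torus, ℂ)}
    (h : ∀ᵐ x : Torus, (φ x : ℂ) = ψ x) : ENNReal.ofReal ‖ψ‖ ≤ supNorm φ := by
  rcases eq_or_ne (supNorm φ) ⊤ with ht | ht
  · rw [ht]; exact le_top
  rw [← ENNReal.ofReal_toReal ht]
  refine ENNReal.ofReal_le_ofReal ?_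
  rw [ContinuousMap.norm_le _ ENNReal.toReal_nonneg]
  have h1 : ∀ᵐ x : Torus, ‖ψ x‖ ≤ (supNorm φ).toReal := by
    filter_upwards [h, ae_le_eLpNormEssSup (f := φ) (μ := (volume : Measure Torus))] with x hx hx'
    rw [← hx, Complex.norm_real, ← toReal_enorm]
    refine ENNReal.toReal_mono ht ?_
    rw [supNorm, eLpNorm_exponent_top]
    exact hx'
  have ho : IsOpen {x : Torus | (supNorm φ).toReal < ‖ψ x‖} :=
    isOpen_lt continuous_const ψ.continuous.norm
  have h0 : {x : Torus | (supNorm φ).toReal < ‖ψ x‖} = ∅ := by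
    rw [← ho.measure_eq_zero_iff (volume : Measure Torus)]
    have := ae_iff.1 h1
    simpa only [not_le] using this
  intro x
  by_contra hx
  rw [not_le] at hx
  have : x ∈ (∅ : Set Torus) := h0 ▸ hx
  exact this

end FourierSeries

/-! ### The conjugate kernel -/

section Kernel

/-- The truncated sine integral of the kernel `cot (s / 2)`. -/
def kerInt (ε : ℝ) (n : ℕ) : ℝ := ∫ s in ε..π, Real.cot (s / 2) * Real.sin (n * s)

theorem sin_half_ne_zero {s : ℝ} (h0 : 0 < |s|) (h1 : |s| ≤ π) : Real.sin (s / 2) ≠ 0 := by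
  rcases lt_or_gt_of_ne (abs_pos.1 h0) with h | h
  · rw [abs_of_neg h] at h1
    exact (Real.sin_neg_of_neg_of_neg_pi_lt (by linarith) (by linarith [Real.pi_pos])).ne
  · rw [abs_of_pos h] at h1
    exact (Real.sin_pos_of_pos_of_lt_pi (by linarith) (by linarith [Real.pi_pos])).ne'

theorem continuousOn_cot_half {ε : ℝ} (hε : 0 < ε) :
    ContinuousOn (fun s : ℝ => Real.cot (s / 2)) {s | ε ≤ |s| ∧ |s| ≤ π} := by
  have : (fun s : ℝ => Real.cot (s / 2)) = fun s => Real.cos (s / 2) / Real.sin (s / 2) := by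
    funext s; exact Real.cot_eq_cos_div_sin _
  rw [this]
  exact ContinuousOn.div (by fun_prop) (by fun_prop) fun s hs =>
    sin_half_ne_zero (hε.trans_le hs.1) hs.2

theorem uIcc_subset {ε : ℝ} (hε : 0 < ε) (h : ε ≤ π) :
    uIcc ε π ⊆ {s | ε ≤ |s| ∧ |s| ≤ π} := by
  rw [uIcc_of_le h]
  intro s hs
  rw [Set.mem_ofPred_eq, abs_of_pos (hε.trans_le hs.1)]
  exact hs

theorem intervalIntegrable_cot_mul {ε : ℝ} (hε : 0 < ε) (h : ε ≤ π) {φ : ℝ → ℝ}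
    (hφ : Continuous φ) :
    IntervalIntegrable (fun s => Real.cot (s / 2) * φ s) volume ε π :=
  (((continuousOn_cot_half hε).mono (uIcc_subset hε h)).mul hφ.continuousOn).intervalIntegrable

/-- The difference of consecutive sines contains the factor `sin (s / 2)`, which cancels the
singularity of the cotangent. The resulting recursion gives both the uniform bound and the limit of
`kerInt`. -/
theorem kerInt_succ_sub {ε : ℝ} (hε : 0 < ε) (h : ε ≤ π) (n : ℕ) :
    kerInt ε (n + 1) - kerInt ε n =
      ∫ s in ε..π, (Real.cos (((n + 1 : ℕ) : ℝ) * s) + Real.cos (n * s)) := by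
  rw [kerInt, kerInt, ← intervalIntegral.integral_sub
    (intervalIntegrable_cot_mul hε h (by fun_prop)) (intervalIntegrable_cot_mul hε h (by fun_prop))]
  refine intervalIntegral.integral_congr fun s hs => ?_
  obtain ⟨h1, h2⟩ := uIcc_subset hε h hs
  have hsin := sin_half_ne_zero (hε.trans_le h1) h2
  rw [← mul_sub, Real.sin_sub_sin, Real.cos_add_cos, Real.cot_eq_cos_div_sin,
    show (((n + 1 : ℕ) : ℝ) * s - n * s) / 2 = s / 2 by push_cast; ring]
  field_simp

theorem integral_cos_mul {ε : ℝ} {n : ℕ} (hn : n ≠ 0) :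
    ∫ s in ε..π, Real.cos (n * s) = -(Real.sin (n * ε) / n) := by
  have hn' : (n : ℝ) ≠ 0 := by exact_mod_cast hn
  rw [intervalIntegral.integral_comp_mul_left _ hn', integral_cos, Real.sin_nat_mul_pi, zero_sub,
    smul_eq_mul]
  ring

theorem kerInt_one {ε : ℝ} (hε : 0 < ε) (h : ε ≤ π) : kerInt ε 1 = π - ε - Real.sin ε := by
  have h1 := kerInt_succ_sub hε h 0
  have h0 : kerInt ε 0 = 0 := by simp [kerInt]
  rw [h0, sub_zero, intervalIntegral.integral_add
    (Continuous.intervalIntegrable (by fun_prop) _ _)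
    (Continuous.intervalIntegrable (by fun_prop) _ _), integral_cos_mul (by norm_num)] at h1
  rw [zero_add] at h1
  rw [h1]
  simp
  ring

theorem kerInt_succ {ε : ℝ} (hε : 0 < ε) (h : ε ≤ π) {n : ℕ} (hn : n ≠ 0) :
    kerInt ε (n + 1) =
      kerInt ε n - Real.sin (((n + 1 : ℕ) : ℝ) * ε) / ((n + 1 : ℕ) : ℝ) -
        Real.sin (n * ε) / n := by
  have h1 := kerInt_succ_sub hε h n
  rw [intervalIntegral.integral_add (Continuous.intervalIntegrable (by fun_prop) _ _)
    (Continuous.intervalIntegrable (by fun_prop) _ _), integral_cos_mul hn,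
    integral_cos_mul (Nat.succ_ne_zero n)] at h1
  linarith

theorem abs_sin_mul_div_le (ε : ℝ) (n : ℕ) : |Real.sin (n * ε) / n| ≤ (n : ℝ)⁻¹ := by
  rw [abs_div, Nat.abs_cast, div_eq_mul_inv]
  exact mul_le_of_le_one_left (by positivity) (Real.abs_sin_le_one _)

/-- Logarithmic growth, uniform in `ε`, suffices for dominated convergence in `hilbert_eq`, since
`H¹` coefficients absorb it. A recursion step costs at most `3 / (n + 1)`, because `1 / n ≤ 2 / (n +
1)`; the constant `5` also covers the case `n = 1`. -/
theorem abs_kerInt_le {ε : ℝ} (hε : 0 < ε) (h : ε ≤ 1) (n : ℕ) :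
    |kerInt ε n| ≤ 5 * (harmonic n : ℝ) := by
  have hpi : ε ≤ π := by linarith [Real.pi_gt_three]
  induction n with
  | zero => simp [kerInt]
  | succ n ih =>
    rw [harmonic_succ]
    push_cast
    rcases Nat.eq_zero_or_pos n with rfl | hn
    · rw [zero_add, kerInt_one hε hpi, abs_le]
      have := Real.sin_le hε.le
      have := Real.sin_nonneg_of_nonneg_of_le_pi hε.le hpi
      norm_num
      constructor <;> linarith [Real.pi_gt_three, Real.pi_lt_four]
    · rw [kerInt_succ hε hpi hn.ne']
      have h1 := abs_le.1 (abs_sin_mul_div_le ε (n + 1))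
      have h2 := abs_le.1 (abs_sin_mul_div_le ε n)
      have h3 : (n : ℝ)⁻¹ ≤ 2 * ((n : ℝ) + 1)⁻¹ := by
        have : (1 : ℝ) ≤ n := by exact_mod_cast hn
        rw [inv_eq_one_div, ← div_eq_mul_inv, div_le_div_iff₀ (by linarith) (by linarith)]
        linarith
      push_cast at h1 ⊢
      have h4 := abs_le.1 ih
      rw [abs_le]
      have : 0 ≤ ((n : ℝ) + 1)⁻¹ := by positivity
      constructor <;> linarith [h1.1, h1.2, h2.1, h2.2, h4.1, h4.2]

theorem tendsto_kerInt {n : ℕ} (hn : n ≠ 0) :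
    Tendsto (fun ε => kerInt ε n) (𝓝[>] 0) (𝓝 π) := by
  have hev : ∀ᶠ ε in 𝓝[>] (0 : ℝ), 0 < ε ∧ ε ≤ π := by
    filter_upwards [Ioo_mem_nhdsGT Real.pi_pos] with ε hε
    exact ⟨hε.1, hε.2.le⟩
  have hc : ∀ {φ : ℝ → ℝ}, Continuous φ → Tendsto φ (𝓝[>] 0) (𝓝 (φ 0)) := fun h =>
    (h.tendsto 0).mono_left nhdsWithin_le_nhds
  induction n with
  | zero => exact absurd rfl hn
  | succ n ih =>
    rcases Nat.eq_zero_or_pos n with rfl | hn'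
    · have := hc (φ := fun ε => π - ε - Real.sin ε) (by fun_prop)
      simp only [sub_zero, Real.sin_zero] at this
      refine this.congr' ?_
      filter_upwards [hev] with ε hε
      exact (kerInt_one hε.1 hε.2).symm
    · have h1 := hc (φ := fun ε => Real.sin (((n + 1 : ℕ) : ℝ) * ε) / ((n + 1 : ℕ) : ℝ))
        (by fun_prop)
      have h2 := hc (φ := fun ε => Real.sin (n * ε) / n) (by fun_prop)
      have := ((ih hn'.ne').sub h1).sub h2
      simp only [mul_zero, Real.sin_zero, zero_div, sub_zero] at this
      refine this.congr' ?_
      filter_upwards [hev] with ε hε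
      exact (kerInt_succ hε.1 hε.2 hn'.ne').symm

/-- The truncated domain of the principal value. -/
def pvSet (ε : ℝ) : Set ℝ := {s : ℝ | ε < |s| ∧ |s| < π}

theorem pvSet_eq {ε : ℝ} (hε : 0 < ε) : pvSet ε = Ioo ε π ∪ Ioo (-π) (-ε) := by
  ext s
  simp only [pvSet, Set.mem_ofPred_eq, mem_union, mem_Ioo]
  constructor
  · rintro ⟨h1, h2⟩
    rcases le_total 0 s with h | h
    · rw [abs_of_nonneg h] at h1 h2; exact Or.inl ⟨h1, h2⟩
    · rw [abs_of_nonpos h] at h1 h2; exact Or.inr ⟨by linarith, by linarith⟩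
  · rintro (⟨h1, h2⟩ | ⟨h1, h2⟩)
    · rw [abs_of_pos (hε.trans h1)]; exact ⟨h1, h2⟩
    · rw [abs_of_neg (by linarith)]; exact ⟨by linarith, by linarith⟩

theorem integrableOn_pvSet {ε : ℝ} (hε : 0 < ε) {φ : ℝ → ℂ} (hφ : Continuous φ) :
    IntegrableOn (fun s : ℝ => (Real.cot (s / 2) : ℂ) * φ s) (pvSet ε) := by
  have hcl : IsCompact {s : ℝ | ε ≤ |s| ∧ |s| ≤ π} := by
    refine Metric.isCompact_of_isClosed_isBounded ?_ ?_
    · exact (isClosed_le continuous_const continuous_abs).inter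
        (isClosed_le continuous_abs continuous_const)
    · exact (Metric.isBounded_Icc (-π) π).subset fun s hs => abs_le.1 hs.2
  have hcont : ContinuousOn (fun s : ℝ => (Real.cot (s / 2) : ℂ) * φ s)
      {s : ℝ | ε ≤ |s| ∧ |s| ≤ π} :=
    (Complex.continuous_ofReal.comp_continuousOn (continuousOn_cot_half hε)).mul hφ.continuousOn
  exact (hcont.integrableOn_compact hcl).mono_set fun s hs => ⟨hs.1.le, hs.2.le⟩

theorem integral_pvSet {ε : ℝ} (hε : 0 < ε) (h : ε ≤ π) {φ : ℝ → ℂ} (hφ : Continuous φ) :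
    ∫ s in pvSet ε, (Real.cot (s / 2) : ℂ) * φ s =
      ∫ s in ε..π, (Real.cot (s / 2) : ℂ) * (φ s - φ (-s)) := by
  have hint := integrableOn_pvSet hε hφ
  rw [pvSet_eq hε] at hint ⊢
  have hd : Disjoint (Ioo ε π) (Ioo (-π) (-ε)) := by
    rw [Set.disjoint_left]
    intro s h1 h2
    linarith [h1.1, h2.2]
  have hint' := integrableOn_pvSet hε (φ := fun s => φ (-s)) (hφ.comp continuous_neg)
  rw [pvSet_eq hε] at hint'
  rw [setIntegral_union hd measurableSet_Ioo (hint.mono_set subset_union_left)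
    (hint.mono_set subset_union_right)]
  have e1 : ∀ ψ : ℝ → ℂ, ∫ s in Ioo ε π, ψ s = ∫ s in ε..π, ψ s := fun ψ => by
    rw [intervalIntegral.integral_of_le h, integral_Ioc_eq_integral_Ioo]
  have e2 : ∫ s in Ioo (-π) (-ε), (Real.cot (s / 2) : ℂ) * φ s =
      ∫ s in ε..π, (Real.cot (-s / 2) : ℂ) * φ (-s) := by
    rw [← integral_Ioc_eq_integral_Ioo, ← intervalIntegral.integral_of_le (by linarith),
      intervalIntegral.integral_comp_neg (fun s => (Real.cot (s / 2) : ℂ) * φ s)]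
  have i1 : ∀ {ψ : ℝ → ℂ}, IntegrableOn ψ (Ioo ε π ∪ Ioo (-π) (-ε)) →
      IntervalIntegrable ψ volume ε π := fun hψ => by
    rw [intervalIntegrable_iff_integrableOn_Ioo_of_le h]
    exact hψ.mono_set subset_union_left
  rw [e1, e2, ← sub_neg_eq_add, ← intervalIntegral.integral_neg]
  have e3 : ∀ s : ℝ, -((Real.cot (-s / 2) : ℂ) * φ (-s)) = (Real.cot (s / 2) : ℂ) * φ (-s) := by
    intro s
    rw [neg_div, Real.cot_eq_cos_div_sin, Real.cos_neg, Real.sin_neg, Real.cot_eq_cos_div_sin]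
    push_cast; ring
  simp only [e3]
  rw [← intervalIntegral.integral_sub (i1 hint) (i1 hint')]
  exact intervalIntegral.integral_congr fun s _ => by ring

theorem integral_pvSet_exp {ε : ℝ} (hε : 0 < ε) (h : ε ≤ π) (n : ℤ) :
    ∫ s in pvSet ε, (Real.cot (s / 2) : ℂ) * Complex.exp (-(Complex.I * n * s)) =
      -2 * Complex.I * (SignType.sign n : ℤ) * kerInt ε n.natAbs := by
  rw [integral_pvSet hε h (φ := fun s : ℝ => Complex.exp (-(Complex.I * n * s))) (by fun_prop),
    kerInt, ← intervalIntegral.integral_ofReal, ← intervalIntegral.integral_const_mul]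
  refine intervalIntegral.integral_congr fun s _ => ?_
  have e1 : Complex.exp (-(Complex.I * n * s)) - Complex.exp (-(Complex.I * n * ((-s : ℝ) : ℂ))) =
      -2 * Complex.I * Real.sin (n * s) := by
    have hs := Complex.two_sin ((n * s : ℝ) : ℂ)
    rw [← Complex.ofReal_sin] at hs
    rw [show -(Complex.I * n * s) = -((n * s : ℝ) : ℂ) * Complex.I by push_cast; ring,
      show -(Complex.I * n * ((-s : ℝ) : ℂ)) = ((n * s : ℝ) : ℂ) * Complex.I by push_cast; ring]
    linear_combination Complex.I * hs + (Complex.exp (-((n * s : ℝ) : ℂ) * Complex.I) -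
      Complex.exp (((n * s : ℝ) : ℂ) * Complex.I)) * Complex.I_mul_I
  have e2 : Real.sin (n * s) = (SignType.sign n : ℤ) * Real.sin ((n.natAbs : ℕ) * s) := by
    rcases lt_trichotomy n 0 with hn | hn | hn
    · have : ((n.natAbs : ℕ) : ℝ) = -(n : ℝ) := by
        rw [Nat.cast_natAbs, abs_of_neg hn]; push_cast; rfl
      rw [this, sign_neg hn, neg_mul, Real.sin_neg]; simp
    · simp [hn]
    · have : ((n.natAbs : ℕ) : ℝ) = (n : ℝ) := by rw [Nat.cast_natAbs, abs_of_pos hn]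
      rw [this, sign_pos hn]; simp
  rw [e1, e2, Complex.ofReal_mul, Complex.ofReal_mul, Complex.ofReal_intCast]
  ring

end Kernel

/-! ### The Hilbert transform, the velocity and the right-hand side of an `H¹` function -/

section PhysicalSpace

open AddCircle

theorem sq_harmonic_div : Sq fun n : ℤ => ((harmonic n.natAbs : ℚ) : ℝ) / (1 + |(n : ℝ)|) := by
  have hs : Summable fun n : ℤ => 25 * |(n : ℝ)| ^ (-(3 / 2 : ℝ)) :=
    (Real.summable_abs_int_rpow (by norm_num)).mul_left 25
  refine Summable.of_nonneg_of_le (fun _ => by positivity) (fun n => ?_) hs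
  rcases eq_or_ne n 0 with rfl | hn
  · simp
  have h1 : (1 : ℝ) ≤ |(n : ℝ)| := by exact_mod_cast Int.one_le_abs hn
  have hx : ((n.natAbs : ℕ) : ℝ) = |(n : ℝ)| := by rw [Nat.cast_natAbs]; push_cast; rfl
  set x := |(n : ℝ)|
  -- From `1 + log x ≤ 1 + 4 x^(1/4)` and `1 ≤ x^(1/4)`. After squaring and dividing by `x²` this
  -- leaves the summable `25 x^(-3/2)`.
  have h2 : ((harmonic n.natAbs : ℚ) : ℝ) ≤ 5 * x ^ (1 / 4 : ℝ) := by
    have := harmonic_le_one_add_log n.natAbs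
    rw [hx] at this
    have h3 := Real.log_le_rpow_div (x := x) (ε := 1 / 4) (by linarith) (by norm_num)
    have h4 : 1 ≤ x ^ (1 / 4 : ℝ) := Real.one_le_rpow h1 (by norm_num)
    linarith
  have h0 : (0 : ℝ) ≤ ((harmonic n.natAbs : ℚ) : ℝ) := by
    have : (0 : ℚ) ≤ harmonic n.natAbs := Finset.sum_nonneg fun _ _ => by positivity
    exact_mod_cast this
  rw [Real.norm_eq_abs, sq_abs, div_pow, div_le_iff₀ (by positivity)]
  have h5 : x ^ (-(3 / 2 : ℝ)) * x ^ 2 = (x ^ (1 / 4 : ℝ)) ^ 2 := by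
    rw [← Real.rpow_natCast x 2, ← Real.rpow_add (by linarith), ← Real.rpow_natCast,
      ← Real.rpow_mul (by linarith)]
    norm_num
  have h6 : ((harmonic n.natAbs : ℚ) : ℝ) ^ 2 ≤ (5 * x ^ (1 / 4 : ℝ)) ^ 2 :=
    pow_le_pow_left₀ h0 h2 2
  have h7 : x ^ (-(3 / 2 : ℝ)) * x ^ 2 ≤ x ^ (-(3 / 2 : ℝ)) * (1 + x) ^ 2 := by
    gcongr; linarith
  nlinarith

theorem summable_harmonic_mul {a : ℤ → ℂ} (ha : InH 1 a) :
    Summable fun n : ℤ => ((harmonic n.natAbs : ℚ) : ℝ) * ‖a n‖ := by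
  have := (sq_harmonic_div.mul_le ha).1
  refine this.congr fun n => ?_
  have h0 : (0 : ℝ) ≤ ((harmonic n.natAbs : ℚ) : ℝ) := by
    have : (0 : ℚ) ≤ harmonic n.natAbs := Finset.sum_nonneg fun _ _ => by positivity
    exact_mod_cast this
  rw [norm_W, wt, pow_one, Real.norm_of_nonneg (by positivity)]
  field_simp

theorem fourier_sub_coe (n : ℤ) (θ : Torus) (s : ℝ) :
    (fourier n (θ - (s : Torus)) : ℂ) = fourier n θ * Complex.exp (-(Complex.I * n * s)) := by
  rw [fourier_apply, fourier_apply, sub_eq_add_neg, smul_add, toCircle_add, Circle.coe_mul,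
    ← fourier_apply, ← fourier_apply, ← AddCircle.coe_neg, exp_eq_fourier]
  congr 2
  push_cast; ring

/-- Lets the truncated principal value, at every single `θ`, be computed with the continuous
representative of an `L²` class. -/
theorem ae_pvSet {P : Torus → Prop} (h : ∀ᵐ x : Torus, P x) (θ : Torus) (ε : ℝ) :
    ∀ᵐ s : ℝ ∂volume.restrict (pvSet ε), P (θ - (s : Torus)) := by
  have h1 : ∀ᵐ x : Torus, P (θ - x) :=
    (Measure.measurePreserving_sub_left (volume : Measure Torus) θ).quasiMeasurePreserving.ae h
  have h2 := (AddCircle.measurePreserving_mk (2 * π) (-π)).quasiMeasurePreserving.ae h1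
  refine ae_restrict_of_ae_restrict_of_subset (fun s hs => ?_) h2
  have := abs_lt.1 hs.2
  exact ⟨this.1, by linarith [this.2]⟩

theorem truncated_hilbert {f : L2} (h : S1 (cf f)) (θ : Torus) {ε : ℝ} (hε : 0 < ε) (hπ : ε ≤ π) :
    (((2 * π)⁻¹ * ∫ s in pvSet ε, Real.cot (s / 2) * f (θ - (s : Torus)) : ℝ) : ℂ) =
      ∑' n : ℤ, cf f n * fourier n θ *
        (-Complex.I * (SignType.sign n : ℤ) * (π⁻¹ * kerInt ε n.natAbs : ℝ)) := by
  let F : ℤ → ℝ → ℂ := fun n s =>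
    cf f n * fourier n θ * ((Real.cot (s / 2) : ℂ) * Complex.exp (-(Complex.I * n * s)))
  have hF : ∀ n, IntegrableOn (F n) (pvSet ε) := fun n =>
    (integrableOn_pvSet hε (φ := fun s : ℝ => Complex.exp (-(Complex.I * n * s)))
      (by fun_prop)).const_mul _
  have hn : ∀ n s, ‖F n s‖ = ‖cf f n‖ * |Real.cot (s / 2)| := fun n s => by
    simp only [F]
    rw [norm_mul, norm_mul, norm_mul, norm_fourier_apply, Complex.norm_real,
      show -(Complex.I * n * s) = ((-(n * s) : ℝ) : ℂ) * Complex.I by push_cast; ring,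
      Complex.norm_exp_ofReal_mul_I, mul_one, mul_one, Real.norm_eq_abs]
  have hs : Summable fun n => ∫ s in pvSet ε, ‖F n s‖ := by
    simp only [hn, integral_const_mul]
    exact Summable.mul_right (∫ s in pvSet ε, |Real.cot (s / 2)|) h
  have key := (hasSum_integral_of_summable_integral_norm hF hs).tsum_eq
  rw [Complex.ofReal_mul, ← integral_complex_ofReal]
  have e : ∫ s in pvSet ε, ((Real.cot (s / 2) * f (θ - (s : Torus)) : ℝ) : ℂ) =
      ∫ s in pvSet ε, ∑' n, F n s := by
    refine integral_congr_ae ?_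
    filter_upwards [ae_pvSet (ae_eq_SC h) θ ε] with s hs'
    rw [Complex.ofReal_mul, hs', SC_apply h, ← tsum_mul_left]
    refine tsum_congr fun n => ?_
    simp only [F]
    rw [fourier_sub_coe]; ring
  rw [e, ← key, ← tsum_mul_left]
  refine tsum_congr fun n => ?_
  simp only [F]
  rw [integral_const_mul, integral_pvSet_exp hε hπ]
  have : (π : ℂ) ≠ 0 := by exact_mod_cast Real.pi_ne_zero
  push_cast
  field_simp

/-- The cotangent kernel multiplies the `n`-th coefficient by `-i sgn(n) kerInt ε |n| / π`, which
tends to `-i sgn(n)`. Domination by `harmonic |n| * ‖cf f n‖` permits the limit under the sum, at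
every point `θ`. -/
theorem hilbert_eq {f : L2} (h : InH 1 (cf f)) (θ : Torus) :
    ((hilbert f θ : ℝ) : ℂ) = SC (Hs (cf f)) θ := by
  have hS := h.s1.1
  have hlim : Tendsto (fun ε : ℝ =>
      (((2 * π)⁻¹ * ∫ s in pvSet ε, Real.cot (s / 2) * f (θ - (s : Torus)) : ℝ) : ℂ))
      (𝓝[>] 0) (𝓝 (SC (Hs (cf f)) θ)) := by
    rw [SC_apply hS.Hs.1]
    have hev : ∀ᶠ ε in 𝓝[>] (0 : ℝ), 0 < ε ∧ ε ≤ 1 := by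
      filter_upwards [Ioo_mem_nhdsGT one_pos] with ε hε
      exact ⟨hε.1, hε.2.le⟩
    have hpi := Real.pi_gt_three
    refine Tendsto.congr' (f₁ := fun ε => ∑' n : ℤ, cf f n * fourier n θ *
        (-Complex.I * (SignType.sign n : ℤ) * (π⁻¹ * kerInt ε n.natAbs : ℝ))) ?_ ?_
    · filter_upwards [hev] with ε hε
      exact (truncated_hilbert hS θ hε.1 (by linarith [hε.2])).symm
    refine tendsto_tsum_of_dominated_convergence
      (bound := fun n : ℤ => 5 * (((harmonic n.natAbs : ℚ) : ℝ) * ‖cf f n‖))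
      ((summable_harmonic_mul h).mul_left 5) (fun n => ?_) ?_
    · rcases eq_or_ne n 0 with rfl | hn
      · simp [Hs]
      · have h1 := ((tendsto_kerInt (Int.natAbs_ne_zero.2 hn)).const_mul π⁻¹)
        rw [inv_mul_cancel₀ Real.pi_ne_zero] at h1
        have h2 := ((Complex.continuous_ofReal.tendsto _).comp h1).const_mul
          (cf f n * fourier n θ * (-Complex.I * (SignType.sign n : ℤ)))
        refine (h2.congr fun ε => ?_).trans_eq ?_
        · simp only [Function.comp]; ring
        · rw [Hs]; congr 1; push_cast; ring
    · filter_upwards [hev] with ε hε n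
      have h1 := abs_kerInt_le hε.1 hε.2 n.natAbs
      have h2 : ‖((SignType.sign n : ℤ) : ℂ)‖ ≤ 1 := by
        rcases lt_trichotomy n 0 with h | h | h <;> simp [h]
      have h3 : π⁻¹ ≤ 1 := inv_le_one_of_one_le₀ (by linarith)
      rw [norm_mul, norm_mul, norm_mul, norm_mul, norm_neg, Complex.norm_I, norm_fourier_apply,
        Complex.norm_real, Real.norm_eq_abs, abs_mul, abs_of_pos (inv_pos.2 Real.pi_pos), mul_one,
        one_mul]
      have h4 : ‖((SignType.sign n : ℤ) : ℂ)‖ * (π⁻¹ * |kerInt ε n.natAbs|) ≤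
          1 * (1 * (5 * ((harmonic n.natAbs : ℚ) : ℝ))) := by gcongr
      calc _ ≤ ‖cf f n‖ * (1 * (1 * (5 * ((harmonic n.natAbs : ℚ) : ℝ)))) := by gcongr
        _ = _ := by ring
  have hre : Tendsto (fun ε : ℝ =>
      (2 * π)⁻¹ * ∫ s in pvSet ε, Real.cot (s / 2) * f (θ - (s : Torus)))
      (𝓝[>] 0) (𝓝 (SC (Hs (cf f)) θ).re) := by
    have := (Complex.continuous_re.tendsto _).comp hlim
    refine this.congr fun ε => ?_
    simp only [Function.comp, Complex.ofReal_re]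
  have h1 : hilbert f θ = (SC (Hs (cf f)) θ).re := hre.limUnder_eq
  rw [h1]
  refine tendsto_nhds_unique ?_ hlim
  refine ((Complex.continuous_ofReal.tendsto _).comp hre).congr fun ε => ?_
  rfl

theorem SC_us_zero {g : ℤ → ℂ} (hg : Sq g) : SC (us g) 0 = 0 := by
  have hS := (us_S1 hg).1
  rw [SC_apply hS]
  simp only [fourier_eval_zero, mul_one]
  have hs : Summable (us g) := hS.of_norm
  rw [hs.tsum_eq_add_tsum_ite 0]
  have : ∀ n : ℤ, (if n = 0 then 0 else us g n) = -(g n / ((|n| : ℤ) : ℂ)) := fun n => by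
    rcases eq_or_ne n 0 with rfl | hn
    · simp
    · simp [us, hn]
  simp only [this, tsum_neg]
  simp [us]

/-- Both sides are primitives of the Hilbert transform that vanish at the origin, where the mean in
`us` was chosen to give `SC_us_zero`. -/
theorem velocity_eq {f : L2} (h : InH 1 (cf f)) (θ : Torus) :
    ((velocity f θ : ℝ) : ℂ) = SC (us (cf f)) θ := by
  obtain ⟨x, hx, rfl⟩ : ∃ x ∈ Ioc (-π) (-π + 2 * π), (x : Torus) = θ :=
    ⟨_, (equivIoc (2 * π) (-π) θ).2, coe_equivIoc⟩
  have hD : Ds (us (cf f)) = Hs (cf f) := Ds_us _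
  have hS := (us_S1 h.sq.1).1
  have hS' : S1 (Ds (us (cf f))) := hD ▸ h.s1.1.Hs.1
  rw [velocity, AddCircle.liftIoc_coe_apply hx, ← intervalIntegral.integral_ofReal]
  simp only [hilbert_eq h, ← hD]
  rw [intervalIntegral.integral_eq_sub_of_hasDerivAt (fun y _ => hasDerivAt_SC hS hS' y)
    (Continuous.intervalIntegrable ((SC _).continuous.comp (AddCircle.continuous_mk' _)) _ _)]
  rw [show ((0 : ℝ) : Torus) = 0 from rfl, SC_us_zero h.sq.1, sub_zero]

theorem fourierCoeff_linear_comb {φ₁ φ₂ φ₃ : Torus → ℂ} (h₁ : MemLp φ₁ 2 (volume : Measure Torus))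
    (h₂ : MemLp φ₂ 2 (volume : Measure Torus)) (h₃ : MemLp φ₃ 2 (volume : Measure Torus))
    (a b c : ℂ) (n : ℤ) :
    fourierCoeff (fun x => a * φ₁ x + b * φ₂ x - c * φ₃ x) n =
      a * fourierCoeff φ₁ n + b * fourierCoeff φ₂ n - c * fourierCoeff φ₃ n := by
  have i : ∀ {φ : Torus → ℂ}, MemLp φ 2 (volume : Measure Torus) →
      Integrable (fun x => fourier (-n) x • φ x) (haarAddCircle : Measure Torus) := fun h =>
    (h.haarAddCircle.integrable (by norm_num)).fourier_smul (-n)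
  have i₁₂ : Integrable (fun x => a * (fourier (-n) x • φ₁ x) + b * (fourier (-n) x • φ₂ x))
      (haarAddCircle : Measure Torus) := ((i h₁).const_mul a).add ((i h₂).const_mul b)
  simp only [fourierCoeff]
  rw [← integral_const_mul, ← integral_const_mul, ← integral_const_mul,
    ← integral_add ((i h₁).const_mul a) ((i h₂).const_mul b),
    ← integral_sub i₁₂ ((i h₃).const_mul c)]
  refine integral_congr_ae (Eventually.of_forall fun x => ?_)
  simp only [smul_eq_mul]
  ring

/-- The right-hand side of the equation has the Fourier coefficients `nl`. -/
theorem ae_eq_rhs_iff {f g : L2} (hf : InH 1 (cf f)) (hg : InH 1 (cf g)) (a p q : ℝ) (F : L2) :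
    F =ᵐ[volume] rhs a p q f g ↔ cf F = nl a p q (cf f) (cf g) := by
  let φ₁ : Torus → ℂ := fun x => SC (Hs (cf g)) x * f x
  let φ₂ : Torus → ℂ := fun x => SC (Hs (cf f)) x * g x
  let φ₃ : Torus → ℂ := fun x => SC (us (cf g)) x * (weakDeriv f : Torus → ℝ) x
  have m₁ : MemLp φ₁ 2 (volume : Measure Torus) := memLp_SC_mul _ (memLp_ofReal f)
  have m₂ : MemLp φ₂ 2 (volume : Measure Torus) := memLp_SC_mul _ (memLp_ofReal g)
  have m₃ : MemLp φ₃ 2 (volume : Measure Torus) := memLp_SC_mul _ (memLp_ofReal (weakDeriv f))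
  let ψ : Torus → ℂ := fun x => (p : ℂ) * φ₁ x + (q : ℂ) * φ₂ x - (a : ℂ) * φ₃ x
  have hψ : ∀ x, ((rhs a p q f g x : ℝ) : ℂ) = ψ x := fun x => by
    simp only [rhs, ψ, φ₁, φ₂, φ₃]
    push_cast
    rw [hilbert_eq hg, hilbert_eq hf, velocity_eq hg]
    ring
  have mψ : MemLp ψ 2 (volume : Measure Torus) :=
    ((m₁.const_mul _).add (m₂.const_mul _)).sub (m₃.const_mul _)
  have hcoef : fourierCoeff ψ = nl a p q (cf f) (cf g) := by
    funext n
    rw [show fourierCoeff ψ n = _ from fourierCoeff_linear_comb m₁ m₂ m₃ p q a n]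
    simp only [φ₁, φ₂, φ₃]
    rw [fourierCoeff_SC_mul hg.s1.1.Hs.1 (memLp_ofReal f),
      fourierCoeff_SC_mul hf.s1.1.Hs.1 (memLp_ofReal g),
      fourierCoeff_SC_mul (us_S1 hg.sq.1).1 (memLp_ofReal (weakDeriv f)),
      show fourierCoeff (fun x : Torus => ((weakDeriv f : Torus → ℝ) x : ℂ)) = _ from
        cf_weakDeriv hf]
    rfl
  constructor
  · intro h
    rw [cf_congr h, ← hcoef]
    simp only [hψ]
  · intro h
    have := ae_eq_of_fourierCoeff_eq (memLp_ofReal F) mψ (h.trans hcoef.symm)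
    filter_upwards [this] with x hx
    rw [← hψ] at hx
    exact Complex.ofReal_injective hx

/-- The supremum norms of `f` and `Hf` are those of their Fourier series. -/
theorem ofReal_norm_SC_le {f : L2} (h : InH 1 (cf f)) :
    ENNReal.ofReal ‖SC (cf f)‖ ≤ supNorm f ∧
      ENNReal.ofReal ‖SC (Hs (cf f))‖ ≤ supNorm (hilbert f) :=
  ⟨ofReal_norm_le_supNorm (ae_eq_SC h.s1.1),
    ofReal_norm_le_supNorm (Eventually.of_forall (hilbert_eq h))⟩

end PhysicalSpace

/-! ### Translations and difference quotients -/

/-- Translation by `h`, on Fourier coefficients. -/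
def tr (h : ℝ) (a : ℤ → ℂ) (n : ℤ) : ℂ := Complex.exp (Complex.I * n * h) * a n

/-- The symbol of the difference quotient with step `h`. -/
def dqSymbol (h : ℝ) (n : ℤ) : ℂ := (Complex.exp (Complex.I * n * h) - 1) / h

/-- The difference quotient with step `h`, on Fourier coefficients. -/
def dq (h : ℝ) (a : ℤ → ℂ) (n : ℤ) : ℂ := dqSymbol h n * a n

theorem norm_exp_I_mul (n : ℤ) (h : ℝ) : ‖Complex.exp (Complex.I * n * h)‖ = 1 := by
  rw [show Complex.I * n * h = ((n * h : ℝ) : ℂ) * Complex.I by push_cast; ring,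
    Complex.norm_exp_ofReal_mul_I]

theorem norm_tr (h : ℝ) (a : ℤ → ℂ) (n : ℤ) : ‖tr h a n‖ = ‖a n‖ := by
  rw [tr, norm_mul, norm_exp_I_mul, one_mul]

theorem norm_dqSymbol_le (h : ℝ) (n : ℤ) : ‖dqSymbol h n‖ ≤ 2 / |h| := by
  rw [dqSymbol, norm_div, Complex.norm_real, Real.norm_eq_abs]
  gcongr
  refine (norm_sub_le _ _).trans ?_
  rw [norm_exp_I_mul, norm_one]; norm_num

theorem norm_dqSymbol_le_abs (h : ℝ) (n : ℤ) : ‖dqSymbol h n‖ ≤ |(n : ℝ)| := by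
  rw [dqSymbol, norm_div, Complex.norm_real, Real.norm_eq_abs]
  refine div_le_of_le_mul₀ (abs_nonneg _) (abs_nonneg _) ?_
  have := Real.norm_exp_I_mul_ofReal_sub_one_le (x := n * h)
  rw [Real.norm_eq_abs, abs_mul] at this
  refine le_trans (le_of_eq ?_) this
  congr 3
  push_cast; ring

theorem norm_dq_le (h : ℝ) (a : ℤ → ℂ) (n : ℤ) : ‖dq h a n‖ ≤ ‖Ds a n‖ := by
  rw [dq, norm_mul, norm_Ds]
  gcongr
  exact norm_dqSymbol_le_abs h n

theorem tendsto_dqSymbol (n : ℤ) :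
    Tendsto (fun h => dqSymbol h n) (𝓝[≠] 0) (𝓝 (Complex.I * n)) := by
  have h1 : HasDerivAt (fun h : ℝ => Complex.exp (Complex.I * n * h)) (Complex.I * n) 0 := by
    have := (((hasDerivAt_id (0 : ℝ)).ofReal_comp.const_mul (Complex.I * n)).cexp)
    simpa using this
  refine h1.tendsto_slope.congr fun h => ?_
  rw [slope_def_module, dqSymbol]
  simp only [sub_zero, Complex.ofReal_zero, mul_zero, Complex.exp_zero, Complex.real_smul,
    Complex.ofReal_inv]
  rw [div_eq_inv_mul]

/-- The discrete product rule: one of the two factors is translated. -/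
theorem dq_conv {h : ℝ} {α β : ℤ → ℂ} (hα : Sq α) (hβ : Sq β) (n : ℤ) :
    dq h (conv α β) n = conv (dq h α) (tr h β) n + conv α (dq h β) n := by
  have s1 : Sq (tr h β) := (hβ.mono fun n => (norm_tr h β n).le).1
  have bound : ∀ {a : ℤ → ℂ}, Sq a → Sq (dq h a) := fun {a} ha =>
    ((ha.const_mul (2 / |h| : ℝ)).1.mono fun n => by
      rw [dq, norm_mul, norm_mul, Complex.norm_real, Real.norm_of_nonneg (by positivity)]
      gcongr
      exact norm_dqSymbol_le h n).1
  rw [dq, conv, conv, conv, ← ((bound hα).conv_summable' s1 n).tsum_add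
    (hα.conv_summable' (bound hβ) n), ← tsum_mul_left]
  refine tsum_congr fun m => ?_
  simp only [dq, tr, dqSymbol]
  have : Complex.exp (Complex.I * n * h) =
      Complex.exp (Complex.I * (n - m : ℤ) * h) * Complex.exp (Complex.I * m * h) := by
    rw [← Complex.exp_add]; congr 1; push_cast; ring
  rw [this]
  ring

theorem SC_tr {a : ℤ → ℂ} (ha : S1 a) (h : ℝ) (θ : Torus) :
    SC (tr h a) θ = SC a (θ + (h : Torus)) := by
  rw [SC_apply ((ha.mono fun n => (norm_tr h a n).le).1), SC_apply ha]
  refine tsum_congr fun n => ?_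
  have := fourier_sub_coe n θ (-h)
  rw [AddCircle.coe_neg, sub_neg_eq_add] at this
  rw [this, tr, show -(Complex.I * n * ((-h : ℝ) : ℂ)) = Complex.I * n * h by push_cast; ring]
  ring

theorem norm_SC_tr_le {a : ℤ → ℂ} (ha : S1 a) (h : ℝ) : ‖SC (tr h a)‖ ≤ ‖SC a‖ := by
  rw [ContinuousMap.norm_le _ (norm_nonneg _)]
  intro θ
  rw [SC_tr ha]
  exact (SC a).norm_coe_le_norm _

/-- The mean value inequality in physical space. For the velocity it bounds the difference quotient
by the maximum of `Hg`, uniformly in the step. -/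
theorem norm_SC_dq_le {a : ℤ → ℂ} (ha : S1 a) (hDa : S1 (Ds a)) (h : ℝ) :
    S1 (dq h a) ∧ ‖SC (dq h a)‖ ≤ ‖SC (Ds a)‖ := by
  have hs : S1 (dq h a) := (hDa.mono (norm_dq_le h a)).1
  refine ⟨hs, ?_⟩
  rw [ContinuousMap.norm_le _ (norm_nonneg _)]
  intro θ
  induction θ using QuotientAddGroup.induction_on with
  | H x =>
  have e : SC (dq h a) (x : Torus) = (SC a ((x + h : ℝ) : Torus) - SC a (x : Torus)) / h := by
    have htr := SC_tr ha h (x : Torus)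
    rw [AddCircle.coe_add, ← htr, SC_apply hs, SC_apply ha,
      SC_apply ((ha.mono fun n => (norm_tr h a n).le).1), ← Summable.tsum_sub, ← tsum_div_const]
    · refine tsum_congr fun n => ?_
      simp only [dq, dqSymbol, tr]; ring
    · refine Summable.of_norm ?_
      simpa only [S1, norm_mul, norm_fourier_apply, mul_one, norm_tr] using ha
    · refine Summable.of_norm ?_
      simpa only [S1, norm_mul, norm_fourier_apply, mul_one] using ha
  have hm := (convex_univ (𝕜 := ℝ) (E := ℝ)).norm_image_sub_le_of_norm_hasDerivWithin_le
    (f := fun y : ℝ => SC a (y : Torus)) (f' := fun y : ℝ => SC (Ds a) (y : Torus))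
    (C := ‖SC (Ds a)‖) (fun y _ => (hasDerivAt_SC ha hDa y).hasDerivWithinAt)
    (fun y _ => (SC (Ds a)).norm_coe_le_norm _) (mem_univ x) (mem_univ (x + h))
  rw [add_sub_cancel_left, Real.norm_eq_abs] at hm
  change ‖SC (dq h a) (x : Torus)‖ ≤ _
  rw [e, norm_div, Complex.norm_real, Real.norm_eq_abs]
  exact div_le_of_le_mul₀ (abs_nonneg _) (norm_nonneg _) hm

theorem tendsto_N2_dq {a : ℤ → ℂ} (ha : Sq (Ds a)) :
    Tendsto (fun h => N2 (dq h a) ^ 2) (𝓝[≠] 0) (𝓝 (N2 (Ds a) ^ 2)) := by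
  simp only [N2_sq]
  refine tendsto_tsum_of_dominated_convergence (bound := fun n => ‖Ds a n‖ ^ 2) ha (fun n => ?_) ?_
  · have := ((tendsto_dqSymbol n).mul_const (a n)).norm.pow 2
    exact this
  · refine Eventually.of_forall fun h n => ?_
    rw [Real.norm_of_nonneg (by positivity)]
    exact pow_le_pow_left₀ (norm_nonneg _) (norm_dq_le h a n) 2

/-! ### Energy estimates with the maximum norms -/

/-- The sum of the maximum norms of `f`, `g`, `Hf` and `Hg`. -/
def maxSum (f g : ℤ → ℂ) : ℝ := ‖SC f‖ + ‖SC g‖ + ‖SC (Hs f)‖ + ‖SC (Hs g)‖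

theorem maxSum_comm (f g : ℤ → ℂ) : maxSum g f = maxSum f g := by rw [maxSum, maxSum]; ring

theorem maxSum_nonneg (f g : ℤ → ℂ) : 0 ≤ maxSum f g := by rw [maxSum]; positivity

theorem InH.Ds_sq {a : ℤ → ℂ} (ha : InH 1 a) : Sq (MHD.Ds a) := by
  simpa only [InH, W_zero] using (InH.Ds (k := 0) ha).1

theorem InH.us_S1 {g : ℤ → ℂ} (hg : InH 1 g) : S1 (MHD.us g) ∧ S1 (MHD.Ds (MHD.us g)) :=
  ⟨(MHD.us_S1 hg.sq.1).1, by rw [Ds_us]; exact hg.s1.1.Hs.1⟩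

theorem abs_ip_transport_le_norm_SC {g F : ℤ → ℂ} (hg : InH 1 g) (hsym : Sym g) (hF : InH 1 F) :
    |ip F (conv (us g) (Ds F))| ≤ ‖SC (Hs g)‖ * N2 F ^ 2 := by
  rw [ip_transport hg.us_S1.1 hg.us_S1.2 hsym.us hF, Ds_us, abs_mul]
  have h1 := abs_ip_le hF.sq.1 (young hg.s1.1.Hs.1 hF.sq.1).1
  have h2 := N2_conv_le_norm_SC hg.s1.1.Hs.1 hF.sq.1
  have h3 := mul_le_mul_of_nonneg_left h2 (N2_nonneg F)
  have h4 := abs_nonneg (ip F (conv (Hs g) F))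
  rw [abs_neg, abs_of_pos (by norm_num : (0 : ℝ) < 1 / 2)]
  nlinarith

theorem ip_comb {F A B C : ℤ → ℂ} (hF : Sq F) (hA : Sq A) (hB : Sq B) (hC : Sq C) (p q a : ℝ) :
    ip F (fun n => p * A n + q * B n - a * C n) = p * ip F A + q * ip F B - a * ip F C := by
  have h1 := ip_add hF ((hA.const_mul (p : ℂ)).1.add (hB.const_mul (q : ℂ)).1).1
    (hC.const_mul ((-a : ℝ) : ℂ)).1
  rw [ip_add hF (hA.const_mul (p : ℂ)).1 (hB.const_mul (q : ℂ)).1, ip_const_mul, ip_const_mul,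
    ip_const_mul] at h1
  rw [show p * ip F A + q * ip F B - a * ip F C = p * ip F A + q * ip F B + -a * ip F C by ring,
    ← h1]
  congr 1
  funext n
  push_cast; ring

theorem abs_comb_le {x y z X M : ℝ} (p q a : ℝ) (hx : |x| ≤ M * X) (hy : |y| ≤ M * X)
    (hz : |z| ≤ M * X) : p * x + q * y - a * z ≤ (|p| + |q| + |a|) * (M * X) := by
  have h1 : p * x ≤ |p| * (M * X) := (le_abs_self _).trans (by rw [abs_mul]; gcongr)
  have h2 : q * y ≤ |q| * (M * X) := (le_abs_self _).trans (by rw [abs_mul]; gcongr)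
  have h3 : -(a * z) ≤ |a| * (M * X) := (neg_le_abs _).trans (by rw [abs_mul]; gcongr)
  linarith

theorem ip_nl_le (a p q : ℝ) {f g : ℤ → ℂ} (hf : InH 1 f) (hg : InH 1 g) (hsym : Sym g) :
    ip f (nl a p q f g) ≤ (|p| + |q| + |a|) * (maxSum f g * (N2 f * (N2 f + N2 g))) := by
  have hA := young hg.s1.1.Hs.1 hf.sq.1
  have hB := young hf.s1.1.Hs.1 hg.sq.1
  have hC := young hg.us_S1.1 hf.Ds_sq
  have e : ip f (nl a p q f g) = _ := ip_comb hf.sq.1 hA.1 hB.1 hC.1 p q a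
  rw [e]
  have n1 := norm_nonneg (SC f)
  have n2 := norm_nonneg (SC g)
  have n3 := norm_nonneg (SC (Hs f))
  have n4 := norm_nonneg (SC (Hs g))
  have m1 := N2_nonneg f
  have m2 := N2_nonneg g
  have hM := maxSum_nonneg f g
  have l1 : ‖SC (Hs g)‖ ≤ maxSum f g := by rw [maxSum]; linarith
  have l2 : ‖SC (Hs f)‖ ≤ maxSum f g := by rw [maxSum]; linarith
  refine abs_comb_le p q a ?_ ?_ ?_
  · calc _ ≤ N2 f * (‖SC (Hs g)‖ * N2 f) := (abs_ip_le hf.sq.1 hA.1).trans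
          (mul_le_mul_of_nonneg_left (N2_conv_le_norm_SC hg.s1.1.Hs.1 hf.sq.1) m1)
      _ ≤ N2 f * (maxSum f g * (N2 f + N2 g)) := by gcongr; linarith
      _ = _ := by ring
  · calc _ ≤ N2 f * (‖SC (Hs f)‖ * N2 g) := (abs_ip_le hf.sq.1 hB.1).trans
          (mul_le_mul_of_nonneg_left (N2_conv_le_norm_SC hf.s1.1.Hs.1 hg.sq.1) m1)
      _ ≤ N2 f * (maxSum f g * (N2 f + N2 g)) := by gcongr; linarith
      _ = _ := by ring
  · calc _ ≤ ‖SC (Hs g)‖ * N2 f ^ 2 := abs_ip_transport_le_norm_SC hg hsym hf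
      _ = N2 f * (‖SC (Hs g)‖ * N2 f) := by ring
      _ ≤ N2 f * (maxSum f g * (N2 f + N2 g)) := by gcongr; linarith
      _ = _ := by ring

theorem InH.dq {k : ℕ} {a : ℤ → ℂ} (ha : InH k a) {h : ℝ} : InH k (MHD.dq h a) := by
  have : InH k fun n => ((2 / |h| : ℝ) : ℂ) * a n := by
    have := (Sq.const_mul ha ((2 / |h| : ℝ) : ℂ)).1
    refine this.mono (fun n => ?_) |>.1
    simp only [W]
    rw [mul_left_comm]
  refine (this.of_norm_le fun n => ?_).1
  rw [MHD.dq, norm_mul, norm_mul, Complex.norm_real, Real.norm_of_nonneg (by positivity)]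
  gcongr
  exact norm_dqSymbol_le h n

/-- The product rule for difference quotients, in `ℓ²`. -/
theorem N2_dq_conv_le {α β : ℤ → ℂ} (hα : InH 1 α) (hβ : InH 1 β) (h : ℝ) :
    Sq (dq h (conv α β)) ∧
      N2 (dq h (conv α β)) ≤ ‖SC β‖ * N2 (Ds α) + ‖SC α‖ * N2 (Ds β) := by
  have e : dq h (conv α β) = fun n => conv (dq h α) (tr h β) n + conv α (dq h β) n := by
    funext n; exact dq_conv hα.sq.1 hβ.sq.1 n
  have dα := hα.Ds_sq.mono (norm_dq_le h α)
  have dβ := hβ.Ds_sq.mono (norm_dq_le h β)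
  have tβ : S1 (tr h β) := (hβ.s1.1.mono fun n => (norm_tr h β n).le).1
  have y1 := young tβ dα.1
  have y2 := young hα.s1.1 dβ.1
  rw [e, conv_comm (dq h α)]
  refine ⟨(y1.1.add y2.1).1, (y1.1.add y2.1).2.trans (add_le_add ?_ ?_)⟩
  · exact (N2_conv_le_norm_SC tβ dα.1).trans
      (mul_le_mul (norm_SC_tr_le hβ.s1.1 h) dα.2 (N2_nonneg _) (norm_nonneg _))
  · exact (N2_conv_le_norm_SC hα.s1.1 dβ.1).trans
      (mul_le_mul_of_nonneg_left dβ.2 (norm_nonneg _))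

theorem N2_Ds_Hs_le {a : ℤ → ℂ} (ha : InH 1 a) : N2 (Ds (Hs a)) ≤ N2 (Ds a) := by
  refine (ha.Ds_sq.mono fun n => ?_).2
  rw [norm_Ds, norm_Ds]
  gcongr
  exact norm_Hs_le a n

/-- The estimate of the differentiated equation for functions merely in `H¹`, uniform in the step.
The transport term splits into a difference quotient of the velocity, bounded by the maximum of
`Hg`, and transport of `dq h f`, which is in `H¹` and hence open to skew symmetry. -/
theorem ip_dq_nl_le (a p q : ℝ) {f g : ℤ → ℂ} (hf : InH 1 f) (hg : InH 1 g) (hsym : Sym g) (h : ℝ) :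
    ip (dq h f) (dq h (nl a p q f g)) ≤
      (|p| + |q| + |a|) * (maxSum f g * (2 * (N2 (Ds f) * (N2 (Ds f) + N2 (Ds g))))) := by
  have hA := N2_dq_conv_le hg.Hs.1 hf h
  have hB := N2_dq_conv_le hf.Hs.1 hg h
  have hdf := hf.Ds_sq.mono (norm_dq_le h f)
  have hdu := norm_SC_dq_le hg.us_S1.1 hg.us_S1.2 h
  rw [Ds_us] at hdu
  have trD : Sq (tr h (Ds f)) ∧ N2 (tr h (Ds f)) ≤ N2 (Ds f) :=
    hf.Ds_sq.mono fun n => (norm_tr h (Ds f) n).le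
  have eC : dq h (conv (us g) (Ds f)) =
      fun n => conv (dq h (us g)) (tr h (Ds f)) n + conv (us g) (Ds (dq h f)) n := by
    funext n
    rw [dq_conv hg.us_S1.1.sq hf.Ds_sq n]
    congr 2
    funext m
    simp only [dq, Ds]; ring
  have y1 := young hdu.1 trD.1
  have y2 := young hg.us_S1.1 (hf.dq (h := h)).Ds_sq
  have hC : Sq (dq h (conv (us g) (Ds f))) := by rw [eC]; exact (y1.1.add y2.1).1
  have e : dq h (nl a p q f g) = fun n => p * dq h (conv (Hs g) f) n +
      q * dq h (conv (Hs f) g) n - a * dq h (conv (us g) (Ds f)) n := by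
    funext n; simp only [dq, nl]; ring
  rw [e, ip_comb hdf.1 hA.1 hB.1 hC p q a]
  have n1 := norm_nonneg (SC f)
  have n2 := norm_nonneg (SC g)
  have n3 := norm_nonneg (SC (Hs f))
  have n4 := norm_nonneg (SC (Hs g))
  have m1 := N2_nonneg (Ds f)
  have m2 := N2_nonneg (Ds g)
  have m3 := N2_nonneg (dq h f)
  have hM := maxSum_nonneg f g
  have l1 : ‖SC (Hs g)‖ ≤ maxSum f g := by rw [maxSum]; linarith
  have l2 : ‖SC (Hs f)‖ ≤ maxSum f g := by rw [maxSum]; linarith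
  have l3 : ‖SC f‖ ≤ maxSum f g := by rw [maxSum]; linarith
  have l4 : ‖SC g‖ ≤ maxSum f g := by rw [maxSum]; linarith
  have hHf := N2_Ds_Hs_le hf
  have hHg := N2_Ds_Hs_le hg
  have hX : 0 ≤ maxSum f g * (N2 (Ds f) * (N2 (Ds f) + N2 (Ds g))) := by positivity
  refine abs_comb_le p q a ?_ ?_ ?_
  · calc _ ≤ N2 (dq h f) * N2 (dq h (conv (Hs g) f)) := abs_ip_le hdf.1 hA.1
      _ ≤ N2 (Ds f) * (maxSum f g * N2 (Ds g) + maxSum f g * N2 (Ds f)) := by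
        refine mul_le_mul hdf.2 (hA.2.trans (add_le_add ?_ ?_)) (N2_nonneg _) m1
        · exact mul_le_mul l3 hHg (N2_nonneg _) hM
        · exact mul_le_mul_of_nonneg_right l1 m1
      _ ≤ _ := by linarith
  · calc _ ≤ N2 (dq h f) * N2 (dq h (conv (Hs f) g)) := abs_ip_le hdf.1 hB.1
      _ ≤ N2 (Ds f) * (maxSum f g * N2 (Ds f) + maxSum f g * N2 (Ds g)) := by
        refine mul_le_mul hdf.2 (hB.2.trans (add_le_add ?_ ?_)) (N2_nonneg _) m1
        · exact mul_le_mul l4 hHf (N2_nonneg _) hM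
        · exact mul_le_mul_of_nonneg_right l2 m2
      _ ≤ _ := by linarith
  · rw [eC, ip_add hdf.1 y1.1 y2.1]
    have t1 : |ip (dq h f) (conv (dq h (us g)) (tr h (Ds f)))| ≤
        N2 (Ds f) * (maxSum f g * N2 (Ds f)) :=
      (abs_ip_le hdf.1 y1.1).trans (mul_le_mul hdf.2
        ((N2_conv_le_norm_SC hdu.1 trD.1).trans (mul_le_mul (hdu.2.trans l1) trD.2
          (N2_nonneg _) hM)) (N2_nonneg _) m1)
    have t2 : |ip (dq h f) (conv (us g) (Ds (dq h f)))| ≤ maxSum f g * N2 (Ds f) ^ 2 :=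
      (abs_ip_transport_le_norm_SC hg hsym hf.dq).trans
        (mul_le_mul l1 (pow_le_pow_left₀ m3 hdf.2 2) (by positivity) hM)
    have t3 : 0 ≤ maxSum f g * (N2 (Ds f) * N2 (Ds g)) := by positivity
    refine (abs_add_le _ _).trans ((add_le_add t1 t2).trans ?_)
    nlinarith

/-! ### Growth of the `H¹` energy in terms of the maximum norms. -/

section Growth

/-- The square of the `ℓ²` norm of a multiplier applied to an `ℓ²`-differentiable curve. -/
theorem hasDerivAt_N2_sq {μ : ℤ → ℂ} {B : ℝ} (hμ : ∀ n, ‖μ n‖ ≤ B) {F : ℝ → ℤ → ℂ} {G : ℤ → ℂ}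
    {t : ℝ} (hF : ∀ᶠ s in 𝓝 t, Sq (F s)) (hG : Sq G)
    (hd : ∀ ε > 0, ∀ᶠ s in 𝓝 t, N2 (fun n => F s n - F t n - (s - t : ℝ) * G n) ≤ ε * |s - t|) :
    HasDerivAt (fun s => N2 (fun n => μ n * F s n) ^ 2)
      (2 * ip (fun n => μ n * F t n) (fun n => μ n * G n)) t := by
  have hB : 0 ≤ B := (norm_nonneg _).trans (hμ 0)
  have mul : ∀ {a : ℤ → ℂ}, Sq a → Sq (fun n => μ n * a n) ∧ N2 (fun n => μ n * a n) ≤ B * N2 a :=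
    fun {a} ha => by
    obtain ⟨h1, h2⟩ := ha.const_mul (B : ℂ)
    rw [Complex.norm_real, Real.norm_of_nonneg hB] at h2
    rw [← h2]
    refine h1.mono fun n => ?_
    rw [norm_mul, norm_mul, Complex.norm_real, Real.norm_of_nonneg hB]
    gcongr
    exact hμ n
  have hFt : Sq (F t) := hF.self_of_nhds
  set A : ℤ → ℂ := fun n => μ n * F t n with hA
  set G' : ℤ → ℂ := fun n => μ n * G n with hG'
  obtain ⟨sA, -⟩ := mul hFt
  obtain ⟨sG, -⟩ := mul hG
  rw [hasDerivAt_iff_isLittleO, Asymptotics.isLittleO_iff]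
  intro c hc
  set K := 2 * N2 A * B + 1 with hK
  have hKpos : 0 < K := by have := N2_nonneg A; positivity
  set L := (N2 G' + B) ^ 2 + 1 with hL
  have hLpos : 0 < L := by positivity
  have hε : 0 < min 1 (c / (2 * K)) := by positivity
  have hball : ∀ᶠ s in 𝓝 t, |s - t| < c / (2 * L) := by
    filter_upwards [Metric.ball_mem_nhds t (show 0 < c / (2 * L) by positivity)] with s hs
    rwa [Metric.mem_ball, Real.dist_eq] at hs
  filter_upwards [hF, hd _ hε, hball] with s hFs hs hst
  set R : ℤ → ℂ := fun n => μ n * (F s n - F t n - (s - t : ℝ) * G n) with hR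
  have hsub : Sq (fun n => F s n - F t n - (s - t : ℝ) * G n) :=
    ((hFs.sub hFt).1.sub (hG.const_mul ((s - t : ℝ) : ℂ)).1).1
  obtain ⟨sR, nR⟩ := mul hsub
  have sG2 := sG.const_mul ((s - t : ℝ) : ℂ)
  have sD := sG2.1.add sR
  have e : (fun n => μ n * F s n) = fun n => A n + (((s - t : ℝ) : ℂ) * G' n + R n) := by
    funext n; simp only [hA, hG', hR]; ring
  rw [e, N2_add_sq sA sD.1, ip_add sA sG2.1 sR, ip_const_mul, smul_eq_mul, Real.norm_eq_abs,
    Real.norm_eq_abs]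
  have n0 := N2_nonneg A
  have n1 := N2_nonneg G'
  have hst0 := abs_nonneg (s - t)
  have r1 : N2 R ≤ B * (min 1 (c / (2 * K)) * |s - t|) :=
    nR.trans (mul_le_mul_of_nonneg_left hs hB)
  have i1 := (abs_ip_le sA sR).trans (mul_le_mul_of_nonneg_left r1 n0)
  have d1 : N2 (fun n => ((s - t : ℝ) : ℂ) * G' n + R n) ≤ (N2 G' + B) * |s - t| := by
    refine sD.2.trans ?_
    rw [sG2.2, Complex.norm_real, Real.norm_eq_abs]
    have : B * (min 1 (c / (2 * K)) * |s - t|) ≤ B * (1 * |s - t|) := by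
      gcongr; exact min_le_left _ _
    linarith
  have d2 : N2 (fun n => ((s - t : ℝ) : ℂ) * G' n + R n) ^ 2 ≤ c / 2 * |s - t| := by
    calc _ ≤ ((N2 G' + B) * |s - t|) ^ 2 := pow_le_pow_left₀ (N2_nonneg _) d1 2
      _ = ((N2 G' + B) ^ 2 * |s - t|) * |s - t| := by ring
      _ ≤ (L * (c / (2 * L))) * |s - t| := by
        gcongr
        rw [hL]; linarith
      _ = _ := by field_simp
  have d3 : 2 * (N2 A * (B * (min 1 (c / (2 * K)) * |s - t|))) ≤ c / 2 * |s - t| := by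
    calc _ = (2 * N2 A * B) * min 1 (c / (2 * K)) * |s - t| := by ring
      _ ≤ K * (c / (2 * K)) * |s - t| := by
        gcongr
        · rw [hK]; linarith
        · exact min_le_right _ _
      _ = _ := by field_simp
  have d4 := sq_nonneg (N2 fun n => ((s - t : ℝ) : ℂ) * G' n + R n)
  have i2 := abs_le.1 i1
  have : (fun n => μ n * F t n) = A := rfl
  rw [this]
  rw [abs_le]
  constructor <;> linarith [i2.1, i2.2]

/-- The `H¹` energy without weights. -/
def enH (f g : ℤ → ℂ) : ℝ := N2 f ^ 2 + N2 g ^ 2 + N2 (Ds f) ^ 2 + N2 (Ds g) ^ 2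

theorem enH_nonneg (f g : ℤ → ℂ) : 0 ≤ enH f g := by rw [enH]; positivity

/-- The growth constant of the energy. -/
def growth (a p q : ℝ) : ℝ := 8 * (|p| + |q| + |a|)

theorem growth_nonneg (a p q : ℝ) : 0 ≤ growth a p q := by rw [growth]; positivity

variable {a p q ρ : ℝ} {f g : ℝ → ℤ → ℂ} {α β : ℝ}

theorem SolOn.swap {S : Set ℤ} {J : Set ℝ} (h : SolOn a p q S J f g) : SolOn a p q S J g f :=
  fun t ht n hn => (h t ht n hn).symm

theorem BddOn.swap {k : ℕ} {J : Set ℝ} (h : BddOn k ρ J f g) : BddOn k ρ J g f :=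
  fun t ht => (h t ht).symm

theorem hasDerivAt_N2_sq_sol (hsol : SolOn a p q univ (Ioo α β) f g)
    (hb : BddOn 1 ρ (Ioo α β) f g) {t : ℝ} (ht : t ∈ Ioo α β) {μ : ℤ → ℂ} {B : ℝ}
    (hμ : ∀ n, ‖μ n‖ ≤ B) :
    HasDerivAt (fun s => N2 (fun n => μ n * f s n) ^ 2)
      (2 * ip (fun n => μ n * f t n) (fun n => μ n * nl a p q (f t) (g t) n)) t :=
  hasDerivAt_N2_sq hμ (by
    filter_upwards [isOpen_Ioo.mem_nhds ht] with s hs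
    exact (hb s hs).1.1.sq.1) (nl_sq a p q (hb t ht).1.1 (hb t ht).2.1).1
    fun ε hε => eventually_N2_sub_sub_le hsol hb ht hε

theorem continuousOn_of_tendsto_W {Φ : (ℤ → ℂ) → ℝ} {C : ℝ}
    (hΦ : ∀ a b, InH 1 a → InH 1 b → |Φ a - Φ b| ≤ C * N2 (W 1 fun n => a n - b n))
    (hsol : SolOn a p q univ (Ioo α β) f g) (hb : BddOn 1 ρ (Ioo α β) f g) :
    ContinuousOn (fun t => Φ (f t)) (Ioo α β) := by
  intro t ht
  refine ContinuousAt.continuousWithinAt ?_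
  have h1 := (tendsto_N2_W_sub hsol hb (k := 1)
    (fun t ht => ⟨(hb t ht).1.1, (hb t ht).2.1⟩) ht).1.const_mul C
  rw [mul_zero] at h1
  rw [ContinuousAt, tendsto_iff_norm_sub_tendsto_zero]
  refine squeeze_zero' (Eventually.of_forall fun _ => norm_nonneg _) ?_ h1
  filter_upwards [isOpen_Ioo.mem_nhds ht] with s hs
  exact hΦ _ _ (hb s hs).1.1 (hb t ht).1.1

theorem abs_N2_sub_le {a b : ℤ → ℂ} (ha : Sq a) (hb : Sq b) :
    |N2 a - N2 b| ≤ N2 fun n => a n - b n := by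
  have h1 := ((ha.sub hb).1.add hb).2
  have h2 := ((ha.sub hb).1.neg.1.add ha).2
  rw [(ha.sub hb).1.neg.2] at h2
  simp only [sub_add_cancel, neg_sub] at h1 h2
  rw [abs_le]
  constructor <;> linarith

theorem continuousOn_energy (hsol : SolOn a p q univ (Ioo α β) f g)
    (hb : BddOn 1 ρ (Ioo α β) f g) : ContinuousOn (fun t => enH (f t) (g t)) (Ioo α β) := by
  have h1 : ∀ a b, InH 1 a → InH 1 b → |N2 a - N2 b| ≤ 1 * N2 (W 1 fun n => a n - b n) :=
    fun a b ha hb => by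
    rw [one_mul]
    exact (abs_N2_sub_le ha.sq.1 hb.sq.1).trans (ha.sub hb).1.sq.2
  have h2 : ∀ a b, InH 1 a → InH 1 b → |N2 (Ds a) - N2 (Ds b)| ≤ 1 * N2 (W 1 fun n => a n - b n) :=
    fun a b ha hb => by
    rw [one_mul]
    refine (abs_N2_sub_le ha.Ds_sq hb.Ds_sq).trans ?_
    refine (Sq.mono (ha.sub hb).1 fun n => ?_).2
    rw [show Ds a n - Ds b n = Ds (fun n => a n - b n) n by simp only [Ds]; ring]
    exact norm_Ds_le _ _
  simp only [enH]
  exact ((((continuousOn_of_tendsto_W h1 hsol hb).pow 2).add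
    ((continuousOn_of_tendsto_W h1 hsol.swap hb.swap).pow 2)).add
    ((continuousOn_of_tendsto_W h2 hsol hb).pow 2)).add
    ((continuousOn_of_tendsto_W h2 hsol.swap hb.swap).pow 2)

theorem abs_norm_SC_sub_le {a b : ℤ → ℂ} (ha : InH 1 a) (hb : InH 1 b) :
    |‖SC a‖ - ‖SC b‖| ≤ kap * N2 (W 1 fun n => a n - b n) := by
  refine (abs_norm_sub_norm_le _ _).trans ?_
  rw [← SC_sub ha.s1.1 hb.s1.1]
  have := (ha.sub hb).1.s1
  exact (norm_SC_le this.1).trans this.2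

theorem continuousOn_maxSum (hsol : SolOn a p q univ (Ioo α β) f g)
    (hb : BddOn 1 ρ (Ioo α β) f g) : ContinuousOn (fun t => maxSum (f t) (g t)) (Ioo α β) := by
  have h2 : ∀ a b, InH 1 a → InH 1 b →
      |‖SC (Hs a)‖ - ‖SC (Hs b)‖| ≤ kap * N2 (W 1 fun n => a n - b n) := fun a b ha hb => by
    refine (abs_norm_SC_sub_le ha.Hs.1 hb.Hs.1).trans ?_
    refine mul_le_mul_of_nonneg_left ?_ kap_nonneg
    have e : (fun n => Hs a n - Hs b n) = Hs fun n => a n - b n := by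
      funext n; simp only [Hs]; ring
    rw [e]
    exact (ha.sub hb).1.Hs.2
  have h1 : ∀ a b, InH 1 a → InH 1 b →
      |‖SC a‖ - ‖SC b‖| ≤ kap * N2 (W 1 fun n => a n - b n) := fun a b => abs_norm_SC_sub_le
  simp only [maxSum]
  exact (((continuousOn_of_tendsto_W h1 hsol hb).add
    (continuousOn_of_tendsto_W h1 hsol.swap hb.swap)).add
    (continuousOn_of_tendsto_W h2 hsol hb)).add
    (continuousOn_of_tendsto_W h2 hsol.swap hb.swap)

/-- For fixed step `h` the energy with difference quotients is differentiable in time, since its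
multipliers are bounded. Its increment is at most an integral independent of `h`, and `h → 0`
recovers the `H¹` energy. -/
theorem energy_le_add_integral (hsol : SolOn a p q univ (Ioo α β) f g)
    (hb : BddOn 1 ρ (Ioo α β) f g) {s t : ℝ} (hs : s ∈ Ioo α β) (ht : t ∈ Ioo α β) (hst : s ≤ t) :
    enH (f t) (g t) ≤ enH (f s) (g s) +
      ∫ r in s..t, growth a p q * maxSum (f r) (g r) * enH (f r) (g r) := by
  have hsub : Icc s t ⊆ Ioo α β := fun r hr => ⟨hs.1.trans_le hr.1, hr.2.trans_lt ht.2⟩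
  have hint : IntegrableOn (fun r => growth a p q * maxSum (f r) (g r) * enH (f r) (g r))
      (Icc s t) :=
    (((continuousOn_const.mul (continuousOn_maxSum hsol hb)).mul
      (continuousOn_energy hsol hb)).mono hsub).integrableOn_compact isCompact_Icc
  have one : ∀ n : ℤ, ‖(1 : ℂ)‖ ≤ 1 := fun _ => by simp
  let y : ℝ → ℝ → ℝ := fun h r =>
    N2 (f r) ^ 2 + N2 (g r) ^ 2 + N2 (dq h (f r)) ^ 2 + N2 (dq h (g r)) ^ 2
  have hy : ∀ h, y h t - y h s ≤
      ∫ r in s..t, growth a p q * maxSum (f r) (g r) * enH (f r) (g r) := fun h => by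
    have hd : ∀ r ∈ Ioo α β, HasDerivAt (y h) (2 * ip (f r) (nl a p q (f r) (g r)) +
        2 * ip (g r) (nl a p q (g r) (f r)) +
        2 * ip (dq h (f r)) (dq h (nl a p q (f r) (g r))) +
        2 * ip (dq h (g r)) (dq h (nl a p q (g r) (f r)))) r := fun r hr => by
      have h1 := hasDerivAt_N2_sq_sol hsol hb hr one
      have h2 := hasDerivAt_N2_sq_sol hsol.swap hb.swap hr one
      have h3 := hasDerivAt_N2_sq_sol hsol hb hr (norm_dqSymbol_le h)
      have h4 := hasDerivAt_N2_sq_sol hsol.swap hb.swap hr (norm_dqSymbol_le h)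
      simp only [one_mul] at h1 h2
      exact ((h1.add h2).add h3).add h4
    refine intervalIntegral.sub_le_integral_of_hasDeriv_right_of_le hst
      (fun r hr => (hd r (hsub hr)).continuousAt.continuousWithinAt)
      (fun r hr => (hd r (hsub (Ioo_subset_Icc_self hr))).hasDerivWithinAt) hint fun r hr => ?_
    obtain ⟨⟨f1, -, f2⟩, g1, -, g2⟩ := hb r (hsub (Ioo_subset_Icc_self hr))
    have b1 := ip_nl_le a p q f1 g1 g2
    have b2 := ip_nl_le a p q g1 f1 f2
    have b3 := ip_dq_nl_le a p q f1 g1 g2 h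
    have b4 := ip_dq_nl_le a p q g1 f1 f2 h
    rw [maxSum_comm] at b2 b4
    have hM : 0 ≤ (|p| + |q| + |a|) * maxSum (f r) (g r) :=
      mul_nonneg (by positivity) (maxSum_nonneg _ _)
    have q1 := mul_le_mul_of_nonneg_left (sq_nonneg (N2 (f r) - N2 (g r))) hM
    have q2 := mul_le_mul_of_nonneg_left (sq_nonneg (N2 (Ds (f r)) - N2 (Ds (g r)))) hM
    have q3 := mul_nonneg hM (sq_nonneg (N2 (f r)))
    have q4 := mul_nonneg hM (sq_nonneg (N2 (g r)))
    rw [growth, enH]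
    nlinarith
  have hlim : ∀ r ∈ Ioo α β, Tendsto (fun h => y h r) (𝓝[≠] 0) (𝓝 (enH (f r) (g r))) :=
    fun r hr => (tendsto_const_nhds.add (tendsto_N2_dq (hb r hr).1.1.Ds_sq)).add
      (tendsto_N2_dq (hb r hr).2.1.Ds_sq)
  have := le_of_tendsto ((hlim t ht).sub (hlim s hs)) (Eventually.of_forall hy)
  linarith

/-- Gronwall's inequality in integral form with a continuous rate. -/
theorem gronwall_integral {E m : ℝ → ℝ} {s t : ℝ} (hs : s ∈ Ioo α β) (ht : t ∈ Ioo α β)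
    (hst : s ≤ t) (hE : ContinuousOn E (Ioo α β)) (hm : ContinuousOn m (Ioo α β))
    (hm0 : ∀ r ∈ Ioo α β, 0 ≤ m r)
    (h : ∀ r ∈ Icc s t, E r ≤ E s + ∫ x in s..r, m x * E x) :
    E t ≤ E s * Real.exp (∫ x in s..t, m x) := by
  have hsub : Icc s t ⊆ Ioo α β := fun r hr => ⟨hs.1.trans_le hr.1, hr.2.trans_lt ht.2⟩
  have ftc : ∀ {φ : ℝ → ℝ}, ContinuousOn φ (Ioo α β) → ∀ r ∈ Icc s t,
      HasDerivAt (fun r => ∫ x in s..r, φ x) (φ r) r := fun {φ} hφ r hr => by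
    have hsr : uIcc s r ⊆ Ioo α β := by
      rw [uIcc_of_le hr.1]; exact (Icc_subset_Icc_right hr.2).trans hsub
    exact intervalIntegral.integral_hasDerivAt_right (hφ.mono hsr).intervalIntegrable
      (hφ.stronglyMeasurableAtFilter isOpen_Ioo r (hsub hr))
      (hφ.continuousAt (isOpen_Ioo.mem_nhds (hsub hr)))
  let Z : ℝ → ℝ := fun r => (E s + ∫ x in s..r, m x * E x) * Real.exp (-∫ x in s..r, m x)
  have hZ : ∀ r ∈ Icc s t, HasDerivAt Z (m r * E r * Real.exp (-∫ x in s..r, m x) +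
      (E s + ∫ x in s..r, m x * E x) * (Real.exp (-∫ x in s..r, m x) * -m r)) r := fun r hr =>
    ((ftc (hm.mul hE) r hr).const_add (E s)).mul ((ftc hm r hr).neg.exp)
  have hanti : AntitoneOn Z (Icc s t) := by
    refine antitoneOn_of_deriv_nonpos (convex_Icc s t)
      (fun r hr => (hZ r hr).continuousAt.continuousWithinAt) ?_ ?_
    · intro r hr
      exact (hZ r (interior_subset hr)).differentiableAt.differentiableWithinAt
    · intro r hr
      have hr' := interior_subset hr
      rw [(hZ r hr').deriv]
      have h1 := mul_le_mul_of_nonneg_left (h r hr') (hm0 r (hsub hr'))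
      have h2 := Real.exp_pos (-∫ x in s..r, m x)
      nlinarith
  have h1 := hanti (left_mem_Icc.2 hst) (right_mem_Icc.2 hst) hst
  simp only [Z, intervalIntegral.integral_same, add_zero, neg_zero, Real.exp_zero, mul_one] at h1
  have h2 := h t (right_mem_Icc.2 hst)
  rw [Real.exp_neg, ← div_eq_mul_inv, div_le_iff₀ (Real.exp_pos _)] at h1
  exact h2.trans h1

/-- The `H¹` energy is controlled by the time integral of the maximum norms. -/
theorem energy_le_mul_exp (hsol : SolOn a p q univ (Ioo α β) f g)
    (hb : BddOn 1 ρ (Ioo α β) f g) {s t : ℝ} (hs : s ∈ Ioo α β) (ht : t ∈ Ioo α β) (hst : s ≤ t) :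
    enH (f t) (g t) ≤ enH (f s) (g s) *
      Real.exp (∫ r in s..t, growth a p q * maxSum (f r) (g r)) :=
  gronwall_integral (E := fun t => enH (f t) (g t)) hs ht hst (continuousOn_energy hsol hb)
    (continuousOn_const.mul (continuousOn_maxSum hsol hb))
    (fun _ _ => mul_nonneg (growth_nonneg a p q) (maxSum_nonneg _ _)) fun _ hr =>
    energy_le_add_integral hsol hb hs ⟨hs.1.trans_le hr.1, hr.2.trans_lt ht.2⟩ hr.1

/-- From `(1 + |n|)² ≤ 2 + 2 n²`. -/
theorem N2_W_one_sq_le_energy {f g : ℤ → ℂ} (hf : InH 1 f) (hg : InH 1 g) :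
    N2 (W 1 f) ^ 2 + N2 (W 1 g) ^ 2 ≤ 2 * enH f g := by
  have key : ∀ {a : ℤ → ℂ}, InH 1 a → N2 (W 1 a) ^ 2 ≤ 2 * N2 a ^ 2 + 2 * N2 (Ds a) ^ 2 :=
    fun {a} ha => by
    rw [N2_sq, N2_sq, N2_sq, ← tsum_mul_left, ← tsum_mul_left,
      ← (Summable.mul_left 2 ha.sq.1).tsum_add (Summable.mul_left 2 ha.Ds_sq)]
    refine Summable.tsum_le_tsum (fun n => ?_) ha
      ((Summable.mul_left 2 ha.sq.1).add (Summable.mul_left 2 ha.Ds_sq))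
    rw [norm_W, norm_Ds, wt, pow_one]
    have := mul_nonneg (sq_nonneg (‖a n‖)) (sq_nonneg (1 - |(n : ℝ)|))
    nlinarith
  rw [enH]
  linarith [key hf, key hg]

end Growth

section Solutions

variable {a p q ρ : ℝ} {k : ℕ} {α β : ℝ}

/-! ### From coefficients to functions -/

theorem norm_le_N2 (f : L2) : ‖f‖ ≤ 3 * N2 (cf f) := by
  refine (sq_le_sq₀ (norm_nonneg _) (mul_nonneg (by norm_num) (N2_nonneg _))).1 ?_
  rw [norm_sq_eq, mul_pow]
  exact mul_le_mul_of_nonneg_right (by linarith [Real.pi_lt_four]) (sq_nonneg _)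

theorem Sym.nl {f g : ℤ → ℂ} (hf : Sym f) (hg : Sym g) : Sym (MHD.nl a p q f g) := by
  rw [Sym, ← refl_nl, hf, hg]

theorem exists_hasDerivAt {w z : ℝ → L2}
    (hsol : SolOn a p q univ (Ioo α β) (fun t => cf (w t)) fun t => cf (z t))
    (hb : BddOn 1 ρ (Ioo α β) (fun t => cf (w t)) fun t => cf (z t)) {t : ℝ} (ht : t ∈ Ioo α β) :
    ∃ F : L2, HasDerivAt w F t ∧ F =ᵐ[volume] rhs a p q (w t) (z t) := by
  obtain ⟨⟨hw, -, sw⟩, hz, -, sz⟩ := hb t ht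
  obtain ⟨F, hF⟩ := exists_cf_eq (nl_sq a p q hw hz).1 (sw.nl sz)
  refine ⟨F, ?_, (ae_eq_rhs_iff hw hz a p q F).2 hF⟩
  rw [hasDerivAt_iff_isLittleO, Asymptotics.isLittleO_iff]
  intro c hc
  filter_upwards [eventually_N2_sub_sub_le hsol hb ht (ε := c / 3) (by positivity)] with s hs
  refine (norm_le_N2 _).trans ?_
  rw [cf_sub, cf_sub, cf_smul, hF, Real.norm_eq_abs]
  linarith

theorem tendsto_hNorm_sub {w z : ℝ → L2}
    (hsol : SolOn a p q univ (Ioo α β) (fun t => cf (w t)) fun t => cf (z t))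
    (hb : BddOn 1 ρ (Ioo α β) (fun t => cf (w t)) fun t => cf (z t))
    (hk : ∀ t ∈ Ioo α β, InH k (cf (w t)) ∧ InH k (cf (z t))) {t : ℝ} (ht : t ∈ Ioo α β) :
    Tendsto (fun s => hNorm k (w s - w t)) (𝓝 t) (𝓝 0) := by
  have h1 := (tendsto_N2_W_sub hsol hb hk ht).1.const_mul √((k + 1) * (2 * π))
  rw [mul_zero] at h1
  refine squeeze_zero' (Eventually.of_forall fun _ => hNorm_nonneg _ _) ?_ h1
  filter_upwards [isOpen_Ioo.mem_nhds ht] with s hs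
  have h2 := hNorm_le (k := k) (f := w s - w t) (by
    rw [cf_sub]; exact ((hk s hs).1.sub (hk t ht).1).1)
  rwa [cf_sub] at h2

/-- A solution bounded in `H^{k+1}` is Lipschitz in `H^k`. -/
theorem N2_W_sub_le {f g : ℝ → ℤ → ℂ} (hsol : SolOn a p q univ (Ioo α β) f g)
    {K : ℝ} (hK : 0 ≤ K) (hb : ∀ t ∈ Ioo α β, (InH (k + 1) (f t) ∧ N2 (W (k + 1) (f t)) ≤ K) ∧
      InH (k + 1) (g t) ∧ N2 (W (k + 1) (g t)) ≤ K) {s t : ℝ} (hs : s ∈ Ioo α β)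
    (ht : t ∈ Ioo α β) :
    N2 (W k fun n => f t n - f s n) ≤ Cn a p q * K * K * |t - s| := by
  have hC := Cn_nonneg a p q
  have := (N2_sub_le_of_hasDerivAt (x := fun t => W k (f t))
    (x' := fun t => W k (nl a p q (f t) (g t))) (L := Cn a p q * K * K) (convex_Ioo α β)
    (by positivity) (fun t ht n => (hsol t ht n (mem_univ n)).1.const_mul _) (fun t ht => ?_) hs ht).2
  · refine le_trans (le_of_eq ?_) this
    congr 1; funext n; simp only [W]; ring
  · obtain ⟨⟨h1, h2⟩, h3, h4⟩ := hb t ht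
    obtain ⟨h5, h6⟩ := nl_bound a p q h1 h3
    exact ⟨h5, h6.trans (mul_le_mul (mul_le_mul_of_nonneg_left h2 hC) h4 (N2_nonneg _)
      (by positivity))⟩

/-! ### From solutions to coefficients -/

theorem timeInterval_coe (T : ℝ) : timeInterval (T : EReal) = Ico 0 T := by
  ext t; simp [timeInterval]

theorem SolvesEq.hasDerivAt {T : EReal} {w z : ℝ → L2} (h : SolvesEq a p q T w z) {t : ℝ}
    (hw : InH 1 (cf (w t))) (hz : InH 1 (cf (z t))) (ht : timeInterval T ∈ 𝓝 t) (n : ℤ) :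
    HasDerivAt (fun s => cf (w s) n) (nl a p q (cf (w t)) (cf (z t)) n) t := by
  obtain ⟨F, hF, hae⟩ := h t (mem_of_mem_nhds ht)
  have := (cfL n).hasFDerivAt.comp_hasDerivAt t (hF.hasDerivAt ht)
  rw [cfL_apply, (ae_eq_rhs_iff hw hz a p q F).1 hae] at this
  exact this

theorem IsContH.continuousOn {T : EReal} {w : ℝ → L2} (h : IsContH k T w) :
    ContinuousOn (fun t => N2 (W k (cf (w t)))) (timeInterval T) := by
  intro t ht
  rw [ContinuousWithinAt, tendsto_iff_norm_sub_tendsto_zero]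
  have h1 := (h.2 t ht).const_mul (2 ^ k)
  rw [mul_zero] at h1
  refine squeeze_zero' (Eventually.of_forall fun _ => norm_nonneg _) ?_ h1
  filter_upwards [self_mem_nhdsWithin] with s hs
  have is := memH_iff.1 (h.1 s hs)
  have it := memH_iff.1 (h.1 t ht)
  have h2 := N2_W_le_hNorm (k := k) (f := w s - w t) (by rw [cf_sub]; exact (is.sub it).1)
  refine le_trans ?_ h2
  rw [cf_sub]
  have h3 := abs_N2_sub_le is it
  refine h3.trans (le_of_eq ?_)
  congr 1; funext n; simp only [W]; ring

variable {wp₀ wm₀ : L2} {wp wm : ℝ → L2} {T : ℝ}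

theorem IsSolution.inH (h : IsSolution a p q k wp₀ wm₀ (T : EReal) wp wm) {t : ℝ}
    (ht : t ∈ Ico 0 T) : InH k (cf (wp t)) ∧ InH k (cf (wm t)) := by
  rw [← timeInterval_coe] at ht
  exact ⟨memH_iff.1 (h.cont_p.1 t ht), memH_iff.1 (h.cont_m.1 t ht)⟩

theorem IsSolution.solOn (h : IsSolution a p q k wp₀ wm₀ (T : EReal) wp wm) (hk : 1 ≤ k) :
    SolOn a p q univ (Ioo 0 T) (fun t => cf (wp t)) fun t => cf (wm t) := by
  intro t ht n _
  have hn : timeInterval (T : EReal) ∈ 𝓝 t := by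
    rw [timeInterval_coe]; exact Ico_mem_nhds ht.1 ht.2
  obtain ⟨h1, h2⟩ := h.inH (Ioo_subset_Ico_self ht)
  have h1 := (h1.mono hk).1
  have h2 := (h2.mono hk).1
  exact ⟨h.eq_p.hasDerivAt h1 h2 hn n, h.eq_m.hasDerivAt h2 h1 hn n⟩

theorem IsSolution.exists_bddOn (h : IsSolution a p q k wp₀ wm₀ (T : EReal) wp wm) (hk : 1 ≤ k)
    {b : ℝ} (hb : b < T) :
    ∃ ρ, BddOn 1 ρ (Icc 0 b) (fun t => cf (wp t)) fun t => cf (wm t) := by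
  have hsub : Icc 0 b ⊆ timeInterval (T : EReal) := by
    rw [timeInterval_coe]; exact fun t ht => ⟨ht.1, ht.2.trans_lt hb⟩
  obtain ⟨C, hC⟩ := isCompact_Icc.exists_bound_of_continuousOn (h.cont_p.continuousOn.mono hsub)
  obtain ⟨C', hC'⟩ := isCompact_Icc.exists_bound_of_continuousOn (h.cont_m.continuousOn.mono hsub)
  refine ⟨max C C', fun t ht => ?_⟩
  obtain ⟨i1, i2⟩ := h.inH (timeInterval_coe T ▸ hsub ht)
  have j1 := i1.mono hk
  have j2 := i2.mono hk
  exact ⟨⟨j1.1, j1.2.trans (((le_abs_self _).trans (hC t ht)).trans (le_max_left _ _)), cf_sym _⟩,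
    j2.1, j2.2.trans (((le_abs_self _).trans (hC' t ht)).trans (le_max_right _ _)), cf_sym _⟩

theorem ofReal_maxSum_le {f g : L2} (hf : InH 1 (cf f)) (hg : InH 1 (cf g)) :
    ENNReal.ofReal (maxSum (cf f) (cf g)) ≤
      supNorm f + supNorm g + supNorm (hilbert f) + supNorm (hilbert g) := by
  rw [maxSum, ENNReal.ofReal_add (by positivity) (by positivity),
    ENNReal.ofReal_add (by positivity) (by positivity),
    ENNReal.ofReal_add (by positivity) (by positivity)]
  have h1 := ofReal_norm_SC_le hf
  have h2 := ofReal_norm_SC_le hg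
  exact add_le_add (add_le_add (add_le_add h1.1 h2.1) h1.2) h2.2

/-- If the maximum norms are integrable in time, then the solution is bounded in `H¹`. -/
theorem IsSolution.exists_bound (h : IsSolution a p q k wp₀ wm₀ (T : EReal) wp wm) (hk : 1 ≤ k)
    (hfin : ∫⁻ t in timeInterval (T : EReal), (supNorm (wp t) + supNorm (wm t) +
      supNorm (hilbert (wp t)) + supNorm (hilbert (wm t))) ≠ ⊤) :
    ∃ R > 0, ∀ t ∈ Ico (T / 2) T,
      N2 (W 1 (cf (wp t))) ^ 2 + N2 (W 1 (cf (wm t))) ^ 2 ≤ R := by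
  have hT : 0 < T := by exact_mod_cast h.pos
  set I := ∫⁻ t in timeInterval (T : EReal), (supNorm (wp t) + supNorm (wm t) +
      supNorm (hilbert (wp t)) + supNorm (hilbert (wm t))) with hI
  have hE := enH_nonneg (cf (wp (T / 2))) (cf (wm (T / 2)))
  have hg := growth_nonneg a p q
  -- Time starts at `T / 2` because the coefficient equations hold with two-sided derivatives only
  -- for positive times. The final `1` makes the bound strictly positive.
  refine ⟨2 * (enH (cf (wp (T / 2))) (cf (wm (T / 2))) * Real.exp (growth a p q * I.toReal)) + 1,
    by positivity, fun t ht => ?_⟩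
  have hin : ∀ r ∈ Ico 0 T, InH 1 (cf (wp r)) ∧ InH 1 (cf (wm r)) := fun r hr =>
    ⟨((h.inH hr).1.mono hk).1, ((h.inH hr).2.mono hk).1⟩
  have htT : t ∈ Ico 0 T := ⟨by linarith [ht.1], ht.2⟩
  have hb : (t + T) / 2 < T := by linarith [ht.2]
  obtain ⟨ρ, hρ⟩ := h.exists_bddOn hk hb
  have hbdd := hρ.mono (J' := Ioo 0 ((t + T) / 2)) Ioo_subset_Icc_self
  have hsol := (h.solOn hk).mono Subset.rfl (Ioo_subset_Ioo_right hb.le)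
  have m1 : T / 2 ∈ Ioo 0 ((t + T) / 2) := ⟨by linarith, by linarith [ht.1]⟩
  have m2 : t ∈ Ioo 0 ((t + T) / 2) := ⟨by linarith [ht.1], by linarith [ht.2]⟩
  have key := energy_le_mul_exp hsol hbdd m1 m2 ht.1
  have hsub : Icc (T / 2) t ⊆ Ioo 0 ((t + T) / 2) := fun r hr =>
    ⟨m1.1.trans_le hr.1, hr.2.trans_lt m2.2⟩
  have hcont := (continuousOn_maxSum hsol hbdd).mono hsub
  have hint : IntegrableOn (fun r => maxSum (cf (wp r)) (cf (wm r))) (Ioc (T / 2) t) :=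
    (hcont.integrableOn_compact isCompact_Icc).mono_set Ioc_subset_Icc_self
  have hle : ∫ r in (T / 2)..t, maxSum (cf (wp r)) (cf (wm r)) ≤ I.toReal := by
    rw [intervalIntegral.integral_of_le ht.1, ← ENNReal.ofReal_le_iff_le_toReal hfin,
      ofReal_integral_eq_lintegral_ofReal hint (Eventually.of_forall fun _ => maxSum_nonneg _ _)]
    have hsub' : Ioc (T / 2) t ⊆ timeInterval (T : EReal) := by
      rw [timeInterval_coe]
      exact fun r hr => ⟨by linarith [hr.1], hr.2.trans_lt ht.2⟩
    refine (setLIntegral_mono' measurableSet_Ioc fun r hr => ?_).trans (lintegral_mono_set hsub')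
    obtain ⟨i1, i2⟩ := hin r (timeInterval_coe T ▸ hsub' hr)
    exact ofReal_maxSum_le i1 i2
  rw [intervalIntegral.integral_const_mul] at key
  have hexp := Real.exp_le_exp.2 (mul_le_mul_of_nonneg_left hle hg)
  have h1 := N2_W_one_sq_le_energy (hin t htT).1 (hin t htT).2
  have h2 := mul_le_mul_of_nonneg_left hexp hE
  linarith

end Solutions

/-! ### Continuation of a bounded solution beyond its time interval. -/

section Continuation

variable {a p q ρ K : ℝ} {k : ℕ}

theorem N2_W_sub_comm (k : ℕ) (x y : ℤ → ℂ) :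
    N2 (W k fun n => x n - y n) = N2 (W k fun n => y n - x n) := by
  simp only [N2]
  congr 2
  funext n
  rw [norm_W, norm_W, norm_sub_rev]

theorem N2_W_sub_triangle {x y z : ℤ → ℂ} (hx : InH k x) (hy : InH k y) (hz : InH k z) :
    N2 (W k fun n => z n - x n) ≤ N2 (W k fun n => z n - y n) + N2 (W k fun n => y n - x n) := by
  have := (Sq.add (hz.sub hy).1 (hy.sub hx).1).2
  refine le_trans (le_of_eq ?_) this
  congr 1
  funext n
  simp only [W]; ring

/-- A solution on `[0, T)` can be glued to a solution on `(c, T')` that agrees with it on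
`(c, T)`. -/
theorem glue {w z v y : ℝ → L2} {c T T' : ℝ} (hc : 0 ≤ c) (hcT : c < T) (hT : T < T')
    (hv : ∀ t < T, v t = w t) (hy : ∀ t < T, y t = z t)
    (hsol : SolOn a p q univ (Ioo c T') (fun t => cf (v t)) fun t => cf (y t))
    (hb : BddOn 1 ρ (Ioo c T') (fun t => cf (v t)) fun t => cf (y t)) (hk : 1 ≤ k) (hK : 0 ≤ K)
    (hkb : ∀ t ∈ Ioo c T', (InH k (cf (v t)) ∧ N2 (W k (cf (v t))) ≤ K) ∧
      InH k (cf (y t)) ∧ N2 (W k (cf (y t))) ≤ K)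
    (hcont : IsContH k (T : EReal) w) (hlip : IsLipH (k - 1) (T : EReal) w)
    (heq : SolvesEq a p q (T : EReal) w z) :
    IsContH k (T' : EReal) v ∧ IsLipH (k - 1) (T' : EReal) v ∧
      SolvesEq a p q (T' : EReal) v y := by
  have hmem : ∀ t < T, timeInterval (T : EReal) ∈ 𝓝[timeInterval (T' : EReal)] t := fun t ht => by
    rw [timeInterval_coe, timeInterval_coe]
    filter_upwards [self_mem_nhdsWithin, mem_nhdsWithin_of_mem_nhds (Iio_mem_nhds ht)] with s h1 h2
    exact ⟨h1.1, h2⟩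
  have hev : ∀ t < T, ∀ᶠ s in 𝓝[timeInterval (T' : EReal)] t, v s = w s := fun t ht =>
    mem_nhdsWithin_of_mem_nhds (mem_of_superset (Iio_mem_nhds ht) fun s hs => hv s hs)
  have hlt : ∀ t ∈ timeInterval (T' : EReal), t < T → t ∈ timeInterval (T : EReal) :=
    fun t ht h => by
    rw [timeInterval_coe] at ht ⊢; exact ⟨ht.1, h⟩
  have hge : ∀ t ∈ timeInterval (T' : EReal), T ≤ t → t ∈ Ioo c T' := fun t ht h => by
    rw [timeInterval_coe] at ht; exact ⟨hcT.trans_le h, ht.2⟩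
  have hin : ∀ t ∈ timeInterval (T' : EReal), MemH k (v t) := fun t ht => by
    rcases lt_or_ge t T with h | h
    · rw [hv t h]; exact hcont.1 t (hlt t ht h)
    · exact memH_iff.2 (hkb t (hge t ht h)).1.1
  refine ⟨⟨hin, fun t ht => ?_⟩, ⟨fun t ht => ?_, ?_⟩, fun t ht => ?_⟩
  · rcases lt_or_ge t T with h | h
    · refine ((hcont.2 t (hlt t ht h)).mono_left (nhdsWithin_le_of_mem (hmem t h))).congr' ?_
      filter_upwards [hev t h] with s hs
      rw [hs, hv t h]
    · exact (tendsto_hNorm_sub hsol hb (fun t ht => ⟨(hkb t ht).1.1, (hkb t ht).2.1⟩)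
        (hge t ht h)).mono_left nhdsWithin_le_nhds
  · exact memH_iff.2 ((memH_iff.1 (hin t ht)).mono (Nat.sub_le k 1)).1
  · obtain ⟨m, rfl⟩ : ∃ m, k = m + 1 := ⟨k - 1, by omega⟩
    rw [Nat.add_sub_cancel] at hlip ⊢
    intro b' hb'
    have hsub : Icc 0 b' ⊆ timeInterval (T' : EReal) := fun t ht => by
      rw [timeInterval_coe] at hb' ⊢
      exact ⟨ht.1, ht.2.trans_lt hb'.2⟩
    have hin' : ∀ t ∈ timeInterval (T' : EReal), InH m (cf (v t)) := fun t ht =>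
      ((memH_iff.1 (hin t ht)).mono (Nat.le_succ m)).1
    -- A point common to both intervals: the Lipschitz bound of the old solution holds on `[0, b]`,
    -- that of the new one on `(c, T')`, and the two are chained through `b`.
    set b := (c + T) / 2 with hbdef
    have hb1 : c < b := by rw [hbdef]; linarith
    have hb2 : b < T := by rw [hbdef]; linarith
    have hb3 : b ∈ timeInterval (T' : EReal) := by
      rw [timeInterval_coe]; exact ⟨by linarith, by linarith⟩
    obtain ⟨C, hC⟩ := hlip.2 b (hlt b hb3 hb2)
    set C₁ := 2 ^ m * |C| with hC₁
    set C₂ := Cn a p q * K * K with hC₂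
    have hC₁0 : 0 ≤ C₁ := by positivity
    have hC₂0 : 0 ≤ C₂ := mul_nonneg (mul_nonneg (Cn_nonneg a p q) hK) hK
    have l1 : ∀ s ∈ Icc 0 b, ∀ t ∈ Icc 0 b,
        N2 (W m fun n => cf (v t) n - cf (v s) n) ≤ C₁ * |t - s| := fun s hs t ht => by
      have is := hin' s (by rw [timeInterval_coe]; exact ⟨hs.1, by linarith [hs.2]⟩)
      have it := hin' t (by rw [timeInterval_coe]; exact ⟨ht.1, by linarith [ht.2]⟩)
      have h1 := N2_W_le_hNorm (k := m) (f := v t - v s) (by rw [cf_sub]; exact (it.sub is).1)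
      rw [cf_sub] at h1
      have h2 := hC s hs t ht
      rw [← hv s (by linarith [hs.2]), ← hv t (by linarith [ht.2])] at h2
      have h3 : C * |t - s| ≤ |C| * |t - s| :=
        mul_le_mul_of_nonneg_right (le_abs_self C) (abs_nonneg _)
      refine h1.trans ?_
      rw [hC₁, mul_assoc]
      exact mul_le_mul_of_nonneg_left (h2.trans h3) (by positivity)
    have l2 : ∀ s ∈ Ioo c T', ∀ t ∈ Ioo c T',
        N2 (W m fun n => cf (v t) n - cf (v s) n) ≤ C₂ * |t - s| := fun s hs t ht =>
      N2_W_sub_le hsol hK hkb hs ht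
    have l3 : ∀ s ∈ timeInterval (T' : EReal), ∀ t ∈ timeInterval (T' : EReal), s ≤ t →
        N2 (W m fun n => cf (v t) n - cf (v s) n) ≤ (C₁ + C₂) * |t - s| := fun s hs t ht hst => by
      have is := hin' s hs
      have it := hin' t ht
      rw [timeInterval_coe] at hs ht
      have hd := abs_nonneg (t - s)
      rcases le_or_gt t b with h | h
      · refine (l1 s ⟨hs.1, hst.trans h⟩ t ⟨ht.1, h⟩).trans ?_
        exact mul_le_mul_of_nonneg_right (by linarith) hd
      rcases le_or_gt b s with h' | h'
      · refine (l2 s ⟨hb1.trans_le h', hs.2⟩ t ⟨hb1.trans h, ht.2⟩).trans ?_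
        exact mul_le_mul_of_nonneg_right (by linarith) hd
      · have h1 := l1 s ⟨hs.1, h'.le⟩ b ⟨by linarith, le_rfl⟩
        have h2 := l2 b ⟨hb1, by linarith⟩ t ⟨hb1.trans h, ht.2⟩
        have h3 := N2_W_sub_triangle is (hin' b hb3) it
        rw [abs_of_pos (by linarith)] at h1 h2
        rw [abs_of_nonneg (by linarith)]
        nlinarith
    have l4 : ∀ s ∈ timeInterval (T' : EReal), ∀ t ∈ timeInterval (T' : EReal),
        N2 (W m fun n => cf (v t) n - cf (v s) n) ≤ (C₁ + C₂) * |t - s| := fun s hs t ht => by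
      rcases le_total s t with h | h
      · exact l3 s hs t ht h
      · rw [N2_W_sub_comm, abs_sub_comm]; exact l3 t ht s hs h
    refine ⟨√((m + 1) * (2 * π)) * (C₁ + C₂), fun s hs t ht => ?_⟩
    have h1 := hNorm_le (k := m) (f := v t - v s) (by
      rw [cf_sub]; exact ((hin' t (hsub ht)).sub (hin' s (hsub hs))).1)
    rw [cf_sub] at h1
    rw [mul_assoc]
    exact h1.trans (mul_le_mul_of_nonneg_left (l4 s (hsub hs) t (hsub ht)) (Real.sqrt_nonneg _))
  · rcases lt_or_ge t T with h | h
    · obtain ⟨F, hF, hae⟩ := heq t (hlt t ht h)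
      refine ⟨F, (hF.mono_of_mem_nhdsWithin (hmem t h)).congr_of_eventuallyEq (hev t h) (hv t h), ?_⟩
      rwa [hv t h, hy t h]
    · obtain ⟨F, hF, hae⟩ := exists_hasDerivAt hsol hb (hge t ht h)
      exact ⟨F, hF.hasDerivWithinAt, hae⟩

/-- A solution that stays bounded in `H¹` up to time `T` can be continued beyond `T`. -/
theorem IsSolution.exists_extension {wp₀ wm₀ : L2} {wp wm : ℝ → L2} {T R : ℝ}
    (h : IsSolution a p q k wp₀ wm₀ (T : EReal) wp wm) (hk : 1 ≤ k) (hR : 0 < R)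
    (hbound : ∀ t ∈ Ico (T / 2) T, N2 (W 1 (cf (wp t))) ^ 2 + N2 (W 1 (cf (wm t))) ^ 2 ≤ R) :
    ∃ T' : EReal, (T : EReal) < T' ∧ ∃ vp vm : ℝ → L2, IsSolution a p q k wp₀ wm₀ T' vp vm ∧
      EqOn vp wp (timeInterval (T : EReal)) ∧ EqOn vm wm (timeInterval (T : EReal)) := by
  have hT : 0 < T := by exact_mod_cast h.pos
  have hδ := lifespan_pos a p q R
  -- The bound `R` holds up to `T`, so restarting less than one life span before `T` overshoots it.
  obtain ⟨t₀, ht₀, hTt⟩ : ∃ t₀ ∈ Ico (T / 2) T, T < t₀ + lifespan a p q R :=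
    ⟨max (T / 2) (T - lifespan a p q R / 2),
      ⟨le_max_left _ _, max_lt (by linarith) (by linarith)⟩, by
        linarith [le_max_right (T / 2) (T - lifespan a p q R / 2)]⟩
  obtain ⟨i1, i2⟩ := h.inH (t := t₀) ⟨by linarith [ht₀.1], ht₀.2⟩
  obtain ⟨f, g, hf0, hg0, hsol, hbdd, hreg⟩ := local_existence a p q hR (i1.mono hk).1 (i2.mono hk).1
    (cf_sym _) (cf_sym _) (hbound t₀ ht₀)
  set δ := lifespan a p q R with hδdef
  -- The restarted solution is in `H^k` on its whole life span, although that span was fixed by the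
  -- `H¹` bound alone.
  have hreg := hreg k i1 i2
  have lift : ∀ s, ∃ u : L2 × L2, s ∈ Ioo (-δ) δ → cf u.1 = f s ∧ cf u.2 = g s := fun s => by
    by_cases hs : s ∈ Ioo (-δ) δ
    · obtain ⟨⟨b1, -, b2⟩, b3, -, b4⟩ := hbdd s hs
      obtain ⟨u, hu⟩ := exists_cf_eq b1.sq.1 b2
      obtain ⟨u', hu'⟩ := exists_cf_eq b3.sq.1 b4
      exact ⟨(u, u'), fun _ => ⟨hu, hu'⟩⟩
    · exact ⟨(0, 0), fun hs' => absurd hs' hs⟩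
  choose U hU using lift
  set c := max 0 (t₀ - δ) with hc
  have hc0 : 0 ≤ c := le_max_left _ _
  have hct : c < t₀ := max_lt (by linarith [ht₀.1]) (by linarith)
  have hshift : ∀ t ∈ Ioo c (t₀ + δ), t - t₀ ∈ Ioo (-δ) δ := fun t ht =>
    ⟨by linarith [(le_max_right 0 (t₀ - δ)).trans_lt ht.1], by linarith [ht.2]⟩
  have hsol' : SolOn a p q univ (Ioo c (t₀ + δ)) (fun t => f (t - t₀)) fun t => g (t - t₀) :=
    fun t ht n hn => by
    obtain ⟨d1, d2⟩ := hsol _ (hshift t ht) n hn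
    exact ⟨d1.comp_sub_const t t₀, d2.comp_sub_const t t₀⟩
  have hbdd' : BddOn 1 √(2 * R) (Ioo c (t₀ + δ)) (fun t => f (t - t₀)) fun t => g (t - t₀) :=
    fun t ht => hbdd _ (hshift t ht)
  -- An `H¹` bound for the given solution is available on compact subintervals, so uniqueness is
  -- applied up to a time `b < T` lying beyond both `t` and `t₀`.
  have heq : ∀ t ∈ Ioo c T, cf (wp t) = f (t - t₀) ∧ cf (wm t) = g (t - t₀) := fun t ht => by
    have hmax : max t t₀ < T := max_lt ht.2 ht₀.2
    set b := (max t t₀ + T) / 2 with hb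
    have hbT : b < T := by rw [hb]; linarith
    have hmb : max t t₀ < b := by rw [hb]; linarith
    obtain ⟨ρ, hρ⟩ := h.exists_bddOn hk hbT
    have m1 : t ∈ Ioo c b := ⟨ht.1, (le_max_left _ _).trans_lt hmb⟩
    have m2 : t₀ ∈ Ioo c b := ⟨hct, (le_max_right _ _).trans_lt hmb⟩
    have sub1 : Ioo c b ⊆ Icc 0 b := fun r hr => ⟨hc0.trans hr.1.le, hr.2.le⟩
    have sub2 : Ioo c b ⊆ Ioo c (t₀ + δ) := Ioo_subset_Ioo_right (by linarith)
    have sub3 : Ioo c b ⊆ Ioo 0 T := Ioo_subset_Ioo hc0 hbT.le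
    have hw : BddOn 1 (max ρ √(2 * R)) (Ioo c b) (fun t => cf (wp t)) fun t => cf (wm t) :=
      fun r hr => by
      obtain ⟨⟨b1, b2, b3⟩, b4, b5, b6⟩ := hρ r (sub1 hr)
      exact ⟨⟨b1, b2.trans (le_max_left _ _), b3⟩, b4, b5.trans (le_max_left _ _), b6⟩
    have hv : BddOn 1 (max ρ √(2 * R)) (Ioo c b) (fun t => f (t - t₀)) fun t => g (t - t₀) :=
      fun r hr => by
      obtain ⟨⟨b1, b2, b3⟩, b4, b5, b6⟩ := hbdd' r (sub2 hr)
      exact ⟨⟨b1, b2.trans (le_max_right _ _), b3⟩, b4, b5.trans (le_max_right _ _), b6⟩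
    exact uniqueness ((h.solOn hk).mono Subset.rfl sub3) (hsol'.mono Subset.rfl sub2) hw hv m2
      (by simp only [sub_self, hf0]) (by simp only [sub_self, hg0]) m1
  let vp : ℝ → L2 := fun t => if t < T then wp t else (U (t - t₀)).1
  let vm : ℝ → L2 := fun t => if t < T then wm t else (U (t - t₀)).2
  have hvp : ∀ t < T, vp t = wp t := fun t ht => if_pos ht
  have hvm : ∀ t < T, vm t = wm t := fun t ht => if_pos ht
  have hcf : ∀ t ∈ Ioo c (t₀ + δ), cf (vp t) = f (t - t₀) ∧ cf (vm t) = g (t - t₀) := fun t ht => by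
    rcases lt_or_ge t T with hlt | hge
    · rw [hvp t hlt, hvm t hlt]; exact heq t ⟨ht.1, hlt⟩
    · simp only [vp, vm, if_neg hge.not_gt]
      exact hU _ (hshift t ht)
  have hsolv : SolOn a p q univ (Ioo c (t₀ + δ)) (fun t => cf (vp t)) fun t => cf (vm t) :=
    fun t ht n hn => by
    obtain ⟨d1, d2⟩ := hsol' t ht n hn
    have hev : ∀ᶠ s in 𝓝 t, cf (vp s) = f (s - t₀) ∧ cf (vm s) = g (s - t₀) := by
      filter_upwards [isOpen_Ioo.mem_nhds ht] with s hs using hcf s hs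
    beta_reduce
    rw [(hcf t ht).1, (hcf t ht).2]
    exact ⟨d1.congr_of_eventuallyEq (hev.mono fun s hs => congrFun hs.1 n),
      d2.congr_of_eventuallyEq (hev.mono fun s hs => congrFun hs.2 n)⟩
  have hbv : BddOn 1 √(2 * R) (Ioo c (t₀ + δ)) (fun t => cf (vp t)) fun t => cf (vm t) :=
    fun t ht => by
    simp only [hcf t ht]
    exact hbdd' t ht
  set E := (N2 (W k (cf (wp t₀))) ^ 2 + N2 (W k (cf (wm t₀))) ^ 2) *
    Real.exp (rate a p q k (2 * R) * δ) with hE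
  have hkb : ∀ t ∈ Ioo c (t₀ + δ), (InH k (cf (vp t)) ∧ N2 (W k (cf (vp t))) ≤ √E) ∧
      InH k (cf (vm t)) ∧ N2 (W k (cf (vm t))) ≤ √E := fun t ht => by
    obtain ⟨r1, r2, r3⟩ := hreg _ (hshift t ht)
    rw [(hcf t ht).1, (hcf t ht).2]
    have hs : |t - t₀| ≤ δ := (abs_lt.2 (hshift t ht)).le
    have h1 : Real.exp (rate a p q k (2 * R) * |t - t₀|) ≤
        Real.exp (rate a p q k (2 * R) * δ) :=
      Real.exp_le_exp.2 (mul_le_mul_of_nonneg_left hs (rate_nonneg a p q k _))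
    have h2 := r3.trans (mul_le_mul_of_nonneg_left h1 (by positivity))
    exact ⟨⟨r1, Real.le_sqrt_of_sq_le (by linarith [sq_nonneg (N2 (W k (g (t - t₀))))])⟩,
      r2, Real.le_sqrt_of_sq_le (by linarith [sq_nonneg (N2 (W k (f (t - t₀))))])⟩
  have gp := glue hc0 (hct.trans ht₀.2) hTt hvp hvm hsolv hbv hk (Real.sqrt_nonneg E) hkb
    h.cont_p h.lip_p h.eq_p
  have gm := glue hc0 (hct.trans ht₀.2) hTt hvm hvp hsolv.swap hbv.swap hk (Real.sqrt_nonneg E)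
    (fun t ht => (hkb t ht).symm) h.cont_m h.lip_m h.eq_m
  refine ⟨((t₀ + δ : ℝ) : EReal), by exact_mod_cast hTt, vp, vm,
    ⟨by exact_mod_cast hT.trans hTt, (hvp 0 hT).trans h.init_p, (hvm 0 hT).trans h.init_m, gp.1,
      gm.1, gp.2.1, gm.2.1, gp.2.2, gm.2.2⟩, ?_, ?_⟩
  · intro t ht
    rw [timeInterval_coe] at ht
    exact hvp t ht.2
  · intro t ht
    rw [timeInterval_coe] at ht
    exact hvm t ht.2

end Continuation

end MHD

end

/-! ### The continuation criterion. -/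

theorem mainTheorem4 (a p q : ℝ) (k : ℕ) (hk : 1 ≤ k)
    (wp₀ wm₀ : MHD.L2) (hp₀ : MHD.MemH k wp₀) (hm₀ : MHD.MemH k wm₀)
    (T : EReal) (wp wm : ℝ → MHD.L2)
    (hmax : MHD.IsMaximalSolution a p q k wp₀ wm₀ T wp wm) :
    T = ⊤ ∨
      ∫⁻ t in MHD.timeInterval T,
        (MHD.supNorm (wp t) + MHD.supNorm (wm t) +
          MHD.supNorm (MHD.hilbert (wp t)) + MHD.supNorm (MHD.hilbert (wm t))) = ⊤ := by
  obtain ⟨hsol, hext⟩ := hmax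
  by_contra! hcon
  lift T to ℝ using ⟨hcon.1, (EReal.bot_lt_zero.trans hsol.pos).ne'⟩
  obtain ⟨R, hR, hbound⟩ := hsol.exists_bound hk hcon.2
  obtain ⟨T', hT', vp, vm, hv, heq⟩ := hsol.exists_extension hk hR hbound
  exact hext T' hT' vp vm hv heq
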